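/- **Theorem (geodesic equation for the Sobolev metric $\overline G^s$).** Let $n\ge 1$ and $s>0$, let $\mathcal F f(\xi)=(2\pi)^{-n/2}\int_{\mathbb R^n}e^{-i\langle x,\xi\rangle}f(x)\,dx$ (extended to $L^2$), and let $H^r(\mathbb R^n)=\{f\in L^2:(1+|\xi|^2)^{r/2}\mathcal Ff\in L^2\}$ for $r\ge 0$. Let $\mathrm{Diff}_c(\mathbb R^n)$ be the group of smooth diffeomorphisms of $\mathbb R^n$ that equal the identity off a compact set; a path (or a family with finitely many parameters) in it is smooth if it is jointly smooth in parameters and point, and its supports lie in a common compact set for parameters in a compact set. Let $\overline G^s_\varphi(X,Y)=\langle X\circ\varphi^{-1},Y\circ\varphi^{-1}\rangle_{\overline H^s}$ be the right invariant metric on $\mathrm{Diff}_c(\mathbb R^n)$, where $\langle u,v\rangle_{\overline H^s}=\sum_k\big(\langle u^k,v^k\rangle_{L^2}+\langle|\xi|^s\mathcal Fu^k,|\xi|^s\mathcal Fv^k\rangle_{L^2}\big)$ is the inner product of the norm $\|f\|^2=\|f\|_{L^2}^2+\||\xi|^s\mathcal Ff\|_{L^2}^2$. A smooth path $\varphi$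 over an open set $J\subseteq\mathbb R$ of times is a *geodesic* if over each $[a,b]\subset J$ it is a critical point of the energy $\frac12\int_a^b\overline G^s_\varphi(\varphi_t,\varphi_t)\,dt$ among smooth variations with fixed end points. 1. For each real $k\ge 0$ the operator $\overline A_s=\mathcal F^{-1}(1+|\xi|^{2s})\mathcal F$ is a linear isomorphism $H^{k+2s}(\mathbb R^n)\to H^k(\mathbb R^n)$, bounded with bounded inverse; $f$ is real-valued if and only if $\overline A_sf$ is. On smooth compactly supported functions it is given by the pointwise Fourier integrals. 2. $\overline A_s$ (acting componentwise) induces $\overline G^s$: for $\varphi\in\mathrm{Diff}_c(\mathbb R^n)$ and smooth compactly supported $X,Y:\mathbb R^n\to\mathbb R^n$, $$\overline G^s_\varphi(X,Y)=\int_{\mathbb R^n}\langle \overline A_s(X\circ\varphi^{-1}),Y\circ\varphi^{-1}\rangle\,dx .$$ 3. There is a function $K\in L^1(\mathbb R^n)$ which is given by the improper integral $$K(x)=|x|^{1-\frac n2}\int_0^\infty J_{\frac n2-1}(r|x|)\,\frac{r^{n/2}}{1+r^{2s}}\,dr ,$$ where $J_\alpha$ is the Bessel function of the first kind: the integrals over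 $[0,R]$ converge to $K$ as $R\to\infty$ in the sense of tempered distributions, and if $s>\frac{n-1}4$ also pointwise at every $x\ne 0$. For every smooth compactly supported $v:\mathbb R^n\to\mathbb R$, the function $\overline A_sv$ is continuous and square integrable, and it is the only such function $g$ with $v=(2\pi)^{-n/2}K\star g$. 4. Let $\varphi$ be a smooth path in $\mathrm{Diff}_c(\mathbb R^n)$ over the open set $J$, and let $u=\varphi_t\circ\varphi^{-1}$. Then $\varphi$ is a geodesic of $\overline G^s$ if and only if there is a smooth $m:J\times\mathbb R^n\to\mathbb R^n$, with $m^k(t,\cdot)\in L^2$ for all $t$ and $k$, such that for $k=1,\dots,n$ $$m^k_t=-\sum_{i=1}^n\Big(m^i\,\partial_ku^i+(\partial_im^k)\,u^i+m^k\,\partial_iu^i\Big),\qquad u^k=(2\pi)^{-\frac n2}\,K\star m^k .$$ Any such $m$ is the momentum $m=\overline A_su$. -/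

import Mathlib

open Set Filter Topology MeasureTheory
open scoped Real FourierTransform ContDiff Manifold SchwartzMap

noncomputable section

namespace SobolevDiff

/-- Euclidean space `ℝⁿ`. -/
abbrev E (n : ℕ) : Type := EuclideanSpace ℝ (Fin n)

/-- `∂ᵢ f`, for a real function `f` on `ℝⁿ`. -/
def pderiv {n : ℕ} (i : Fin n) (f : E n → ℝ) (x : E n) : ℝ :=
  fderiv ℝ f x (EuclideanSpace.single i 1)

/-! ### Fourier multipliers and Sobolev spaces

Mathlib's Fourier transform is `𝓕 f η = ∫ exp (-2πi ⟨x, η⟩) f x dx`. With the unitary transform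
`F f ξ = (2π)^(-n/2) ∫ exp (-i ⟨x, ξ⟩) f x dx` one has `F f (2πη) = (2π)^(-n/2) 𝓕 f η`. The
substitution `ξ = 2πη` therefore gives `F⁻¹ a(|ξ|) F = 𝓕⁻ a(2π|η|) 𝓕` and
`⟪a(|ξ|) F f, b(|ξ|) F g⟫_{L²(dξ)} = ⟪a(2π|η|) 𝓕 f, b(2π|η|) 𝓕 g⟫_{L²(dη)}`. -/

/-- The symbol `1 + |ξ|^(2s)` at `ξ = 2πη`. -/
def abarSymbol {n : ℕ} (s : ℝ) (η : E n) : ℝ := 1 + (2 * π * ‖η‖) ^ (2 * s)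

/-- The operator `F⁻¹ (1 + |ξ|^(2s)) F` on real-valued (test) functions on `ℝⁿ`. -/
def Abar {n : ℕ} (s : ℝ) (v : E n → ℝ) (x : E n) : ℝ :=
  (𝓕⁻ (fun η : E n => (abarSymbol s η : ℂ) * 𝓕 (fun y : E n => (v y : ℂ)) η) x).re

/-- `L²(ℝⁿ)`, with complex scalars. -/
abbrev L2 (n : ℕ) : Type := Lp ℂ 2 (volume : Measure (E n))

/-- `(1 + |ξ|²)^(r/2) F f`, at `ξ = 2πη`. -/
def weightedFourier {n : ℕ} (r : ℝ) (f : L2 n) (η : E n) : ℂ :=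
  (((1 + (2 * π * ‖η‖) ^ 2) ^ (r / 2) : ℝ) : ℂ) * (𝓕 f : L2 n) η

/-- The Sobolev space `H^r(ℝⁿ) = {f ∈ L² : (1 + |ξ|²)^(r/2) F f ∈ L²}`. -/
def SobolevSpace (n : ℕ) (r : ℝ) : Submodule ℂ (L2 n) where
  carrier := {f | MemLp (weightedFourier r f) 2 volume}
  add_mem' := by
    intro f g hf hg
    refine (MemLp.add hf hg).ae_eq ?_
    have h : (𝓕 (f + g) : L2 n) = 𝓕 f + 𝓕 g := FourierTransform.fourier_add f g
    have h2 := Lp.coeFn_add (𝓕 f : L2 n) (𝓕 g)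
    filter_upwards [h2] with η hη
    simp only [weightedFourier, Pi.add_apply, h, hη]
    ring
  zero_mem' := by
    have h : (𝓕 (0 : L2 n) : L2 n) = 0 := FourierTransform.fourier_zero
    refine (MemLp.zero (ε := ℂ) (p := 2) (μ := (volume : Measure (E n)))).ae_eq ?_
    filter_upwards [Lp.coeFn_zero ℂ 2 (volume : Measure (E n))] with η hη
    simp only [weightedFourier, h, hη, Pi.zero_apply, mul_zero]
  smul_mem' := by
    intro c f hf
    refine (MemLp.const_smul hf c).ae_eq ?_
    have h : (𝓕 (c • f) : L2 n) = c • 𝓕 f := FourierTransform.fourier_smul c f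
    filter_upwards [Lp.coeFn_smul c (𝓕 f : L2 n)] with η hη
    simp only [weightedFourier, Pi.smul_apply, h, hη, smul_eq_mul]
    ring

/-- The norm `‖f‖_{H^r} = ‖(1 + |ξ|²)^(r/2) F f‖_{L²}`. -/
def sobolevNorm {n : ℕ} (r : ℝ) (f : L2 n) : ℝ :=
  (eLpNorm (weightedFourier r f) 2 volume).toReal

/-! ### The group of compactly supported diffeomorphisms -/

/-- `Diff_c(ℝⁿ)`: smooth diffeomorphisms that equal the identity off a compact set. -/
abbrev DiffC (n : ℕ) : Type :=
  {φ : E n ≃ₘ^∞⟮𝓘(ℝ, E n), 𝓘(ℝ, E n)⟯ E n // HasCompactSupport (fun x => φ x - x)}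

/-- Compactly supported smooth vector fields on `ℝⁿ`; for every `φ` in `Diff_c(ℝⁿ)` these
are also the tangent vectors at `φ`. -/
def IsTestField {n : ℕ} (X : E n → E n) : Prop :=
  ContDiff ℝ ∞ X ∧ HasCompactSupport X

/-- Right translation `X ↦ X ∘ φ⁻¹` of a tangent vector at `φ` to the identity. -/
def rightTriv {n : ℕ} (φ : DiffC n) (X : E n → E n) (x : E n) : E n := X (φ.1.symm x)

/-- A family of elements of `Diff_c(ℝⁿ)`, with parameter in an open set `U`, is smooth:
it is jointly smooth in parameter and point, and the supports lie in one compact set as long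
as the parameter stays in a compact subset of `U`. -/
def SmoothFamilyOn {n : ℕ} {P : Type*} [NormedAddCommGroup P] [NormedSpace ℝ P]
    (U : Set P) (φ : P → DiffC n) : Prop :=
  ContDiffOn ℝ ∞ (fun q : P × E n => (φ q.1).1 q.2) (U ×ˢ univ) ∧
    ∀ K ⊆ U, IsCompact K → ∃ C : Set (E n), IsCompact C ∧ ∀ p ∈ K, ∀ x ∉ C, (φ p).1 x = x

/-- The velocity `∂ₜφ(t, ·)` of a path in `Diff_c(ℝⁿ)`, a tangent vector at `φ(t)`. -/
def velocity {n : ℕ} (φ : ℝ → DiffC n) (t : ℝ) (x : E n) : E n :=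
  deriv (fun τ => (φ τ).1 x) t

/-- The Eulerian velocity field `u(t) = φₜ ∘ φ(t)⁻¹`. -/
def eulerVelocity {n : ℕ} (φ : ℝ → DiffC n) (t : ℝ) : E n → E n :=
  rightTriv (φ t) (velocity φ t)

/-! ### The metric and its geodesics -/

/-- `|ξ|^s F f`, at `ξ = 2πη`, for a real-valued function `f`. -/
def homFourier {n : ℕ} (s : ℝ) (f : E n → ℝ) (η : E n) : ℂ :=
  (((2 * π * ‖η‖) ^ s : ℝ) : ℂ) * 𝓕 (fun y : E n => (f y : ℂ)) η

/-- The inner product of the norm `‖f‖² = ‖f‖²_{L²} + ‖|ξ|^s F f‖²_{L²}` on vector fields,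
`∑ₖ (⟨uᵏ, vᵏ⟩_{L²} + ⟨|ξ|^s F uᵏ, |ξ|^s F vᵏ⟩_{L²})`. -/
def hbarInner {n : ℕ} (s : ℝ) (u v : E n → E n) : ℝ :=
  ∑ k, ((∫ x, u x k * v x k) +
    (∫ η, inner ℂ (homFourier s (fun x => u x k) η) (homFourier s (fun x => v x k) η)).re)

/-- The right invariant metric `Ḡˢ` on `Diff_c(ℝⁿ)`. -/
def Gbar {n : ℕ} (s : ℝ) (φ : DiffC n) (X Y : E n → E n) : ℝ :=
  hbarInner s (rightTriv φ X) (rightTriv φ Y)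

/-- The energy of the part over `[a, b]` of a path. -/
def energy {n : ℕ} (s a b : ℝ) (φ : ℝ → DiffC n) : ℝ :=
  (1 / 2) * ∫ t in a..b, Gbar s (φ t) (velocity φ t) (velocity φ t)

/-- `Φ` is a smooth variation, with parameter `ε`, of `φ` over the open set `J` that fixes
the path at the times `a` and `b`. -/
def IsProperVariation {n : ℕ} (J : Set ℝ) (a b : ℝ) (φ : ℝ → DiffC n)
    (Φ : ℝ × ℝ → DiffC n) : Prop :=
  SmoothFamilyOn (univ ×ˢ J) Φ ∧ (∀ t ∈ J, Φ (0, t) = φ t) ∧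
    ∀ ε, Φ (ε, a) = φ a ∧ Φ (ε, b) = φ b

/-- The path `φ` is a geodesic of `Ḡˢ` over the open set `J` of times: over each `[a, b] ⊆ J`
it is a critical point of the energy among smooth paths with the same end points. -/
def IsGeodesicOn {n : ℕ} (s : ℝ) (J : Set ℝ) (φ : ℝ → DiffC n) : Prop :=
  ∀ a b, a < b → Icc a b ⊆ J → ∀ Φ, IsProperVariation J a b φ Φ →
    HasDerivAt (fun ε => energy s a b (fun t => Φ (ε, t))) 0 0

/-! ### The Hankel kernel -/

/-- The Bessel function of the first kind `J_α`, at `r > 0`. -/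
def besselJ (α r : ℝ) : ℝ :=
  ∑' j : ℕ, (-1) ^ j / (j.factorial * Real.Gamma (j + α + 1)) * (r / 2) ^ (2 * j + α)

/-- `|x|^(1-n/2) ∫₀ᴿ J_{n/2-1}(r|x|) r^(n/2) / (1 + r^(2s)) dr`. -/
def hankelTrunc (n : ℕ) (s R : ℝ) (x : E n) : ℝ :=
  ‖x‖ ^ (1 - (n : ℝ) / 2) *
    ∫ r in (0 : ℝ)..R, besselJ ((n : ℝ) / 2 - 1) (r * ‖x‖) *
      (r ^ ((n : ℝ) / 2) / (1 + r ^ (2 * s)))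

/-- The integrable function `K` is the kernel
`|x|^(1-n/2) ∫₀^∞ J_{n/2-1}(r|x|) r^(n/2) / (1 + r^(2s)) dr`: the improper integral converges
to `K` in the sense of distributions, and also at each point `x ≠ 0` when `s > (n-1)/4`. -/
def IsHankelKernel (n : ℕ) (s : ℝ) (K : E n → ℝ) : Prop :=
  Integrable K ∧
    (∀ ψ : 𝓢(E n, ℝ),
      Tendsto (fun R => ∫ x, hankelTrunc n s R x * ψ x) atTop (𝓝 (∫ x, K x * ψ x))) ∧
    (((n : ℝ) - 1) / 4 < s →
      ∀ x, x ≠ 0 → Tendsto (fun R => hankelTrunc n s R x) atTop (𝓝 (K x)))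

/-- `v = (2π)^(-n/2) K ⋆ g`, at every point and with absolutely convergent integrals. -/
def IsKernelConv {n : ℕ} (K g v : E n → ℝ) : Prop :=
  ∀ x, Integrable (fun y => K (x - y) * g y) ∧
    v x = (2 * π) ^ (-(n : ℝ) / 2) * ∫ y, K (x - y) * g y

/-! ### The momentum equation -/

/-- The system `mᵏₜ = -∑ᵢ (mⁱ ∂ₖuⁱ + ∂ᵢmᵏ uⁱ + mᵏ ∂ᵢuⁱ)`, `uᵏ = (2π)^(-n/2) K ⋆ mᵏ`,
for a smooth momentum `m` whose components are square integrable at each time. -/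
def SolvesMomentumSystem {n : ℕ} (J : Set ℝ) (K : E n → ℝ) (u m : ℝ → E n → E n) : Prop :=
  ContDiffOn ℝ ∞ (fun q : ℝ × E n => m q.1 q.2) (J ×ˢ univ) ∧
    ∀ t ∈ J, ∀ k,
      MemLp (fun x => m t x k) 2 volume ∧
      (∀ x, HasDerivAt (fun τ => m τ x k)
        (-∑ i, (m t x i * pderiv k (fun y => u t y i) x
          + (pderiv i (fun y => m t y k) x * u t x i
            + m t x k * pderiv i (fun y => u t y i) x))) t) ∧
      IsKernelConv K (fun x => m t x k) (fun x => u t x k)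

end SobolevDiff

end

noncomputable section

namespace SobolevDiff

variable {n : ℕ}

/-! ### Fourier transforms of integrable and square integrable functions -/

/-! The symbol `1 + |ξ|^(2s)` is real, even, at least one, and comparable from both sides with `(1 +
|ξ|²)^s`. Multiplication by it is therefore an isomorphism between the weighted L² spaces that
define `H^(k+2s)` and `H^k`, it commutes with complex conjugation of functions, and Plancherel's
formula turns it into the inner product of the metric (`exists_sobolev_isomorphism`,
`hbar_pairing`).

The kernel has to be integrable for every `s > 0`, although `1 / (1 + |ξ|^(2s))` need be neither
integrable nor smooth at the origin. The device is `exists_resolventProfile_eq_integral`: with `z =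
|ξ|²`, repeated integration by parts writes `1 / (1 + z^s)` as a superposition of truncated powers
`(1 - z/t)₊ᴺ` with a density in `L¹(dt)`. For `N = n + 2` such a power is the Fourier transform of a
dilate of one fixed integrable function. Dilates have equal L¹ norm, so the superposition of these
functions converges in L¹, to `k` (`exists_resolventKernel`).

The Hankel integral up to `R` is, by polar coordinates and the Bessel formula for spherical averages
of plane waves (`integral_sphere_cos`), the inverse Fourier integral over the ball of radius `R`.
Paired with a Schwartz function it converges to `(2π)^(n/2) k`. Pointwise, one integrates by parts:
the primitive of the oscillating factor grows like `r^((n-1)/2)` because `J_{n/2}(r) = O(r^(-1/2))`,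
and the profile decays like `r^(-2s)`, whence the threshold `(n-1)/4 < s`. The pointwise limit
agrees almost everywhere with the distributional one (`hankelLimit_ae_eq`) and is then taken as `K`.
That convolution with `K` inverts `Abar`, uniquely among continuous square integrable functions,
follows by duality from the self-adjointness of `Abar` (`eq_Abar_of_kernelConv`).

For the geodesics let `u` and `w` be the right trivialized `t`- and `ε`-derivatives of a variation.
Equality of mixed derivatives reads `∂_ε u = ∂_t w + Dw·u - Du·w`. Since `Abar` is symmetric, the
energy has derivative `∫∫ m · ∂_ε u` with `m = Abar u`, and integration by parts in time and space
turns this into `-∫∫ w · (defect of the momentum equation)` (`hasDerivAt_energy`). The variations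
`(id + δ sin ε θ(t) X) ∘ φ` realize enough fields `w` for the fundamental lemma of the calculus of
variations. All this needs `m` to be jointly smooth in time and space; that comes from `Abar = L ⋆
(1 - Δ)ᴺ` with `L` continuous (`exists_Abar_eq_convolution`). -/

theorem integral_fourier_mul_eq_flip {f g : E n → ℂ} (hf : Integrable f) (hg : Integrable g) :
    ∫ x, 𝓕 f x * g x = ∫ x, f x * 𝓕 g x := by
  have := VectorFourier.integral_fourierIntegral_smul_eq_flip (μ := (volume : Measure (E n)))
    (ν := (volume : Measure (E n))) (L := innerₗ (E n)) Real.continuous_fourierChar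
    continuous_inner hf hg
  rw [flip_innerₗ] at this
  exact this

theorem integral_fourierInv_mul_eq_flip {f g : E n → ℂ} (hf : Integrable f) (hg : Integrable g) :
    ∫ x, 𝓕⁻ f x * g x = ∫ x, f x * 𝓕⁻ g x := by
  have h := integral_fourier_mul_eq_flip hf hg.comp_neg
  rw [← integral_neg_eq_self]
  simp only [Real.fourierInv_eq_fourier_neg, neg_neg]
  rw [h]
  congr 1 with x
  rw [← Real.fourierInv_eq_fourier_neg, Real.fourierInv_eq_fourier_comp_neg]

theorem continuous_fourierInv {f : E n → ℂ} (hf : Integrable f) : Continuous (𝓕⁻ f) := by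
  have h : Continuous (𝓕 f) :=
    VectorFourier.fourierIntegral_continuous Real.continuous_fourierChar
      (by exact continuous_inner) hf
  have : 𝓕⁻ f = fun x => 𝓕 f (-x) := by
    ext x; exact Real.fourierInv_eq_fourier_neg f x
  rw [this]
  exact h.comp continuous_neg

theorem norm_fourierInv_le (f : E n → ℂ) (x : E n) : ‖𝓕⁻ f x‖ ≤ ∫ η, ‖f η‖ := by
  rw [Real.fourierInv_eq_fourier_neg]
  exact VectorFourier.norm_fourierIntegral_le_integral_norm _ _ _ f (-x)

/-- The abstract L² transform and the Fourier integral are compared as distributions: paired with a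
test function, both hand the transform over to it, the first by its extension to tempered
distributions and the second by Fubini. -/
theorem fourierInv_toLp_ae {h : E n → ℂ} (h1 : Integrable h) (h2 : MemLp h 2 volume) :
    (𝓕⁻ (h2.toLp h) : L2 n) =ᵐ[volume] 𝓕⁻ h := by
  refine ae_eq_of_integral_contDiff_smul_eq ((Lp.memLp _).locallyIntegrable (by norm_num))
    (continuous_fourierInv h1).locallyIntegrable ?_
  intro g hg hgc
  have hg₁ : HasCompactSupport (Complex.ofRealCLM ∘ g) := hgc.comp_left rfl
  have hg₂ : ContDiff ℝ ∞ (Complex.ofRealCLM ∘ g) := by fun_prop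
  set G : 𝓢(E n, ℂ) := hg₁.toSchwartzMap hg₂ with hG
  have e1 : ∫ x, g x • (𝓕⁻ (h2.toLp h) : L2 n) x
      = (((𝓕⁻ (h2.toLp h) : L2 n)) : 𝓢'(E n, ℂ)) G := by
    rw [Lp.toTemperedDistribution_apply]
    simp [hG]
  rw [e1, ← Lp.fourierInv_toTemperedDistribution_eq, TemperedDistribution.fourierInv_apply,
    Lp.toTemperedDistribution_apply]
  have e2 : ∫ x, (𝓕⁻ G) x • (h2.toLp h : L2 n) x = ∫ x, 𝓕⁻ (G : E n → ℂ) x * h x := by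
    apply integral_congr_ae
    filter_upwards [h2.coeFn_toLp] with x hx
    rw [hx, ← SchwartzMap.fourierInv_coe, smul_eq_mul]
  rw [e2, integral_fourierInv_mul_eq_flip G.integrable h1]
  simp [hG]

theorem memLp_fourierInv {h : E n → ℂ} (h1 : Integrable h) (h2 : MemLp h 2 volume) :
    MemLp (𝓕⁻ h) 2 volume :=
  (Lp.memLp (𝓕⁻ (h2.toLp h) : L2 n)).ae_eq (fourierInv_toLp_ae h1 h2)

/-! ### The symbol -/

theorem one_le_abarSymbol (s : ℝ) (η : E n) : 1 ≤ abarSymbol s η := by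
  unfold abarSymbol
  have : 0 ≤ (2 * π * ‖η‖) ^ (2 * s) := by positivity
  linarith

theorem abarSymbol_pos (s : ℝ) (η : E n) : 0 < abarSymbol s η :=
  zero_lt_one.trans_le (one_le_abarSymbol s η)

theorem abarSymbol_neg (s : ℝ) (η : E n) : abarSymbol s (-η) = abarSymbol s η := by
  simp [abarSymbol]

theorem continuous_abarSymbol {s : ℝ} (hs : 0 < s) : Continuous (abarSymbol (n := n) s) := by
  unfold abarSymbol
  refine continuous_const.add (Continuous.rpow_const (by fun_prop) fun x => Or.inr (by positivity))

theorem abarSymbol_le {s : ℝ} (hs : 0 < s) (η : E n) :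
    abarSymbol s η ≤ 2 * (1 + (2 * π * ‖η‖) ^ 2) ^ s := by
  have h1 : (1 : ℝ) ≤ (1 + (2 * π * ‖η‖) ^ 2) ^ s :=
    Real.one_le_rpow (by nlinarith [sq_nonneg (2 * π * ‖η‖)]) hs.le
  have h2 : (2 * π * ‖η‖) ^ (2 * s) ≤ (1 + (2 * π * ‖η‖) ^ 2) ^ s := by
    rw [Real.rpow_mul (by positivity), Real.rpow_two]
    exact Real.rpow_le_rpow (by positivity) (by linarith) hs.le
  unfold abarSymbol
  linarith

/-- The larger of `1` and `r ^ 2` is at least half of their sum, whence the constant `2 ^ s`. With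
`abarSymbol_le` this is the comparability on which the isomorphism of Sobolev spaces rests. -/
theorem le_abarSymbol {s : ℝ} (hs : 0 < s) (η : E n) :
    (1 + (2 * π * ‖η‖) ^ 2) ^ s ≤ 2 ^ s * abarSymbol s η := by
  unfold abarSymbol
  set r := 2 * π * ‖η‖ with hr
  have hr0 : 0 ≤ r := by positivity
  rw [Real.rpow_mul hr0, Real.rpow_two]
  rcases le_total (r ^ 2) 1 with h | h
  · calc (1 + r ^ 2) ^ s ≤ 2 ^ s := Real.rpow_le_rpow (by positivity) (by linarith) hs.le
      _ ≤ 2 ^ s * (1 + (r ^ 2) ^ s) := by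
        have : 0 ≤ (r ^ 2) ^ s := by positivity
        nlinarith [Real.rpow_pos_of_pos (zero_lt_two : (0:ℝ) < 2) s]
  · calc (1 + r ^ 2) ^ s ≤ (2 * r ^ 2) ^ s := Real.rpow_le_rpow (by positivity) (by linarith) hs.le
      _ = 2 ^ s * (r ^ 2) ^ s := Real.mul_rpow (by norm_num) (by positivity)
      _ ≤ _ := by
        have : 0 < (2:ℝ) ^ s := by positivity
        nlinarith

/-- Temperate growth of the symbol, by a natural power of `1 + ‖η‖`. -/
theorem exists_abarSymbol_le_pow {s : ℝ} (hs : 0 < s) :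
    ∃ (C : ℝ) (N : ℕ), 0 < C ∧ ∀ η : E n, abarSymbol s η ≤ C * (1 + ‖η‖) ^ N := by
  obtain ⟨N, hN⟩ := exists_nat_ge (2 * s)
  refine ⟨1 + (2 * π) ^ (2 * s), N, by positivity, fun η => ?_⟩
  have h1 : (1 : ℝ) ≤ (1 + ‖η‖) ^ N := one_le_pow₀ (by linarith [norm_nonneg η])
  have h2 : ‖η‖ ^ (2 * s) ≤ (1 + ‖η‖) ^ N := by
    calc ‖η‖ ^ (2 * s) ≤ (1 + ‖η‖) ^ (2 * s) :=
          Real.rpow_le_rpow (norm_nonneg _) (by linarith) (by positivity)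
      _ ≤ (1 + ‖η‖) ^ (N : ℝ) :=
          Real.rpow_le_rpow_of_exponent_le (by linarith [norm_nonneg η]) hN
      _ = _ := Real.rpow_natCast _ _
  unfold abarSymbol
  rw [Real.mul_rpow (by positivity) (norm_nonneg _)]
  have : 0 < (2 * π) ^ (2 * s) := by positivity
  nlinarith

/-! ### The operator on test functions -/

/-- The weight `1 + ‖η‖` is not smooth at the origin; the smooth weight `2 * (1 + ‖η‖ ^ 2)`
dominates it and keeps the product a Schwartz function. -/
theorem exists_schwartz_weight (G : 𝓢(E n, ℂ)) (N : ℕ) :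
    ∃ H : 𝓢(E n, ℂ), ∀ η, (1 + ‖η‖) ^ N * ‖G η‖ ≤ ‖H η‖ := by
  have hg : Function.HasTemperateGrowth (fun η : E n => (2 * (1 + ‖η‖ ^ 2)) ^ N) := by fun_prop
  refine ⟨SchwartzMap.smulLeftCLM ℂ (fun η : E n => (2 * (1 + ‖η‖ ^ 2)) ^ N) G, fun η => ?_⟩
  rw [SchwartzMap.smulLeftCLM_apply_apply hg, norm_smul, Real.norm_of_nonneg (by positivity)]
  gcongr
  nlinarith [sq_nonneg (‖η‖ - 1), norm_nonneg η]

theorem memLp_mul_schwartz {a : E n → ℂ} (ha : AEStronglyMeasurable a volume) {C : ℝ} {N : ℕ}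
    (h : ∀ η, ‖a η‖ ≤ C * (1 + ‖η‖) ^ N) (G : 𝓢(E n, ℂ)) (q : ENNReal) :
    MemLp (fun η => a η * G η) q volume := by
  obtain ⟨H, hH⟩ := exists_schwartz_weight G N
  refine MemLp.of_le_mul (c := C) (H.memLp q volume)
    (ha.mul G.continuous.aestronglyMeasurable) (ae_of_all _ fun η => ?_)
  have hC : 0 ≤ C := by
    have := (norm_nonneg _).trans (h 0)
    simpa using this
  calc ‖a η * G η‖ ≤ (C * (1 + ‖η‖) ^ N) * ‖G η‖ := by
        rw [norm_mul]; gcongr; exact h η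
    _ = C * ((1 + ‖η‖) ^ N * ‖G η‖) := by ring
    _ ≤ _ := by gcongr; exact hH η

/-- A real test function, as a complex Schwartz function. -/
def testSchwartz {v : E n → ℝ} (hv : ContDiff ℝ ∞ v) (hc : HasCompactSupport v) : 𝓢(E n, ℂ) :=
  (hc.comp_left (g := fun r : ℝ => (r : ℂ)) (by simp)).toSchwartzMap
    (Complex.ofRealCLM.contDiff.comp hv)

@[simp]
theorem testSchwartz_coe {v : E n → ℝ} (hv : ContDiff ℝ ∞ v) (hc : HasCompactSupport v) :
    (testSchwartz hv hc : E n → ℂ) = fun x => (v x : ℂ) := rfl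

theorem fourier_testSchwartz {v : E n → ℝ} (hv : ContDiff ℝ ∞ v) (hc : HasCompactSupport v) :
    ((𝓕 (testSchwartz hv hc) : 𝓢(E n, ℂ)) : E n → ℂ) = 𝓕 (fun x => (v x : ℂ)) := by
  rw [SchwartzMap.fourier_coe, testSchwartz_coe]

theorem memLp_fourier_test {v : E n → ℝ} (hv : ContDiff ℝ ∞ v) (hc : HasCompactSupport v)
    (q : ENNReal) : MemLp (𝓕 (fun x => (v x : ℂ))) q volume := by
  rw [← fourier_testSchwartz hv hc]
  exact (𝓕 (testSchwartz hv hc)).memLp q volume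

theorem memLp_mul_fourier_test {a : E n → ℂ} (ha : AEStronglyMeasurable a volume) {C : ℝ} {N : ℕ}
    (h : ∀ η, ‖a η‖ ≤ C * (1 + ‖η‖) ^ N) {v : E n → ℝ} (hv : ContDiff ℝ ∞ v)
    (hc : HasCompactSupport v) (q : ENNReal) :
    MemLp (fun η => a η * 𝓕 (fun x => (v x : ℂ)) η) q volume := by
  rw [← fourier_testSchwartz hv hc]
  exact memLp_mul_schwartz ha h _ q

theorem memLp_symbol_fourier {s : ℝ} (hs : 0 < s) {v : E n → ℝ} (hv : ContDiff ℝ ∞ v)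
    (hc : HasCompactSupport v) (q : ENNReal) :
    MemLp (fun η : E n => (abarSymbol s η : ℂ) * 𝓕 (fun y : E n => (v y : ℂ)) η) q volume := by
  obtain ⟨C, N, -, h⟩ := exists_abarSymbol_le_pow (n := n) hs
  refine memLp_mul_fourier_test (C := C) (N := N) ?_ (fun η => ?_) hv hc q
  · exact (Complex.continuous_ofReal.comp (continuous_abarSymbol hs)).aestronglyMeasurable
  · rw [Complex.norm_real, Real.norm_of_nonneg (abarSymbol_pos s η).le]
    exact h η

theorem integrable_symbol_fourier {s : ℝ} (hs : 0 < s) {v : E n → ℝ} (hv : ContDiff ℝ ∞ v)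
    (hc : HasCompactSupport v) :
    Integrable (fun η : E n => (abarSymbol s η : ℂ) * 𝓕 (fun y : E n => (v y : ℂ)) η) :=
  memLp_one_iff_integrable.1 (memLp_symbol_fourier hs hv hc 1)

theorem integrable_test {v : E n → ℝ} (hv : ContDiff ℝ ∞ v) (hc : HasCompactSupport v) :
    Integrable (fun x => (v x : ℂ)) := (testSchwartz hv hc).integrable

theorem conj_fourier (f : E n → ℂ) (η : E n) :
    (starRingEnd ℂ) (𝓕 f η) = 𝓕⁻ (fun x => (starRingEnd ℂ) (f x)) η := by
  rw [Real.fourier_eq', Real.fourierInv_eq', ← integral_conj]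
  congr 1 with x
  simp only [smul_eq_mul, map_mul, ← Complex.exp_conj, Complex.conj_I, Complex.conj_ofReal]
  congr 2
  push_cast
  ring

theorem conj_fourier_real (v : E n → ℝ) (η : E n) :
    (starRingEnd ℂ) (𝓕 (fun x => (v x : ℂ)) η) = 𝓕⁻ (fun x => (v x : ℂ)) η := by
  simp [conj_fourier]

theorem conj_fourierInv (f : E n → ℂ) (η : E n) :
    (starRingEnd ℂ) (𝓕⁻ f η) = 𝓕⁻ (fun x => (starRingEnd ℂ) (f (-x))) η := by
  rw [Real.fourierInv_eq_fourier_comp_neg, conj_fourier]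

/-- The inverse Fourier transform of a Hermitian function is real. -/
theorem fourierInv_eq_ofReal_re {f : E n → ℂ} (hf : ∀ η, (starRingEnd ℂ) (f (-η)) = f η)
    (x : E n) : ((𝓕⁻ f x).re : ℂ) = 𝓕⁻ f x := by
  rw [← Complex.conj_eq_iff_re, conj_fourierInv]
  simp only [hf]

/-- The symbol is real and even and `v` is real, so the function being inverted is Hermitian and the
real part in the definition of `Abar` discards nothing. -/
theorem Abar_eq_fourierInv (s : ℝ) (v : E n → ℝ) (x : E n) : (Abar s v x : ℂ) =
    𝓕⁻ (fun η : E n => (abarSymbol s η : ℂ) * 𝓕 (fun y : E n => (v y : ℂ)) η) x := by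
  unfold Abar
  refine fourierInv_eq_ofReal_re (fun η => ?_) x
  rw [map_mul, Complex.conj_ofReal, abarSymbol_neg, conj_fourier_real,
    Real.fourierInv_eq_fourier_neg, neg_neg]

theorem continuous_Abar {s : ℝ} (hs : 0 < s) {v : E n → ℝ} (hv : ContDiff ℝ ∞ v)
    (hc : HasCompactSupport v) : Continuous (Abar s v) :=
  Complex.continuous_re.comp (continuous_fourierInv (integrable_symbol_fourier hs hv hc))

theorem memLp_Abar {s : ℝ} (hs : 0 < s) {v : E n → ℝ} (hv : ContDiff ℝ ∞ v)
    (hc : HasCompactSupport v) : MemLp (Abar s v) 2 volume :=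
  (memLp_fourierInv (integrable_symbol_fourier hs hv hc) (memLp_symbol_fourier hs hv hc 2)).re

theorem exists_abs_Abar_le (s : ℝ) (v : E n → ℝ) : ∃ C, ∀ x, |Abar s v x| ≤ C :=
  ⟨_, fun x => (Complex.abs_re_le_norm _).trans (norm_fourierInv_le _ x)⟩

theorem fourierInv_fourier_test {v : E n → ℝ} (hv : ContDiff ℝ ∞ v) (hc : HasCompactSupport v) :
    𝓕⁻ (𝓕 (fun x => (v x : ℂ))) = fun x => (v x : ℂ) := by
  have h := (testSchwartz hv hc).integrable (μ := volume)
  refine Continuous.fourierInv_fourier_eq (Complex.continuous_ofReal.comp hv.continuous) h ?_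
  exact memLp_one_iff_integrable.1 (memLp_fourier_test hv hc 1)

theorem integrable_Abar_mul {s : ℝ} (hs : 0 < s) {v w : E n → ℝ} (hv : ContDiff ℝ ∞ v)
    (hc : HasCompactSupport v) (hw : Continuous w) (hwc : HasCompactSupport w) :
    Integrable (fun x => Abar s v x * w x) :=
  ((continuous_Abar hs hv hc).mul hw).integrable_of_hasCompactSupport hwc.mul_left

theorem integral_Abar_mul {s : ℝ} (hs : 0 < s) {v w : E n → ℝ} (hv : ContDiff ℝ ∞ v)
    (hc : HasCompactSupport v) (hw : ContDiff ℝ ∞ w) (hwc : HasCompactSupport w) :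
    ((∫ x, Abar s v x * w x : ℝ) : ℂ) =
      ∫ η, (abarSymbol s η : ℂ) * 𝓕 (fun y : E n => (v y : ℂ)) η *
        𝓕⁻ (fun y : E n => (w y : ℂ)) η := by
  rw [← integral_fourierInv_mul_eq_flip (integrable_symbol_fourier hs hv hc)
    (integrable_test hw hwc), ← integral_complex_ofReal]
  congr 1 with x
  rw [← Abar_eq_fourierInv]
  push_cast
  rfl

/-- Self-adjointness of `Abar`: on the frequency side the substitution `η ↦ -η` exchanges `v` and
`w` because the symbol is even. -/
theorem integral_Abar_mul_comm {s : ℝ} (hs : 0 < s) {v w : E n → ℝ} (hv : ContDiff ℝ ∞ v)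
    (hc : HasCompactSupport v) (hw : ContDiff ℝ ∞ w) (hwc : HasCompactSupport w) :
    ∫ x, Abar s v x * w x = ∫ x, v x * Abar s w x := by
  have h : ∫ x, v x * Abar s w x = ∫ x, Abar s w x * v x := by simp only [mul_comm]
  rw [h]
  apply Complex.ofReal_injective
  rw [integral_Abar_mul hs hv hc hw hwc, integral_Abar_mul hs hw hwc hv hc,
    ← integral_neg_eq_self]
  congr 1 with η
  rw [abarSymbol_neg, ← Real.fourierInv_eq_fourier_neg,
    Real.fourierInv_eq_fourier_neg _ (-η), neg_neg]
  ring

/-- Polarized Plancherel formula. The second term on the left carries the multiplier `|ξ|^(2s)`,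
which is the symbol minus one, and the first term supplies the missing one. -/
theorem hbar_pairing {s : ℝ} (hs : 0 < s) {v w : E n → ℝ} (hv : ContDiff ℝ ∞ v)
    (hc : HasCompactSupport v) (hw : ContDiff ℝ ∞ w) (hwc : HasCompactSupport w) :
    (∫ x, v x * w x) + (∫ η, inner ℂ (homFourier s v η) (homFourier s w η)).re =
      ∫ x, Abar s v x * w x := by
  have hw2 := memLp_fourier_test hw hwc 2
  have hv2 := memLp_fourier_test hv hc 2
  have i1 : Integrable fun η => 𝓕 (fun y : E n => (w y : ℂ)) η *
      𝓕⁻ (fun y : E n => (v y : ℂ)) η := by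
    simp_rw [← conj_fourier_real]
    exact hw2.integrable_mul hv2.star
  have i2 : Integrable fun η => (abarSymbol s η : ℂ) * 𝓕 (fun y : E n => (w y : ℂ)) η *
      𝓕⁻ (fun y : E n => (v y : ℂ)) η := by
    simp_rw [← conj_fourier_real]
    exact (memLp_symbol_fourier hs hw hwc 2).integrable_mul hv2.star
  have h1 : ((∫ x, v x * w x : ℝ) : ℂ) = ∫ η, 𝓕 (fun y : E n => (w y : ℂ)) η *
      𝓕⁻ (fun y : E n => (v y : ℂ)) η := by
    rw [← integral_fourierInv_mul_eq_flip (memLp_one_iff_integrable.1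
      (memLp_fourier_test hw hwc 1)) (integrable_test hv hc), fourierInv_fourier_test hw hwc,
      ← integral_complex_ofReal]
    congr 1 with x
    push_cast
    ring
  have h2 : ((∫ x, Abar s v x * w x : ℝ) : ℂ) = ∫ η, (abarSymbol s η : ℂ) *
      𝓕 (fun y : E n => (w y : ℂ)) η * 𝓕⁻ (fun y : E n => (v y : ℂ)) η := by
    rw [integral_Abar_mul_comm hs hv hc hw hwc]
    simp only [mul_comm (v _)]
    exact integral_Abar_mul hs hw hwc hv hc
  have h3 : ∫ η, inner ℂ (homFourier s v η) (homFourier s w η) =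
      (∫ η, (abarSymbol s η : ℂ) * 𝓕 (fun y : E n => (w y : ℂ)) η *
        𝓕⁻ (fun y : E n => (v y : ℂ)) η) -
      ∫ η, 𝓕 (fun y : E n => (w y : ℂ)) η * 𝓕⁻ (fun y : E n => (v y : ℂ)) η := by
    rw [← integral_sub i2 i1]
    congr 1 with η
    have h4 : ((2 * π * ‖η‖) ^ (2 * s) : ℝ) = (2 * π * ‖η‖) ^ s * (2 * π * ‖η‖) ^ s := by
      rw [two_mul s, Real.rpow_add_of_nonneg (by positivity) hs.le hs.le]
    simp only [homFourier, abarSymbol, h4, ← conj_fourier_real, RCLike.inner_apply, map_mul,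
      Complex.conj_ofReal]
    push_cast
    ring
  rw [h3, ← h1, ← h2]
  simp

/-! ### Sobolev spaces -/

theorem integral_smul_fourier_L2 (f : L2 n) {g : E n → ℝ} (hg : ContDiff ℝ ∞ g)
    (hc : HasCompactSupport g) :
    ∫ x, g x • (𝓕 f : L2 n) x = ∫ x, 𝓕 (fun y => (g y : ℂ)) x * f x := by
  have e1 : ∫ x, g x • (𝓕 f : L2 n) x = ((𝓕 f : L2 n) : 𝓢'(E n, ℂ)) (testSchwartz hg hc) := by
    rw [Lp.toTemperedDistribution_apply]
    simp
  rw [e1, ← Lp.fourier_toTemperedDistribution_eq, TemperedDistribution.fourier_apply,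
    Lp.toTemperedDistribution_apply, fourier_testSchwartz]
  rfl

/-- No integral formula can be conjugated on all of L². The Hermitian symmetry is therefore checked
weakly, against real test functions, whose own transforms are given by integrals. -/
theorem fourier_star_ae (f : L2 n) :
    (𝓕 (star f) : L2 n) =ᵐ[volume] fun η => (starRingEnd ℂ) ((𝓕 f : L2 n) (-η)) := by
  have hneg : MeasurePreserving (fun x : E n => -x) volume volume :=
    Measure.measurePreserving_neg volume
  have hm : MemLp (fun η => (starRingEnd ℂ) ((𝓕 f : L2 n) (-η))) 2 volume :=
    ((Lp.memLp (𝓕 f : L2 n)).comp_measurePreserving hneg).star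
  refine ae_eq_of_integral_contDiff_smul_eq ((Lp.memLp _).locallyIntegrable (by norm_num))
    (hm.locallyIntegrable (by norm_num)) fun g hg hc => ?_
  rw [integral_smul_fourier_L2 _ hg hc]
  have hg' : ContDiff ℝ ∞ (fun x => g (-x)) := hg.comp contDiff_neg
  have hc' : HasCompactSupport (fun x => g (-x)) := hc.comp_homeomorph (Homeomorph.neg (E n))
  have h1 := integral_smul_fourier_L2 f hg' hc'
  have h2 : ∫ x, g x • (starRingEnd ℂ) ((𝓕 f : L2 n) (-x)) =
      (starRingEnd ℂ) (∫ x, g (-x) • (𝓕 f : L2 n) x) := by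
    rw [← integral_conj, ← integral_neg_eq_self]
    simp [Complex.real_smul]
  rw [h2, h1, ← integral_conj]
  apply integral_congr_ae
  filter_upwards [Lp.coeFn_star f] with x hx
  rw [hx, Pi.star_apply, map_mul, conj_fourier_real, Real.fourierInv_eq_fourier_comp_neg]
  simp

theorem real_iff_star_eq (f : L2 n) : (∀ᵐ x, (f x).im = 0) ↔ star f = f := by
  rw [Lp.ext_iff]
  constructor
  · intro h
    filter_upwards [h, Lp.coeFn_star f] with x hx h2
    rw [h2, Pi.star_apply]
    exact Complex.conj_eq_iff_im.2 hx
  · intro h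
    filter_upwards [h, Lp.coeFn_star f] with x hx h2
    rw [h2, Pi.star_apply] at hx
    exact Complex.conj_eq_iff_im.1 hx

theorem fourier_L2_injective : Function.Injective (𝓕 : L2 n → L2 n) := fun f g h => by
  have h1 : (𝓕⁻ (𝓕 f : L2 n) : L2 n) = f := FourierTransform.fourierInv_fourier_eq f
  have h2 : (𝓕⁻ (𝓕 g : L2 n) : L2 n) = g := FourierTransform.fourierInv_fourier_eq g
  rw [← h1, h, h2]

/-- The weight `(1 + |ξ|²)^(r/2)` at `ξ = 2πη`. -/
def sobolevWeight (r : ℝ) (η : E n) : ℝ := (1 + (2 * π * ‖η‖) ^ 2) ^ (r / 2)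

theorem sobolevWeight_pos (r : ℝ) (η : E n) : 0 < sobolevWeight r η := by
  unfold sobolevWeight; positivity

theorem one_le_sobolevWeight {r : ℝ} (hr : 0 ≤ r) (η : E n) : 1 ≤ sobolevWeight r η :=
  Real.one_le_rpow (by nlinarith [sq_nonneg (2 * π * ‖η‖)]) (by positivity)

theorem continuous_sobolevWeight (r : ℝ) : Continuous (sobolevWeight (n := n) r) := by
  unfold sobolevWeight
  exact Continuous.rpow_const (by fun_prop) fun x => Or.inl (by positivity)

theorem sobolevWeight_add (k s : ℝ) (η : E n) :
    sobolevWeight (k + 2 * s) η = sobolevWeight k η * (1 + (2 * π * ‖η‖) ^ 2) ^ s := by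
  unfold sobolevWeight
  rw [← Real.rpow_add (by positivity)]
  congr 1
  ring

theorem sobolevWeight_mul_abarSymbol_le {s : ℝ} (hs : 0 < s) (k : ℝ) (η : E n) :
    sobolevWeight k η * abarSymbol s η ≤ 2 * sobolevWeight (k + 2 * s) η := by
  rw [sobolevWeight_add]
  nlinarith [abarSymbol_le hs η, sobolevWeight_pos k η]

theorem sobolevWeight_le_mul_abarSymbol {s : ℝ} (hs : 0 < s) (k : ℝ) (η : E n) :
    sobolevWeight (k + 2 * s) η ≤ 2 ^ s * (sobolevWeight k η * abarSymbol s η) := by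
  rw [sobolevWeight_add]
  nlinarith [le_abarSymbol hs η, sobolevWeight_pos k η]

theorem weightedFourier_eq (r : ℝ) (f : L2 n) (η : E n) :
    weightedFourier r f η = (sobolevWeight r η : ℂ) * (𝓕 f : L2 n) η := rfl

theorem norm_weightedFourier (r : ℝ) (f : L2 n) (η : E n) :
    ‖weightedFourier r f η‖ = sobolevWeight r η * ‖(𝓕 f : L2 n) η‖ := by
  rw [weightedFourier_eq, norm_mul, Complex.norm_real,
    Real.norm_of_nonneg (sobolevWeight_pos r η).le]

theorem aestronglyMeasurable_weightedFourier (r : ℝ) (f : L2 n) :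
    AEStronglyMeasurable (weightedFourier r f) volume :=
  ((Complex.continuous_ofReal.comp (continuous_sobolevWeight r)).aestronglyMeasurable).mul
    (Lp.aestronglyMeasurable _)

theorem norm_weightedFourier_le_of_symbol {s : ℝ} (hs : 0 < s) (k : ℝ) {f g : L2 n}
    (h : (𝓕 g : L2 n) =ᵐ[volume] fun η => (abarSymbol s η : ℂ) * (𝓕 f : L2 n) η) :
    (∀ᵐ η, ‖weightedFourier k g η‖ ≤ 2 * ‖weightedFourier (k + 2 * s) f η‖) ∧
    ∀ᵐ η, ‖weightedFourier (k + 2 * s) f η‖ ≤ 2 ^ s * ‖weightedFourier k g η‖ := by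
  constructor
  · filter_upwards [h] with η hη
    rw [norm_weightedFourier, norm_weightedFourier, hη, norm_mul, Complex.norm_real,
      Real.norm_of_nonneg (abarSymbol_pos s η).le, ← mul_assoc, ← mul_assoc]
    exact mul_le_mul_of_nonneg_right (sobolevWeight_mul_abarSymbol_le hs k η) (norm_nonneg _)
  · filter_upwards [h] with η hη
    rw [norm_weightedFourier, norm_weightedFourier, hη, norm_mul, Complex.norm_real,
      Real.norm_of_nonneg (abarSymbol_pos s η).le, ← mul_assoc, ← mul_assoc]
    refine mul_le_mul_of_nonneg_right ?_ (norm_nonneg _)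
    have := sobolevWeight_le_mul_abarSymbol hs k η
    linarith

theorem mem_sobolevSpace_iff_of_symbol {s : ℝ} (hs : 0 < s) (k : ℝ) {f g : L2 n}
    (h : (𝓕 g : L2 n) =ᵐ[volume] fun η => (abarSymbol s η : ℂ) * (𝓕 f : L2 n) η) :
    g ∈ SobolevSpace n k ↔ f ∈ SobolevSpace n (k + 2 * s) := by
  obtain ⟨h1, h2⟩ := norm_weightedFourier_le_of_symbol hs k h
  exact ⟨fun hg => MemLp.of_le_mul hg (aestronglyMeasurable_weightedFourier _ _) h2,
    fun hf => MemLp.of_le_mul hf (aestronglyMeasurable_weightedFourier _ _) h1⟩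

theorem sobolevNorm_le_of_le {f g : L2 n} {k r C : ℝ} (hC : 0 ≤ C) (hf : f ∈ SobolevSpace n r)
    (h : ∀ᵐ η, ‖weightedFourier k g η‖ ≤ C * ‖weightedFourier r f η‖) :
    sobolevNorm k g ≤ C * sobolevNorm r f := by
  have h1 := eLpNorm_le_mul_eLpNorm_of_ae_le_mul h 2
  have hf' : eLpNorm (weightedFourier r f) 2 volume < ⊤ := MemLp.eLpNorm_lt_top hf
  unfold sobolevNorm
  refine (ENNReal.toReal_mono (ENNReal.mul_ne_top ENNReal.ofReal_ne_top hf'.ne) h1).trans ?_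
  rw [ENNReal.toReal_mul, ENNReal.toReal_ofReal hC]

theorem exists_fourier_eq {h : E n → ℂ} (hh : MemLp h 2 volume) :
    ∃ g : L2 n, (𝓕 g : L2 n) =ᵐ[volume] h := by
  refine ⟨𝓕⁻ (hh.toLp h), ?_⟩
  rw [FourierTransform.fourier_fourierInv_eq]
  exact hh.coeFn_toLp

theorem memLp_symbol_mul_fourier {s : ℝ} (hs : 0 < s) {k : ℝ} (hk : 0 ≤ k) {f : L2 n}
    (hf : f ∈ SobolevSpace n (k + 2 * s)) :
    MemLp (fun η => (abarSymbol s η : ℂ) * (𝓕 f : L2 n) η) 2 volume := by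
  refine MemLp.of_le_mul (c := 2) hf
    (((Complex.continuous_ofReal.comp (continuous_abarSymbol hs)).aestronglyMeasurable).mul
      (Lp.aestronglyMeasurable _)) (ae_of_all _ fun η => ?_)
  rw [norm_weightedFourier, norm_mul, Complex.norm_real,
      Real.norm_of_nonneg (abarSymbol_pos s η).le, ← mul_assoc]
  refine mul_le_mul_of_nonneg_right ?_ (norm_nonneg _)
  -- Here `0 ≤ k` enters: the weight of order `k` is at least one, so leaving it out only decreases
  -- the left side.
  refine le_trans ?_ (sobolevWeight_mul_abarSymbol_le hs k η)
  nlinarith [one_le_sobolevWeight hk η, abarSymbol_pos s η]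

theorem memLp_inv_symbol_mul {s : ℝ} (hs : 0 < s) {f : E n → ℂ} (hf : MemLp f 2 volume) :
    MemLp (fun η => ((abarSymbol s η)⁻¹ : ℂ) * f η) 2 volume := by
  refine MemLp.of_le_mul (c := 1) hf (((Complex.continuous_ofReal.comp
    (continuous_abarSymbol hs)).measurable.inv.aestronglyMeasurable).mul hf.1)
    (ae_of_all _ fun η => ?_)
  rw [norm_mul, norm_inv, Complex.norm_real, Real.norm_of_nonneg (abarSymbol_pos s η).le]
  exact mul_le_mul_of_nonneg_right (inv_le_one_of_one_le₀ (one_le_abarSymbol s η)) (norm_nonneg _)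

theorem eq_of_fourier_ae_eq {f g : L2 n} (h : (𝓕 f : L2 n) =ᵐ[volume] (𝓕 g : L2 n)) : f = g :=
  fourier_L2_injective (Lp.ext h)

/-- The operator with symbol `1 + |ξ|^(2s)` from `H^(k+2s)` to `H^k`. -/
def sobolevMap {s : ℝ} (hs : 0 < s) {k : ℝ} (hk : 0 ≤ k) (f : SobolevSpace n (k + 2 * s)) :
    SobolevSpace n k :=
  ⟨(exists_fourier_eq (memLp_symbol_mul_fourier hs hk f.2)).choose,
    (mem_sobolevSpace_iff_of_symbol hs k
      (exists_fourier_eq (memLp_symbol_mul_fourier hs hk f.2)).choose_spec).2 f.2⟩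

theorem fourier_sobolevMap {s : ℝ} (hs : 0 < s) {k : ℝ} (hk : 0 ≤ k)
    (f : SobolevSpace n (k + 2 * s)) :
    (𝓕 (sobolevMap hs hk f : L2 n) : L2 n) =ᵐ[volume]
      fun η => (abarSymbol s η : ℂ) * (𝓕 (f : L2 n) : L2 n) η :=
  (exists_fourier_eq (memLp_symbol_mul_fourier hs hk f.2)).choose_spec

theorem sobolevMap_bijective {s : ℝ} (hs : 0 < s) {k : ℝ} (hk : 0 ≤ k) :
    Function.Bijective (sobolevMap (n := n) hs hk) := by
  constructor
  · intro f g h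
    apply Subtype.ext
    apply eq_of_fourier_ae_eq
    have h1 := fourier_sobolevMap hs hk f
    rw [h] at h1
    filter_upwards [h1, fourier_sobolevMap hs hk g] with η h1 h2
    rw [h1] at h2
    exact mul_left_cancel₀ (by exact_mod_cast (abarSymbol_pos s η).ne') h2
  · intro g
    -- The symbol is at least one, so the quotient by it stays in L²; that the preimage has `2 * s`
    -- more derivatives is then read off from the comparison of the weights.
    obtain ⟨f, hf⟩ := exists_fourier_eq (memLp_inv_symbol_mul hs (Lp.memLp (𝓕 (g : L2 n) : L2 n)))
    have hgf : (𝓕 (g : L2 n) : L2 n) =ᵐ[volume]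
        fun η => (abarSymbol s η : ℂ) * (𝓕 f : L2 n) η := by
      filter_upwards [hf] with η hη
      rw [hη, mul_inv_cancel_left₀]
      exact_mod_cast (abarSymbol_pos s η).ne'
    refine ⟨⟨f, (mem_sobolevSpace_iff_of_symbol hs k hgf).1 g.2⟩, Subtype.ext ?_⟩
    apply eq_of_fourier_ae_eq
    exact (fourier_sobolevMap hs hk _).trans hgf.symm

/-- The operator with symbol `1 + |ξ|^(2s)` as a linear isomorphism. -/
def sobolevEquiv {s : ℝ} (hs : 0 < s) {k : ℝ} (hk : 0 ≤ k) :
    SobolevSpace n (k + 2 * s) ≃ₗ[ℂ] SobolevSpace n k :=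
  LinearEquiv.ofBijective
    { toFun := sobolevMap hs hk
      map_add' := fun f g => by
        apply Subtype.ext
        apply eq_of_fourier_ae_eq
        have e1 : (𝓕 ((f : L2 n) + g) : L2 n) = 𝓕 (f : L2 n) + 𝓕 (g : L2 n) :=
          FourierTransform.fourier_add _ _
        have e2 : (𝓕 ((sobolevMap hs hk f : L2 n) + sobolevMap hs hk g) : L2 n) =
          𝓕 (sobolevMap hs hk f : L2 n) + 𝓕 (sobolevMap hs hk g : L2 n) :=
          FourierTransform.fourier_add _ _
        rw [Submodule.coe_add, e2]
        filter_upwards [fourier_sobolevMap hs hk (f + g), fourier_sobolevMap hs hk f,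
          fourier_sobolevMap hs hk g, Lp.coeFn_add (𝓕 (f : L2 n) : L2 n) (𝓕 (g : L2 n)),
          Lp.coeFn_add (𝓕 (sobolevMap hs hk f : L2 n) : L2 n) (𝓕 (sobolevMap hs hk g : L2 n))]
          with η h1 h2 h3 h4 h5
        rw [h1, h5, Submodule.coe_add, e1, h4, Pi.add_apply, Pi.add_apply, h2, h3, mul_add]
      map_smul' := fun c f => by
        apply Subtype.ext
        apply eq_of_fourier_ae_eq
        have e1 : (𝓕 (c • (f : L2 n)) : L2 n) = c • 𝓕 (f : L2 n) :=
          FourierTransform.fourier_smul _ _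
        have e2 : (𝓕 (c • (sobolevMap hs hk f : L2 n)) : L2 n) =
          c • 𝓕 (sobolevMap hs hk f : L2 n) :=
          FourierTransform.fourier_smul _ _
        rw [RingHom.id_apply, Submodule.coe_smul, e2]
        filter_upwards [fourier_sobolevMap hs hk (c • f), fourier_sobolevMap hs hk f,
          Lp.coeFn_smul c (𝓕 (f : L2 n) : L2 n),
          Lp.coeFn_smul c (𝓕 (sobolevMap hs hk f : L2 n) : L2 n)]
          with η h1 h2 h3 h4
        rw [h1, h4, Submodule.coe_smul, e1, h3, Pi.smul_apply, Pi.smul_apply, h2, smul_eq_mul,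
          smul_eq_mul, mul_left_comm] }
    (sobolevMap_bijective hs hk)

/-- Reality is invariance under `star`, which acts on transforms by reflection and conjugation. A
real even multiplier commutes with this action, and since it has no zeros the invariance can also be
pulled back. -/
theorem sobolevMap_real_iff {s : ℝ} (hs : 0 < s) {k : ℝ} (hk : 0 ≤ k)
    (f : SobolevSpace n (k + 2 * s)) :
    (∀ᵐ x, ((f : L2 n) x).im = 0) ↔ ∀ᵐ x, ((sobolevMap hs hk f : L2 n) x).im = 0 := by
  have hneg : MeasurePreserving (fun x : E n => -x) volume volume :=
    Measure.measurePreserving_neg volume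
  have key : (𝓕 (star (sobolevMap hs hk f : L2 n)) : L2 n) =ᵐ[volume]
      fun η => (abarSymbol s η : ℂ) * (𝓕 (star (f : L2 n)) : L2 n) η := by
    filter_upwards [fourier_star_ae (sobolevMap hs hk f : L2 n), fourier_star_ae (f : L2 n),
      hneg.quasiMeasurePreserving.ae (fourier_sobolevMap hs hk f)] with η h1 h2 h3
    rw [h1, h2, h3, map_mul, Complex.conj_ofReal, abarSymbol_neg]
  rw [real_iff_star_eq, real_iff_star_eq]
  constructor
  · intro h
    rw [h] at key
    exact eq_of_fourier_ae_eq (key.trans (fourier_sobolevMap hs hk f).symm)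
  · intro h
    rw [h] at key
    apply eq_of_fourier_ae_eq
    filter_upwards [key, fourier_sobolevMap hs hk f] with η h1 h2
    rw [h1] at h2
    exact mul_left_cancel₀ (by exact_mod_cast (abarSymbol_pos s η).ne') h2

theorem sobolevMap_test {s : ℝ} (hs : 0 < s) {k : ℝ} (hk : 0 ≤ k)
    (f : SobolevSpace n (k + 2 * s)) {v : E n → ℝ} (hv : ContDiff ℝ ∞ v)
    (hc : HasCompactSupport v) (h : (f : L2 n) =ᵐ[volume] fun x => (v x : ℂ)) :
    (sobolevMap hs hk f : L2 n) =ᵐ[volume] fun x => (Abar s v x : ℂ) := by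
  have hf : (f : L2 n) = (testSchwartz hv hc).toLp 2 := by
    apply Lp.ext
    filter_upwards [h, (testSchwartz hv hc).coeFn_toLp 2 volume] with x h1 h2
    rw [h1, h2, testSchwartz_coe]
  have hF : (𝓕 (f : L2 n) : L2 n) =ᵐ[volume] 𝓕 (fun x => (v x : ℂ)) := by
    rw [hf, SchwartzMap.toLp_fourier_eq, ← fourier_testSchwartz hv hc]
    exact SchwartzMap.coeFn_toLp _ _ _
  have h2 := memLp_symbol_fourier hs hv hc 2
  have hT : (sobolevMap hs hk f : L2 n) = 𝓕⁻ (h2.toLp _) := by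
    apply eq_of_fourier_ae_eq
    rw [FourierTransform.fourier_fourierInv_eq]
    filter_upwards [fourier_sobolevMap hs hk f, h2.coeFn_toLp, hF] with η h1 h2 h3
    rw [h1, h2, h3]
  rw [hT]
  filter_upwards [fourierInv_toLp_ae (integrable_symbol_fourier hs hv hc) h2] with x hx
  rw [hx, Abar_eq_fourierInv]

theorem exists_sobolev_isomorphism {s : ℝ} (hs : 0 < s) (k : ℝ) (hk : 0 ≤ k) :
    ∃ T : SobolevSpace n (k + 2 * s) ≃ₗ[ℂ] SobolevSpace n k,
        (∀ f : SobolevSpace n (k + 2 * s), (𝓕 (T f : L2 n) : L2 n) =ᵐ[volume]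
          fun η => (abarSymbol s η : ℂ) * (𝓕 (f : L2 n) : L2 n) η) ∧
        (∃ C : ℝ, 0 < C ∧ ∀ f : SobolevSpace n (k + 2 * s),
          sobolevNorm k (T f : L2 n) ≤ C * sobolevNorm (k + 2 * s) (f : L2 n) ∧
          sobolevNorm (k + 2 * s) (f : L2 n) ≤ C * sobolevNorm k (T f : L2 n)) ∧
        (∀ f : SobolevSpace n (k + 2 * s), (∀ᵐ x, ((f : L2 n) x).im = 0) ↔
          ∀ᵐ x, ((T f : L2 n) x).im = 0) ∧
        (∀ (f : SobolevSpace n (k + 2 * s)) (v : E n → ℝ),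
          ContDiff ℝ ∞ v → HasCompactSupport v →
          ((f : L2 n) =ᵐ[volume] fun x => (v x : ℂ)) →
          ((T f : L2 n) =ᵐ[volume] fun x => (Abar s v x : ℂ))) := by
  refine ⟨sobolevEquiv hs hk, fourier_sobolevMap hs hk, ⟨2 + 2 ^ s, by positivity, fun f => ?_⟩,
    sobolevMap_real_iff hs hk, fun f v hv hc h => sobolevMap_test hs hk f hv hc h⟩
  obtain ⟨h1, h2⟩ := norm_weightedFourier_le_of_symbol hs k (fourier_sobolevMap hs hk f)
  have p2 : (0 : ℝ) < 2 ^ s := by positivity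
  constructor
  · refine (sobolevNorm_le_of_le (by norm_num) f.2 h1).trans ?_
    exact mul_le_mul_of_nonneg_right (by linarith) ENNReal.toReal_nonneg
  · refine (sobolevNorm_le_of_le (by positivity) (sobolevMap hs hk f).2 h2).trans ?_
    exact mul_le_mul_of_nonneg_right (by linarith) ENNReal.toReal_nonneg

/-! ### The metric -/

theorem isTestField_rightTriv (φ : DiffC n) {X : E n → E n} (hX : IsTestField X) :
    IsTestField (rightTriv φ X) := by
  refine ⟨hX.1.comp φ.1.symm.contMDiff.contDiff, ?_⟩
  exact hX.2.comp_homeomorph φ.1.symm.toHomeomorph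

theorem IsTestField.apply {X : E n → E n} (hX : IsTestField X) (k : Fin n) :
    ContDiff ℝ ∞ (fun x => X x k) ∧ HasCompactSupport (fun x => X x k) := by
  refine ⟨(contDiff_euclidean.1 hX.1) k, hX.2.comp_left (g := fun y : E n => y k) (by simp)⟩

theorem hbarInner_eq_integral {s : ℝ} (hs : 0 < s) {X Y : E n → E n} (hX : IsTestField X)
    (hY : IsTestField Y) :
    hbarInner s X Y = ∫ x, ∑ k, Abar s (fun y => X y k) x * Y x k := by
  rw [integral_finsetSum _ fun k _ => integrable_Abar_mul hs (hX.apply k).1 (hX.apply k).2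
    (hY.apply k).1.continuous (hY.apply k).2]
  exact Finset.sum_congr rfl fun k _ =>
    hbar_pairing hs (hX.apply k).1 (hX.apply k).2 (hY.apply k).1 (hY.apply k).2

theorem Gbar_eq_integral {s : ℝ} (hs : 0 < s) (φ : DiffC n) (X Y : E n → E n)
    (hX : IsTestField X) (hY : IsTestField Y) :
    (∀ k, Integrable fun x => Abar s (fun y => rightTriv φ X y k) x * rightTriv φ Y x k) ∧
      Gbar s φ X Y =
        ∫ x, ∑ k, Abar s (fun y => rightTriv φ X y k) x * rightTriv φ Y x k := by
  have hX' := isTestField_rightTriv φ hX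
  have hY' := isTestField_rightTriv φ hY
  exact ⟨fun k => integrable_Abar_mul hs (hX'.apply k).1 (hX'.apply k).2
    (hY'.apply k).1.continuous (hY'.apply k).2, hbarInner_eq_integral hs hX' hY'⟩

/-! ### The integrable kernel with Fourier transform `1 / (1 + |ξ|^(2s))` -/

/-- The function `1 / (1 + t^s)`. -/
def resolventProfile (s t : ℝ) : ℝ := (1 + t ^ s)⁻¹

theorem resolventProfile_mem {s t : ℝ} (ht : 0 ≤ t) : resolventProfile s t ∈ Icc (0 : ℝ) 1 := by
  have : 0 ≤ t ^ s := by positivity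
  unfold resolventProfile
  exact ⟨by positivity, inv_le_one_of_one_le₀ (by linarith)⟩

theorem continuousOn_resolventProfile {s : ℝ} (hs : 0 < s) :
    ContinuousOn (resolventProfile s) (Ici 0) := by
  refine ContinuousOn.inv₀ (continuousOn_const.add
    ((Real.continuous_rpow_const hs.le).continuousOn)) fun x (hx : 0 ≤ x) => ?_
  have : 0 ≤ x ^ s := by positivity
  positivity

/-- The logistic form `q' = -s q (1 - q) / t` is what matters: differentiating a polynomial in `q`
gives a polynomial in `q` times `resolventDensity`, so repeated integration by parts never leaves
this class. -/
theorem hasDerivAt_resolventProfile (s : ℝ) {t : ℝ} (ht : 0 < t) :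
    HasDerivAt (resolventProfile s)
      (-s * (resolventProfile s t * (1 - resolventProfile s t) / t)) t := by
  have h0 : 0 < t ^ s := by positivity
  have h := ((Real.hasDerivAt_rpow_const (p := s) (Or.inl ht.ne')).const_add 1).inv
    (by positivity)
  convert! h using 1
  have : t ^ (s - 1) = t ^ s / t := by rw [Real.rpow_sub_one ht.ne']
  unfold resolventProfile
  rw [this]
  field_simp
  ring

theorem tendsto_resolventProfile {s : ℝ} (hs : 0 < s) :
    Tendsto (resolventProfile s) atTop (𝓝 0) :=
  Tendsto.inv_tendsto_atTop (tendsto_atTop_add_const_left _ _ (tendsto_rpow_atTop hs))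

/-- The density `q(1 - q)/t`, for `q = 1 / (1 + t^s)`. -/
def resolventDensity (s t : ℝ) : ℝ := resolventProfile s t * (1 - resolventProfile s t) / t

theorem resolventDensity_nonneg (s : ℝ) {t : ℝ} (ht : 0 ≤ t) : 0 ≤ resolventDensity s t := by
  obtain ⟨h1, h2⟩ := resolventProfile_mem (s := s) ht
  unfold resolventDensity
  have : 0 ≤ 1 - resolventProfile s t := by linarith
  positivity

/-- Up to the factor `-s` the density is the derivative of a monotone function with finite limits at
both ends. -/
theorem integrableOn_resolventDensity {s : ℝ} (hs : 0 < s) :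
    IntegrableOn (resolventDensity s) (Ioi 0) := by
  have h : IntegrableOn (fun t => -s * resolventDensity s t) (Ioi 0) :=
    integrableOn_Ioi_deriv_of_nonpos
      ((continuousOn_resolventProfile hs) 0 self_mem_Ici)
      (fun t ht => hasDerivAt_resolventProfile s ht)
      (fun t ht => by have := resolventDensity_nonneg s (mem_Ioi.1 ht).le; nlinarith)
      (tendsto_resolventProfile hs)
  have h2 := h.const_mul (-s)⁻¹
  refine IntegrableOn.congr_fun h2 (fun t _ => ?_) measurableSet_Ioi
  field_simp

theorem exists_abs_polynomial_eval_le (G : Polynomial ℝ) :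
    ∃ C, ∀ x ∈ Icc (0 : ℝ) 1, |G.eval x| ≤ C := by
  obtain ⟨C, hC⟩ := isCompact_Icc.exists_bound_of_continuousOn (s := Icc (0 : ℝ) 1)
    G.continuous.continuousOn
  exact ⟨C, fun x hx => by simpa using hC x hx⟩

theorem aestronglyMeasurable_resolvent {s : ℝ} (hs : 0 < s) (G : Polynomial ℝ) :
    AEStronglyMeasurable (fun t => G.eval (resolventProfile s t)) (volume.restrict (Ioi 0)) :=
  (G.continuous.comp_continuousOn ((continuousOn_resolventProfile hs).mono
    Ioi_subset_Ici_self)).aestronglyMeasurable measurableSet_Ioi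

theorem integrableOn_polynomial_mul_resolventDensity {s : ℝ} (hs : 0 < s) (G : Polynomial ℝ) :
    IntegrableOn (fun t => G.eval (resolventProfile s t) * resolventDensity s t) (Ioi 0) := by
  obtain ⟨C, hC⟩ := exists_abs_polynomial_eval_le G
  refine Integrable.bdd_mul (c := C) (integrableOn_resolventDensity hs)
    (aestronglyMeasurable_resolvent hs G) ?_
  filter_upwards [ae_restrict_mem measurableSet_Ioi] with t ht
  exact hC _ (resolventProfile_mem (mem_Ioi.1 ht).le)

theorem integrableOn_pow_mul_resolventDensity {s : ℝ} (hs : 0 < s) (G : Polynomial ℝ) (N : ℕ)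
    {z : ℝ} (hz : 0 < z) :
    IntegrableOn (fun t => (1 - z / t) ^ N *
      (G.eval (resolventProfile s t) * resolventDensity s t)) (Ioi z) := by
  refine Integrable.bdd_mul (c := 1) ((integrableOn_polynomial_mul_resolventDensity hs G).mono_set
    (Ioi_subset_Ioi hz.le)) ?_ ?_
  · refine ContinuousOn.aestronglyMeasurable (fun t ht => ContinuousAt.continuousWithinAt ?_)
      measurableSet_Ioi
    have : t ≠ 0 := (hz.trans ht).ne'
    fun_prop (disch := assumption)
  · filter_upwards [ae_restrict_mem measurableSet_Ioi] with t ht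
    have h0 : 0 < t := hz.trans ht
    have h1 : z / t ≤ 1 := (div_le_one h0).2 (mem_Ioi.1 ht).le
    have h2 : 0 ≤ z / t := by positivity
    rw [norm_pow, Real.norm_of_nonneg (by linarith)]
    exact pow_le_one₀ (by linarith) (by linarith)

/-- `1 / (1 + z^s)` is a superposition of the truncated powers `(1 - z/t)₊ᴺ`, with an integrable
density. -/
theorem exists_resolventProfile_eq_integral {s : ℝ} (hs : 0 < s) (N : ℕ) :
    ∃ G : Polynomial ℝ, ∀ z, 0 < z → resolventProfile s z =
      ∫ t in Ioi z, (1 - z / t) ^ N * (G.eval (resolventProfile s t) * resolventDensity s t) := by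
  induction N with
  | zero =>
    refine ⟨Polynomial.C s, fun z hz => ?_⟩
    have h := integral_Ioi_of_hasDerivAt_of_tendsto' (a := z) (f := resolventProfile s)
      (fun t ht => hasDerivAt_resolventProfile s (hz.trans_le ht))
      (((integrableOn_resolventDensity hs).mono_set (Ioi_subset_Ioi hz.le)).const_mul (-s))
      (tendsto_resolventProfile hs)
    rw [integral_const_mul] at h
    simp only [pow_zero, one_mul, Polynomial.eval_C]
    rw [integral_const_mul]
    unfold resolventDensity
    linarith
  | succ N ih =>
    obtain ⟨G, hG⟩ := ih
    let X : Polynomial ℝ := Polynomial.X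
    -- The primitive will be `(1 - z/t)^(N+1) H(q) / (N+1)`. Since `H(q) / t = G(q) *
    -- resolventDensity` and `z/t = 1 - (1 - z/t)`, its derivative is the old integrand minus the
    -- new one exactly for this `G'`. It vanishes at `t = z` because of the truncated power, and at
    -- infinity because `q → 0` and `H(0) = 0`.
    let H : Polynomial ℝ := X * (1 - X) * G
    let G' : Polynomial ℝ := G + Polynomial.C (s / (N + 1)) * Polynomial.derivative H
    refine ⟨G', fun z hz => ?_⟩
    rw [hG z hz, ← sub_eq_zero, ← integral_sub (integrableOn_pow_mul_resolventDensity hs G N hz)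
      (integrableOn_pow_mul_resolventDensity hs G' (N + 1) hz)]
    have hI := (integrableOn_pow_mul_resolventDensity hs G N hz).sub
      (integrableOn_pow_mul_resolventDensity hs G' (N + 1) hz)
    have hd : ∀ t ∈ Ici z, HasDerivAt
        (fun t => (1 - z / t) ^ (N + 1) * H.eval (resolventProfile s t) / (N + 1))
        ((1 - z / t) ^ N * (G.eval (resolventProfile s t) * resolventDensity s t) -
          (1 - z / t) ^ (N + 1) * (G'.eval (resolventProfile s t) * resolventDensity s t)) t := by
      intro t ht
      have h0 : 0 < t := hz.trans_le ht
      have d1 : HasDerivAt (fun t => (1 - z / t) ^ (N + 1))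
          (((N + 1 : ℕ) : ℝ) * (1 - z / t) ^ N * (z / t ^ 2)) t := by
        have := ((hasDerivAt_const t (1 : ℝ)).sub
          ((hasDerivAt_const t z).div (hasDerivAt_id t) h0.ne')).pow (N + 1)
        convert! this using 1
        simp
        ring
      have d2 := (H.hasDerivAt (resolventProfile s t)).comp t (hasDerivAt_resolventProfile s h0)
      have d3 := (d1.mul d2).div_const ((N : ℝ) + 1)
      convert! d3 using 1
      have hN : (N : ℝ) + 1 ≠ 0 := by positivity
      simp only [G', H, X, resolventDensity, Polynomial.eval_add, Polynomial.eval_mul,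
        Polynomial.eval_C, Function.comp, Polynomial.eval_X, Polynomial.eval_sub,
        Polynomial.eval_one]
      rw [pow_succ]
      generalize (1 - z / t) ^ N = A
      generalize Polynomial.eval (resolventProfile s t)
        (Polynomial.derivative (Polynomial.X * (1 - Polynomial.X) * G)) = B
      generalize Polynomial.eval (resolventProfile s t) G = D
      push_cast
      field_simp
      ring
    have hlim : Tendsto (fun t => (1 - z / t) ^ (N + 1) * H.eval (resolventProfile s t) / (N + 1))
        atTop (𝓝 0) := by
      have l1 : Tendsto (fun t => (1 - z / t) ^ (N + 1)) atTop (𝓝 ((1 - 0) ^ (N + 1))) :=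
        (tendsto_const_nhds.sub (tendsto_const_nhds.div_atTop tendsto_id)).pow _
      have l2 : Tendsto (fun t => H.eval (resolventProfile s t)) atTop (𝓝 (H.eval 0)) :=
        (H.continuous.tendsto 0).comp (tendsto_resolventProfile hs)
      have l3 := (l1.mul l2).div_const ((N : ℝ) + 1)
      simpa [H, X] using l3
    have h := integral_Ioi_of_hasDerivAt_of_tendsto' hd hI hlim
    rw [h]
    simp [hz.ne']

/-! ### Truncated powers -/

theorem hasDerivAt_max_pow (m : ℕ) (x : ℝ) :
    HasDerivAt (fun x : ℝ => max x 0 ^ (m + 2)) ((m + 2) * max x 0 ^ (m + 1)) x := by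
  rcases lt_trichotomy x 0 with h | h | h
  · have : (fun x : ℝ => max x 0 ^ (m + 2)) =ᶠ[𝓝 x] fun _ => 0 := by
      filter_upwards [gt_mem_nhds h] with y hy
      rw [max_eq_right hy.le, zero_pow (by omega)]
    rw [max_eq_right h.le, zero_pow (by omega), mul_zero]
    exact (hasDerivAt_const x (0 : ℝ)).congr_of_eventuallyEq this
  · subst h
    rw [max_self, zero_pow (by omega), mul_zero, hasDerivAt_iff_isLittleO]
    simp only [max_self, sub_zero, smul_zero, ne_eq, Nat.add_eq_zero_iff, OfNat.ofNat_ne_zero,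
      and_false, not_false_eq_true, zero_pow]
    refine Asymptotics.IsBigO.trans_isLittleO (g := fun x : ℝ => x ^ (m + 2)) ?_ ?_
    · refine Asymptotics.IsBigO.of_bound 1 (Eventually.of_forall fun y => ?_)
      rw [norm_pow, norm_pow, one_mul]
      refine pow_le_pow_left₀ (norm_nonneg _) ?_ _
      rw [Real.norm_of_nonneg (le_max_right _ _), Real.norm_eq_abs]
      exact max_le (le_abs_self y) (abs_nonneg y)
    · simpa using Asymptotics.isLittleO_pow_pow (𝕜 := ℝ) (m := 1) (n := m + 2) (by omega)
  · have : (fun x : ℝ => max x 0 ^ (m + 2)) =ᶠ[𝓝 x] fun x => x ^ (m + 2) := by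
      filter_upwards [lt_mem_nhds h] with y hy
      rw [max_eq_left hy.le]
    rw [max_eq_left h.le]
    have h2 := (hasDerivAt_pow (m + 2) x).congr_of_eventuallyEq this
    convert! h2 using 1
    push_cast
    rfl

theorem contDiff_max_pow (m : ℕ) : ContDiff ℝ m (fun x : ℝ => max x 0 ^ (m + 1)) := by
  induction m with
  | zero => exact contDiff_zero.2 (by fun_prop)
  | succ m ih =>
    have hd : deriv (fun x : ℝ => max x 0 ^ (m + 1 + 1)) =
        fun x => ((m : ℝ) + 2) * max x 0 ^ (m + 1) :=
      funext fun x => (hasDerivAt_max_pow m x).deriv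
    push_cast
    rw [contDiff_succ_iff_deriv]
    refine ⟨fun x => (hasDerivAt_max_pow m x).differentiableAt, by simp, ?_⟩
    rw [hd]
    exact contDiff_const.mul ih

/-- The truncated power `(1 - |y|²)₊ᴺ`. -/
def truncPower (N : ℕ) (y : E n) : ℝ := max (1 - ‖y‖ ^ 2) 0 ^ N

theorem contDiff_truncPower (m : ℕ) : ContDiff ℝ m (truncPower (n := n) (m + 1)) := by
  unfold truncPower
  exact (contDiff_max_pow m).comp (contDiff_const.sub (contDiff_norm_sq ℝ))

theorem hasCompactSupport_truncPower (m : ℕ) : HasCompactSupport (truncPower (n := n) (m + 1)) := by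
  refine HasCompactSupport.of_support_subset_isCompact (isCompact_closedBall 0 1) fun y hy => ?_
  rw [mem_closedBall_zero_iff]
  by_contra h
  apply hy
  unfold truncPower
  rw [max_eq_right (by nlinarith), zero_pow (by omega)]

/-- The `n + 1` derivatives give decay `‖w‖^(-(n+1))`, which is integrable at infinity in dimension
`n`; the bound of order zero takes care of the region near the origin. -/
theorem integrable_fourier_of_contDiff {f : E n → ℂ} (hf : ContDiff ℝ ((n + 1 : ℕ) : ℕ∞) f)
    (hc : HasCompactSupport f) : Integrable (𝓕 f) := by
  have hint : Integrable f := hf.continuous.integrable_of_hasCompactSupport hc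
  have hI : ∀ (k m : ℕ), (k : ℕ∞) ≤ (0 : ℕ∞) → (m : ℕ∞) ≤ ((n + 1 : ℕ) : ℕ∞) →
      Integrable (fun v => ‖v‖ ^ k * ‖iteratedFDeriv ℝ m f v‖) := by
    intro k m _ hm
    have h1 : Continuous fun v : E n => ‖v‖ ^ k * ‖iteratedFDeriv ℝ m f v‖ :=
      (by fun_prop : Continuous fun v : E n => ‖v‖ ^ k).mul
        (hf.continuous_iteratedFDeriv (by exact_mod_cast hm)).norm
    exact h1.integrable_of_hasCompactSupport ((hc.iteratedFDeriv m).norm.mul_left)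
  have hb := fun w : E n => Real.pow_mul_norm_iteratedFDeriv_fourier_le hf hI (k := 0) (n := n + 1)
    (by simp) le_rfl w
  have hb0 := fun w : E n => Real.pow_mul_norm_iteratedFDeriv_fourier_le hf hI (k := 0) (n := 0)
    (by simp) (by simp) w
  simp only [norm_iteratedFDeriv_zero] at hb hb0
  generalize ((2 * π) ^ 0 * (2 * ((0 : ℕ) : ℝ) + 2) ^ (n + 1) *
    ∑ p ∈ Finset.range (0 + 1) ×ˢ Finset.range (n + 1 + 1),
        ∫ v, ‖v‖ ^ p.1 * ‖iteratedFDeriv ℝ p.2 f v‖) = A at hb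
  generalize ((2 * π) ^ 0 * (2 * ((0 : ℕ) : ℝ) + 2) ^ 0 *
    ∑ p ∈ Finset.range (0 + 1) ×ˢ Finset.range (0 + 1),
        ∫ v, ‖v‖ ^ p.1 * ‖iteratedFDeriv ℝ p.2 f v‖) = B at hb0
  have hcont : Continuous (𝓕 f) :=
    VectorFourier.fourierIntegral_continuous Real.continuous_fourierChar
      (by exact continuous_inner) hint
  have hdom := integrable_one_add_norm (E := E n) (μ := volume) (r := (n + 1 : ℕ))
    (by simp)
  refine Integrable.mono' (hdom.const_mul (2 ^ (n + 1) * (A + B))) hcont.aestronglyMeasurable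
    (ae_of_all _ fun w => ?_)
  have hA : 0 ≤ A := le_trans (by positivity) (hb 0)
  have h0 := hb0 w
  rw [pow_zero, one_mul] at h0
  have h1 := hb w
  rw [Real.rpow_neg (by positivity), Real.rpow_natCast, ← div_eq_mul_inv, le_div_iff₀ (by positivity)]
  have h2 : (1 + ‖w‖) ^ (n + 1) ≤ 2 ^ (n + 1) * (1 + ‖w‖ ^ (n + 1)) := by
    rcases le_total ‖w‖ 1 with h | h
    · calc (1 + ‖w‖) ^ (n + 1) ≤ 2 ^ (n + 1) := by gcongr; linarith
        _ ≤ _ := by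
          have : 0 ≤ ‖w‖ ^ (n + 1) := by positivity
          nlinarith [pow_pos (zero_lt_two : (0:ℝ) < 2) (n + 1)]
    · calc (1 + ‖w‖) ^ (n + 1) ≤ (2 * ‖w‖) ^ (n + 1) := by gcongr; linarith
        _ = 2 ^ (n + 1) * ‖w‖ ^ (n + 1) := mul_pow _ _ _
        _ ≤ _ := by nlinarith [pow_pos (zero_lt_two : (0:ℝ) < 2) (n + 1)]
  calc ‖𝓕 f w‖ * (1 + ‖w‖) ^ (n + 1) ≤ ‖𝓕 f w‖ * (2 ^ (n + 1) * (1 + ‖w‖ ^ (n + 1))) := by gcongr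
    _ = 2 ^ (n + 1) * (‖w‖ ^ (n + 1) * ‖𝓕 f w‖ + ‖𝓕 f w‖) := by ring
    _ ≤ _ := by gcongr

/-- An even integrable real function whose Fourier transform is `(1 - |η|²)₊ᴺ`. -/
theorem exists_fourier_eq_truncPower :
    ∃ γ : E n → ℝ, Continuous γ ∧ Integrable γ ∧ (∀ x, γ (-x) = γ x) ∧
      ∀ η, 𝓕 (fun x => (γ x : ℂ)) η = (truncPower (n + 2) η : ℂ) := by
  -- The exponent `n + 2` is chosen so that the truncated power keeps the `n + 1` continuous
  -- derivatives that make its transform integrable.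
  have hd : ContDiff ℝ ((n + 1 : ℕ) : ℕ∞) (fun y : E n => (truncPower (n + 2) y : ℂ)) :=
    Complex.ofRealCLM.contDiff.comp (by exact_mod_cast contDiff_truncPower (n := n) (n + 1))
  have hc : HasCompactSupport (fun y : E n => (truncPower (n + 2) y : ℂ)) :=
    (hasCompactSupport_truncPower (n := n) (n + 1)).comp_left (g := fun r : ℝ => (r : ℂ)) (by simp)
  have heven : ∀ y : E n, truncPower (n + 2) (-y) = truncPower (n + 2) y := by simp [truncPower]
  have hi : Integrable (fun y : E n => (truncPower (n + 2) y : ℂ)) :=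
    hd.continuous.integrable_of_hasCompactSupport hc
  have hFi := integrable_fourier_of_contDiff hd hc
  have hinv : 𝓕⁻ (fun y : E n => (truncPower (n + 2) y : ℂ)) =
      𝓕 (fun y : E n => (truncPower (n + 2) y : ℂ)) := by
    rw [Real.fourierInv_eq_fourier_comp_neg]
    simp only [heven]
  have hre := fun x => fourierInv_eq_ofReal_re
    (f := fun y : E n => (truncPower (n + 2) y : ℂ)) (fun η => by simp [heven]) x
  refine ⟨fun x => (𝓕⁻ (fun y : E n => (truncPower (n + 2) y : ℂ)) x).re,
    Complex.continuous_re.comp (continuous_fourierInv hi), ?_, fun x => ?_, fun η => ?_⟩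
  · rw [hinv]
    exact hFi.re
  · simp only
    rw [Real.fourierInv_eq_fourier_neg, neg_neg, hinv]
  · simp only [hre]
    change 𝓕 (𝓕⁻ (fun y : E n => (truncPower (n + 2) y : ℂ))) η = _
    rw [Continuous.fourier_fourierInv_eq hd.continuous hi hFi]

theorem integral_char_comp_smul {γ : E n → ℝ} {a : ℝ} (ha : 0 < a) (η : E n) :
    ∫ x : E n, Real.fourierChar (-inner ℝ x η) • ((a ^ n * γ (a • x) : ℝ) : ℂ) =
      𝓕 (fun x => (γ x : ℂ)) (a⁻¹ • η) := by
  have h := Measure.integral_comp_smul_of_nonneg (volume : Measure (E n))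
    (fun x : E n => Real.fourierChar (-inner ℝ x (a⁻¹ • η)) • ((a ^ n * γ x : ℝ) : ℂ)) a
    (hR := ha.le)
  have e : ∀ x : E n, inner ℝ (a • x) (a⁻¹ • η) = inner ℝ x η := by
    intro x
    rw [real_inner_smul_left, real_inner_smul_right, ← mul_assoc, mul_inv_cancel₀ ha.ne', one_mul]
  simp only [e] at h
  rw [h, Real.fourier_eq, finrank_euclideanSpace_fin, ← integral_smul]
  congr 1 with x
  have : (a : ℂ) ≠ 0 := by exact_mod_cast ha.ne'
  simp only [Circle.smul_def, smul_eq_mul, Complex.real_smul]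
  push_cast
  field_simp

/-- All the dilates have the same L¹ norm. This makes the superposition over `t` absolutely
convergent as soon as the density is integrable. -/
theorem integral_abs_comp_smul {γ : E n → ℝ} {a : ℝ} (ha : 0 < a) :
    ∫ x : E n, |a ^ n * γ (a • x)| = ∫ x, |γ x| := by
  have h := Measure.integral_comp_smul_of_nonneg (volume : Measure (E n))
    (fun x : E n => |a ^ n * γ x|) a (hR := ha.le)
  rw [h, finrank_euclideanSpace_fin, ← integral_smul]
  congr 1 with x
  rw [abs_mul, abs_of_pos (by positivity), smul_eq_mul, inv_mul_cancel_left₀ (by positivity)]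

/-- The dilation factor `√t / (2π)` combines the radius `√t` of the ball in `ξ` with the change of
variable `ξ = 2πη`. The exponent must be nonzero for the power to vanish outside the ball. -/
theorem truncPower_scale {N : ℕ} (hN : N ≠ 0) {t : ℝ} (ht : 0 < t) (η : E n) :
    truncPower N ((√t / (2 * π))⁻¹ • η) =
      if (2 * π * ‖η‖) ^ 2 < t then (1 - (2 * π * ‖η‖) ^ 2 / t) ^ N else 0 := by
  have h : ‖(√t / (2 * π))⁻¹ • η‖ ^ 2 = (2 * π * ‖η‖) ^ 2 / t := by
    rw [norm_smul, norm_inv, Real.norm_of_nonneg (by positivity), inv_div, mul_pow, div_pow,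
      Real.sq_sqrt ht.le]
    ring
  unfold truncPower
  rw [h]
  split_ifs with h1
  · rw [max_eq_left]
    linarith [(div_lt_one ht).2 h1]
  · rw [max_eq_right, zero_pow hN]
    linarith [(one_le_div ht).2 (not_lt.1 h1)]

theorem inv_abarSymbol_eq (s : ℝ) (η : E n) :
    (abarSymbol s η)⁻¹ = resolventProfile s ((2 * π * ‖η‖) ^ 2) := by
  unfold abarSymbol resolventProfile
  rw [Real.rpow_mul (by positivity), Real.rpow_two]

/-- An integrable even function with Fourier transform `1 / (1 + |ξ|^(2s))`. -/
theorem exists_resolventKernel {s : ℝ} (hs : 0 < s) :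
    ∃ k : E n → ℝ, Integrable k ∧ (∀ x, k (-x) = k x) ∧
      ∀ η ≠ 0, 𝓕 (fun x => (k x : ℂ)) η = ((abarSymbol s η)⁻¹ : ℝ) := by
  obtain ⟨γ, hγc, hγi, hγe, hγF⟩ := exists_fourier_eq_truncPower (n := n)
  obtain ⟨G, hG⟩ := exists_resolventProfile_eq_integral hs (n + 2)
  set w : ℝ → ℝ := fun t => G.eval (resolventProfile s t) * resolventDensity s t with hw
  have hwi : IntegrableOn w (Ioi 0) := integrableOn_polynomial_mul_resolventDensity hs G
  set a : ℝ → ℝ := fun t => √t / (2 * π) with ha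
  have ha0 : ∀ t, 0 < t → 0 < a t := fun t ht => by
    have := Real.sqrt_pos.2 ht
    positivity
  have hac : Continuous a := by fun_prop
  -- The kernel is the integral over `t` of the weight times the L¹-normalized dilate of `γ`; Fubini
  -- gives its integrability and its transform.
  let F : ℝ × E n → ℝ := fun z => w z.1 * (a z.1 ^ n * γ (a z.1 • z.2))
  have hFm : AEStronglyMeasurable F ((volume.restrict (Ioi 0)).prod volume) :=
    (hwi.aestronglyMeasurable.comp_fst).mul
      (by fun_prop : Continuous fun z : ℝ × E n =>
        a z.1 ^ n * γ (a z.1 • z.2)).aestronglyMeasurable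
  have hFi : Integrable F ((volume.restrict (Ioi 0)).prod volume) := by
    rw [integrable_prod_iff hFm]
    constructor
    · filter_upwards [ae_restrict_mem measurableSet_Ioi] with t ht
      exact ((hγi.comp_smul (ha0 t ht).ne').const_mul (a t ^ n)).const_mul (w t)
    · refine (hwi.norm.mul_const (∫ x, |γ x|)).congr ?_
      filter_upwards [ae_restrict_mem measurableSet_Ioi] with t ht
      rw [← integral_abs_comp_smul (ha0 t ht), ← integral_const_mul]
      simp only [F, norm_mul, Real.norm_eq_abs, abs_mul]
  refine ⟨fun x => ∫ t in Ioi 0, F (t, x), hFi.integral_prod_right, fun x => ?_, fun η hη => ?_⟩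
  · simp only [F, smul_neg, hγe]
  -- The superposition formula holds at positive `z` only, which is why the frequency `0` is
  -- excluded.
  · have hz : 0 < (2 * π * ‖η‖) ^ 2 := by
      have := norm_pos_iff.2 hη
      positivity
    have hswap : Integrable (Function.uncurry fun (x : E n) (t : ℝ) =>
        Real.fourierChar (-inner ℝ x η) • ((F (t, x) : ℝ) : ℂ))
        (volume.prod (volume.restrict (Ioi 0))) := by
      have h1 : Integrable (fun z : E n × ℝ => ((F (z.2, z.1) : ℝ) : ℂ))
        (volume.prod (volume.restrict (Ioi 0))) := hFi.swap.ofReal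
      refine h1.mono ?_ (ae_of_all _ fun z => ?_)
      · have : Continuous fun z : E n × ℝ => ((Real.fourierChar (-inner ℝ z.1 η) : Circle) : ℂ) :=
          continuous_subtype_val.comp (Real.continuous_fourierChar.comp (by fun_prop))
        exact this.aestronglyMeasurable.smul h1.1
      · simp only [Function.uncurry, Circle.norm_smul, le_refl]
    calc 𝓕 (fun x => ((∫ t in Ioi 0, F (t, x) : ℝ) : ℂ)) η
        = ∫ x, ∫ t in Ioi 0, Real.fourierChar (-inner ℝ x η) • ((F (t, x) : ℝ) : ℂ) := by
          rw [Real.fourier_eq]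
          congr 1 with x
          simp only [Circle.smul_def]
          rw [← integral_complex_ofReal, ← integral_smul]
      _ = ∫ t in Ioi 0, ∫ x, Real.fourierChar (-inner ℝ x η) • ((F (t, x) : ℝ) : ℂ) :=
          integral_integral_swap hswap
      _ = ∫ t in Ioi 0, ((w t * truncPower (n + 2) ((a t)⁻¹ • η) : ℝ) : ℂ) := by
          refine setIntegral_congr_fun measurableSet_Ioi fun t ht => ?_
          rw [Complex.ofReal_mul, ← hγF, ← integral_char_comp_smul (ha0 t ht) η,
            ← integral_const_mul]
          congr 1 with x
          simp only [F, Circle.smul_def, smul_eq_mul]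
          push_cast
          ring
      _ = ((∫ t in Ioi 0, (Ioi ((2 * π * ‖η‖) ^ 2)).indicator
            (fun t => (1 - (2 * π * ‖η‖) ^ 2 / t) ^ (n + 2) * w t) t : ℝ) : ℂ) := by
          rw [integral_complex_ofReal]
          congr 1
          refine setIntegral_congr_fun measurableSet_Ioi fun t ht => ?_
          simp only [ha]
          rw [truncPower_scale (by omega) ht, indicator_apply]
          simp only [mem_Ioi]
          split_ifs <;> ring
      _ = _ := by
          rw [setIntegral_indicator measurableSet_Ioi, Ioi_inter_Ioi, sup_eq_right.2 hz.le,
            inv_abarSymbol_eq, hG _ hz]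

/-! ### Bessel functions -/

/-- The entire function `f` with `J_ν(r) = (r/2)^ν f(r²/4)`. -/
def besselSeries (ν y : ℝ) : ℝ :=
  ∑' j : ℕ, (-1) ^ j / (j.factorial * Real.Gamma (j + ν + 1)) * y ^ j

/-- In the recursion for the Gamma function the factor `j + ν + 1` exceeds one for `j ≥ 1` and is at
least `1/2` for `j = 0`, so only the first step can lose, and at most a factor two. The range `ν ≥
-1/2` includes the order `n/2 - 1` for `n = 1`. -/
theorem half_Gamma_le {ν : ℝ} (hν : -1 / 2 ≤ ν) (j : ℕ) :
    Real.Gamma (ν + 1) / 2 ≤ Real.Gamma (j + ν + 1) := by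
  have h0 : 0 < Real.Gamma (ν + 1) := Real.Gamma_pos_of_pos (by linarith)
  induction j with
  | zero => simp; linarith
  | succ j ih =>
    have e : ((j + 1 : ℕ) : ℝ) + ν + 1 = (j + ν + 1) + 1 := by push_cast; ring
    have hj0 : (0 : ℝ) < j + ν + 1 := by
      have : (0 : ℝ) ≤ j := j.cast_nonneg
      linarith
    have e2 : Real.Gamma (j + ν + 1 + 1) = (j + ν + 1) * Real.Gamma (j + ν + 1) :=
      Real.Gamma_add_one hj0.ne'
    rw [e, e2]
    rcases Nat.eq_zero_or_pos j with rfl | hj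
    · simp; nlinarith
    · have : (1 : ℝ) ≤ j := by exact_mod_cast hj
      nlinarith

theorem norm_besselSeries_term_le {ν : ℝ} (hν : -1 / 2 ≤ ν) (y : ℝ) (j : ℕ) :
    ‖(-1) ^ j / (j.factorial * Real.Gamma (j + ν + 1)) * y ^ j‖ ≤
      2 / Real.Gamma (ν + 1) * (|y| ^ j / j.factorial) := by
  have h0 : 0 < Real.Gamma (ν + 1) := Real.Gamma_pos_of_pos (by linarith)
  have h1 := half_Gamma_le hν j
  have h2 : 0 < Real.Gamma (j + ν + 1) := by linarith
  have hf : (0 : ℝ) < j.factorial := by exact_mod_cast j.factorial_pos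
  rw [Real.norm_eq_abs, abs_mul, abs_div, abs_pow, abs_pow, abs_neg, abs_one, one_pow,
    abs_of_pos (a := (j.factorial : ℝ) * Real.Gamma (j + ν + 1)) (by positivity)]
  have h3 : 1 / Real.Gamma (j + ν + 1) ≤ 2 / Real.Gamma (ν + 1) := by
    rw [div_le_div_iff₀ h2 h0]
    linarith
  calc 1 / (j.factorial * Real.Gamma (j + ν + 1)) * |y| ^ j
      = 1 / Real.Gamma (j + ν + 1) * (|y| ^ j / j.factorial) := by field_simp
    _ ≤ _ := by gcongr

theorem summable_besselSeries {ν : ℝ} (hν : -1 / 2 ≤ ν) (y : ℝ) :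
    Summable fun j : ℕ => (-1) ^ j / (j.factorial * Real.Gamma (j + ν + 1)) * y ^ j :=
  Summable.of_norm_bounded ((Real.summable_pow_div_factorial |y|).mul_left _)
    (norm_besselSeries_term_le hν y)

/-- Termwise differentiation on a ball: the shift `j ↦ j + 1` of the index raises the argument of
Gamma by one, that is, the order. -/
theorem hasDerivAt_besselSeries {ν : ℝ} (hν : -1 / 2 ≤ ν) (y : ℝ) :
    HasDerivAt (besselSeries ν) (-besselSeries (ν + 1) y) y := by
  have h0 : 0 < Real.Gamma (ν + 1) := Real.Gamma_pos_of_pos (by linarith)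
  set c : ℕ → ℝ := fun j => (-1) ^ j / (j.factorial * Real.Gamma (j + ν + 1)) with hc
  have hcb : ∀ j, |c j| ≤ 2 / Real.Gamma (ν + 1) * (1 / j.factorial) := fun j => by
    simpa only [one_pow, mul_one, abs_one, Real.norm_eq_abs] using norm_besselSeries_term_le hν 1 j
  set R := |y| + 1 with hR
  have hd : ∀ (j : ℕ) (z : ℝ), z ∈ Metric.ball (0 : ℝ) R →
      HasDerivAt (fun z => c j * z ^ j) (c j * (j * z ^ (j - 1))) z :=
    fun j z _ => (hasDerivAt_pow j z).const_mul _
  have hu : Summable fun j : ℕ => 2 / Real.Gamma (ν + 1) * (1 / j.factorial) *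
      (j * R ^ (j - 1)) := by
    rw [← summable_nat_add_iff 1]
    refine ((Real.summable_pow_div_factorial R).mul_left (2 / Real.Gamma (ν + 1))).congr
      fun j => ?_
    rw [Nat.factorial_succ]
    push_cast
    field_simp
  have hb : ∀ (j : ℕ) (z : ℝ), z ∈ Metric.ball (0 : ℝ) R → ‖c j * (j * z ^ (j - 1))‖ ≤
      2 / Real.Gamma (ν + 1) * (1 / j.factorial) * (j * R ^ (j - 1)) := by
    intro j z hz
    rw [mem_ball_zero_iff, Real.norm_eq_abs] at hz
    rw [norm_mul, norm_mul, norm_pow, Real.norm_eq_abs, Real.norm_eq_abs, Real.norm_eq_abs,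
      Nat.abs_cast]
    gcongr
    exact hcb j
  have key := hasDerivAt_tsum_of_isPreconnected (y₀ := 0) (y := y) hu Metric.isOpen_ball
    (convex_ball (0 : ℝ) R).isPreconnected hd hb (by simp [hR]; positivity)
    (by simpa [hc] using summable_besselSeries hν 0) (by simp [hR])
  convert! key using 1
  have hs : Summable fun j : ℕ => c j * (j * y ^ (j - 1)) :=
    Summable.of_norm_bounded hu fun j => hb j y (by simp [hR])
  rw [hs.tsum_eq_zero_add, besselSeries, ← tsum_neg]
  simp only [CharP.cast_eq_zero, zero_mul, mul_zero, zero_add]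
  congr 1 with j
  simp only [hc, Nat.factorial_succ]
  have e : ((j + 1 : ℕ) : ℝ) + ν + 1 = j + (ν + 1) + 1 := by push_cast; ring
  rw [e, pow_succ]
  push_cast
  have : (0 : ℝ) < j.factorial := by exact_mod_cast j.factorial_pos
  have h2 : 0 < Real.Gamma (j + (ν + 1) + 1) := Real.Gamma_pos_of_pos (by
    have : (0 : ℝ) ≤ j := j.cast_nonneg
    linarith)
  field_simp

theorem continuous_besselSeries {ν : ℝ} (hν : -1 / 2 ≤ ν) : Continuous (besselSeries ν) :=
  continuous_iff_continuousAt.2 fun y => (hasDerivAt_besselSeries hν y).continuousAt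

/-- The recursion `(ν + 1) f_{ν+1}(y) - y f_{ν+2}(y) = f_ν(y)`. -/
theorem besselSeries_recursion {ν : ℝ} (hν : -1 / 2 ≤ ν) (y : ℝ) :
    (ν + 1) * besselSeries (ν + 1) y - y * besselSeries (ν + 1 + 1) y = besselSeries ν y := by
  have hG : ∀ (μ : ℝ) (j : ℕ), -1 / 2 ≤ μ → 0 < Real.Gamma (j + μ + 1) := fun μ j h =>
    Real.Gamma_pos_of_pos (by have : (0 : ℝ) ≤ j := j.cast_nonneg; linarith)
  have s1 := summable_besselSeries (ν := ν + 1) (by linarith) y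
  have s2 := summable_besselSeries (ν := ν + 1 + 1) (by linarith) y
  have h2 : HasSum (fun j : ℕ => -(j * ((-1) ^ j / (j.factorial * Real.Gamma (j + (ν + 1) + 1))
      * y ^ j))) (y * besselSeries (ν + 1 + 1) y) := by
    rw [← hasSum_nat_add_iff' 1]
    simp only [Finset.range_one, Finset.sum_singleton, CharP.cast_eq_zero, zero_mul, neg_zero,
      sub_zero]
    refine (s2.hasSum.mul_left y).congr_fun fun j => ?_
    have e : ((j + 1 : ℕ) : ℝ) + (ν + 1) + 1 = j + (ν + 1 + 1) + 1 := by push_cast; ring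
    rw [e, Nat.factorial_succ, pow_succ, pow_succ]
    push_cast
    have : (0 : ℝ) < j.factorial := by exact_mod_cast j.factorial_pos
    have := hG (ν + 1 + 1) j (by linarith)
    field_simp
  have h3 := (s1.hasSum.mul_left (ν + 1)).sub h2
  have h4 := (summable_besselSeries hν y).hasSum
  refine h3.unique (h4.congr_fun fun j => ?_)
  have e : (j : ℝ) + (ν + 1) + 1 = (j + ν + 1) + 1 := by ring
  have hj : (0 : ℝ) < j + ν + 1 := by
    have : (0 : ℝ) ≤ j := j.cast_nonneg
    linarith
  rw [e, Real.Gamma_add_one hj.ne']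
  have : (0 : ℝ) < j.factorial := by exact_mod_cast j.factorial_pos
  have := hG ν j hν
  field_simp
  ring

theorem besselJ_eq {r : ℝ} (hr : 0 < r) (ν : ℝ) :
    besselJ ν r = (r / 2) ^ ν * besselSeries ν (r ^ 2 / 4) := by
  unfold besselJ besselSeries
  rw [← tsum_mul_left]
  congr 1 with j
  have h : (r / 2) ^ (2 * (j : ℝ) + ν) = (r / 2) ^ ν * (r ^ 2 / 4) ^ j := by
    rw [Real.rpow_add (by positivity), mul_comm]
    congr 1
    rw [Real.rpow_mul (by positivity), Real.rpow_natCast]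
    congr 1
    rw [Real.rpow_two]
    ring
  rw [h]
  ring

/-- `J_ν`, written through the entire series. -/
def besselAux (ν r : ℝ) : ℝ := (r / 2) ^ ν * besselSeries ν (r ^ 2 / 4)

theorem hasDerivAt_half_rpow (ν : ℝ) {r : ℝ} (hr : 0 < r) :
    HasDerivAt (fun r : ℝ => (r / 2) ^ ν) (ν / r * (r / 2) ^ ν) r := by
  have h := ((hasDerivAt_id r).div_const 2).rpow_const (p := ν) (Or.inl (by simp; positivity))
  convert! h using 1
  simp only [id]
  rw [Real.rpow_sub_one (by positivity)]
  field_simp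

theorem hasDerivAt_sq_div_four (r : ℝ) : HasDerivAt (fun r : ℝ => r ^ 2 / 4) (r / 2) r := by
  have h := (hasDerivAt_pow 2 r).div_const 4
  convert! h using 1
  simp
  ring

theorem hasDerivAt_besselAux {ν : ℝ} (hν : -1 / 2 ≤ ν) {r : ℝ} (hr : 0 < r) :
    HasDerivAt (besselAux ν) (ν / r * besselAux ν r - besselAux (ν + 1) r) r := by
  have h := (hasDerivAt_half_rpow ν hr).mul
    ((hasDerivAt_besselSeries hν (r ^ 2 / 4)).comp r (hasDerivAt_sq_div_four r))
  convert! h using 1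
  unfold besselAux
  rw [Real.rpow_add_one (by positivity)]
  simp only [Function.comp]
  ring

/-- With `hasDerivAt_besselAux` this closes a first-order linear system for the pair `(J_ν,
J_{ν+1})`, which replaces Bessel's equation in the decay estimate. -/
theorem hasDerivAt_besselAux_succ {ν : ℝ} (hν : -1 / 2 ≤ ν) {r : ℝ} (hr : 0 < r) :
    HasDerivAt (besselAux (ν + 1)) (besselAux ν r - (ν + 1) / r * besselAux (ν + 1) r) r := by
  convert! hasDerivAt_besselAux (ν := ν + 1) (by linarith) hr using 1
  unfold besselAux
  rw [← besselSeries_recursion hν, Real.rpow_add_one (y := ν + 1) (by positivity),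
    Real.rpow_add_one (y := ν) (by positivity)]
  field_simp
  ring

/-- The decay `|J_{ν+1}(r)| = O(r^(-1/2))`. -/
theorem exists_besselAux_sq_le {ν : ℝ} (hν : -1 / 2 ≤ ν) :
    ∃ M z, 0 < z ∧ 0 ≤ M ∧ ∀ r, z ≤ r → r * besselAux (ν + 1) r ^ 2 ≤ M := by
  set c := 2 * ν + 1 with hc
  have hc0 : 0 ≤ c := by linarith
  set A := besselAux ν with hA
  set B := besselAux (ν + 1) with hB
  -- The system gives `(r (A² + B²))' = c (A² - B²)` and `(A B)' = A² - B² - A B / r`. Subtracting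
  -- `c A B` therefore cancels the leading part and leaves the small derivative `c A B / r`.
  let F : ℝ → ℝ := fun r => r * (A r ^ 2 + B r ^ 2) - c * (A r * B r)
  have hF : ∀ r, 0 < r → HasDerivAt F (c / r * (A r * B r)) r := by
    intro r hr
    have dA := hasDerivAt_besselAux hν hr
    have dB := hasDerivAt_besselAux_succ hν hr
    have h := ((hasDerivAt_id r).mul ((dA.pow 2).add (dB.pow 2))).sub ((dA.mul dB).const_mul c)
    convert! h using 1
    simp [← hA, ← hB]
    field_simp
    rw [hc]
    ring
  -- For `r ≥ 1 + c` the cross term is at most half of the main one, so `A B ≤ F / r` and `F' ≤ c F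
  -- / r²`. The integrating factor `exp (c / r)` absorbs this and makes `H` decreasing, hence
  -- bounded.
  let H : ℝ → ℝ := fun r => F r * Real.exp (c / r)
  have hH : ∀ r, 0 < r → HasDerivAt H
      ((c / r * (A r * B r) - c / r ^ 2 * F r) * Real.exp (c / r)) r := by
    intro r hr
    have h := (hF r hr).mul (((hasDerivAt_const r c).div (hasDerivAt_id r) hr.ne').exp)
    convert! h using 1
    simp
    ring
  have hlow : ∀ r, 1 + c ≤ r → r / 2 * (A r ^ 2 + B r ^ 2) ≤ F r := by
    intro r hr
    have h1 : c * (A r * B r) ≤ c * ((A r ^ 2 + B r ^ 2) / 2) :=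
      mul_le_mul_of_nonneg_left (by nlinarith [sq_nonneg (A r - B r)]) hc0
    have h2 : 0 ≤ A r ^ 2 + B r ^ 2 := by positivity
    simp only [F]
    nlinarith
  have hanti : AntitoneOn H (Ici (1 + c)) := by
    have hpos : ∀ r ∈ Ici (1 + c), 0 < r := fun r hr => by
      have : 1 + c ≤ r := hr
      linarith
    refine antitoneOn_of_deriv_nonpos (convex_Ici _)
      (fun r hr => (hH r (hpos r hr)).continuousAt.continuousWithinAt)
      (fun r hr => (hH r (hpos r (interior_subset hr))).differentiableAt.differentiableWithinAt)
      fun r hr => ?_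
    have hr' := interior_subset hr
    have hr0 := hpos r hr'
    rw [(hH r hr0).deriv]
    refine mul_nonpos_of_nonpos_of_nonneg ?_ (Real.exp_pos _).le
    have h1 := hlow r hr'
    have h2 : A r * B r ≤ (A r ^ 2 + B r ^ 2) / 2 := by nlinarith [sq_nonneg (A r - B r)]
    have h3 : r * (A r * B r) ≤ F r := by nlinarith
    have h4 : c / r * (A r * B r) = c / r ^ 2 * (r * (A r * B r)) := by field_simp
    rw [h4, ← mul_sub]
    exact mul_nonpos_of_nonneg_of_nonpos (by positivity) (by linarith)
  have hz : 0 < 1 + c := by linarith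
  have h0 : 0 ≤ H (1 + c) := by
    have := hlow (1 + c) le_rfl
    have h2 : 0 ≤ (1 + c) / 2 * (A (1 + c) ^ 2 + B (1 + c) ^ 2) := by positivity
    exact mul_nonneg (by linarith) (Real.exp_pos _).le
  refine ⟨2 * H (1 + c), 1 + c, hz, by linarith, fun r hr => ?_⟩
  have h1 := hanti self_mem_Ici hr hr
  have h2 := hlow r hr
  have hr0 : 0 < r := by linarith
  have h3 : 1 ≤ Real.exp (c / r) := Real.one_le_exp (by positivity)
  have h4 : 0 ≤ r / 2 * (A r ^ 2 + B r ^ 2) := by positivity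
  have h5 : F r ≤ H r := by
    simp only [H]
    nlinarith
  have h6 : 0 ≤ r * A r ^ 2 := by positivity
  nlinarith

/-- For large `z` the left side is `2^(n/2) z^(n/2) |J_{n/2}(z)|`, and `J_{n/2}(z) = O(z^(-1/2))`;
for small `z` continuity on a compact interval is enough. -/
theorem exists_pow_mul_besselSeries_le {n : ℕ} (hn : 1 ≤ n) :
    ∃ C, 0 ≤ C ∧ ∀ z, 0 ≤ z → |z ^ n * besselSeries ((n : ℝ) / 2) (z ^ 2 / 4)| ≤
      C * (1 + z) ^ (((n : ℝ) - 1) / 2) := by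
  have hn' : (1 : ℝ) ≤ n := by exact_mod_cast hn
  obtain ⟨M, z0, hz0, hM0, hM⟩ := exists_besselAux_sq_le (ν := (n : ℝ) / 2 - 1) (by linarith)
  rw [sub_add_cancel] at hM
  have hcont : Continuous fun z : ℝ => z ^ n * besselSeries ((n : ℝ) / 2) (z ^ 2 / 4) :=
    (by fun_prop : Continuous fun z : ℝ => z ^ n).mul
      ((continuous_besselSeries (by linarith)).comp (by fun_prop))
  obtain ⟨C0, hC0⟩ := isCompact_Icc.exists_bound_of_continuousOn (s := Icc 0 z0)
    hcont.continuousOn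
  have hC00 : 0 ≤ C0 := (norm_nonneg _).trans (hC0 0 ⟨le_rfl, hz0.le⟩)
  refine ⟨C0 + 2 ^ ((n : ℝ) / 2) * √M, by positivity, fun z hz => ?_⟩
  have hone : (1 : ℝ) ≤ (1 + z) ^ (((n : ℝ) - 1) / 2) :=
    Real.one_le_rpow (by linarith) (by linarith)
  have hs : 0 ≤ 2 ^ ((n : ℝ) / 2) * √M := by positivity
  rcases le_total z z0 with h | h
  · refine (hC0 z ⟨hz, h⟩).trans ?_
    nlinarith
  · have hz' : 0 < z := hz0.trans_le h
    have e1 : z ^ n * besselSeries ((n : ℝ) / 2) (z ^ 2 / 4) =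
        2 ^ ((n : ℝ) / 2) * (z ^ (((n : ℝ) - 1) / 2) * (√z * besselAux ((n : ℝ) / 2) z)) := by
      unfold besselAux
      rw [Real.div_rpow hz (by norm_num), Real.sqrt_eq_rpow]
      have : z ^ n = z ^ (((n : ℝ) - 1) / 2) * (z ^ (1 / 2 : ℝ) * z ^ ((n : ℝ) / 2)) := by
        rw [← Real.rpow_add hz', ← Real.rpow_add hz', ← Real.rpow_natCast]
        congr 1
        ring
      rw [this]
      field_simp
    have e2 : |√z * besselAux ((n : ℝ) / 2) z| ≤ √M := by
      apply Real.abs_le_sqrt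
      rw [mul_pow, Real.sq_sqrt hz]
      exact hM z h
    have e3 : z ^ (((n : ℝ) - 1) / 2) ≤ (1 + z) ^ (((n : ℝ) - 1) / 2) :=
      Real.rpow_le_rpow hz (by linarith) (by linarith)
    rw [e1, abs_mul, abs_mul, abs_of_pos (a := (2 : ℝ) ^ ((n : ℝ) / 2)) (by positivity),
      abs_of_pos (a := z ^ (((n : ℝ) - 1) / 2)) (by positivity)]
    calc 2 ^ ((n : ℝ) / 2) * (z ^ (((n : ℝ) - 1) / 2) * |√z * besselAux ((n : ℝ) / 2) z|)
        ≤ 2 ^ ((n : ℝ) / 2) * ((1 + z) ^ (((n : ℝ) - 1) / 2) * √M) := by gcongr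
      _ ≤ _ := by nlinarith

/-! ### Polar coordinates and spherical averages -/

/-- The surface measure of the unit sphere. -/
abbrev sphereMeasure (n : ℕ) : Measure (Metric.sphere (0 : E n) 1) :=
  (volume : Measure (E n)).toSphere

theorem integral_polar (hn : 1 ≤ n) {f : E n → ℝ} (hf : Integrable f) :
    ∫ x, f x = ∫ r in Ioi (0 : ℝ), r ^ (n - 1) *
      ∫ w : Metric.sphere (0 : E n) 1, f (r • (w : E n)) ∂(sphereMeasure n) := by
  have hmp := (volume : Measure (E n)).measurePreserving_homeomorphUnitSphereProd
  have hemb := (homeomorphUnitSphereProd (E n)).measurableEmbedding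
  rw [finrank_euclideanSpace_fin] at hmp
  let g : Metric.sphere (0 : E n) 1 × Ioi (0 : ℝ) → ℝ := fun z => f ((z.2 : ℝ) • (z.1 : E n))
  have hg : ∀ x : ({(0 : E n)}ᶜ : Set (E n)), g (homeomorphUnitSphereProd (E n) x) = f x := by
    intro x
    have h := congrArg Subtype.val ((homeomorphUnitSphereProd (E n)).symm_apply_apply x)
    rw [homeomorphUnitSphereProd_symm_apply_coe] at h
    simp only [g, h]
  have h1 : ∫ x, f x = ∫ z, g z ∂((sphereMeasure n).prod (Measure.volumeIoiPow (n - 1))) := by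
    rw [← hmp.integral_comp hemb g]
    simp only [hg]
    rw [integral_subtype_comap (measurableSet_singleton _).compl fun x ↦ f x]
    have : Nontrivial (E n) := by
      have : Nonempty (Fin n) := ⟨⟨0, hn⟩⟩
      infer_instance
    rw [restrict_compl_singleton]
  have hgi : Integrable g ((sphereMeasure n).prod (Measure.volumeIoiPow (n - 1))) := by
    rw [← hmp.integrable_comp_emb hemb]
    have : g ∘ homeomorphUnitSphereProd (E n) = fun x : ({(0 : E n)}ᶜ : Set (E n)) => f x := funext hg
    rw [this]
    exact (integrableOn_iff_comap_subtypeVal (measurableSet_singleton _).compl).1 hf.integrableOn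
  rw [h1, integral_prod_symm _ hgi]
  simp only [Measure.volumeIoiPow, ENNReal.ofReal]
  rw [integral_withDensity_eq_integral_smul (measurable_subtype_coe.pow_const _).real_toNNReal,
    integral_subtype_comap measurableSet_Ioi fun a : ℝ ↦ Real.toNNReal (a ^ (n - 1)) •
      ∫ w : Metric.sphere (0 : E n) 1, f (a • (w : E n)) ∂(sphereMeasure n)]
  refine setIntegral_congr_fun measurableSet_Ioi fun r hr => ?_
  rw [NNReal.smul_def, Real.coe_toNNReal _ (pow_nonneg (mem_Ioi.1 hr).le _), smul_eq_mul]

theorem integral_pow_mul_exp_neg_sq (j : ℕ) :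
    ∫ t : ℝ, t ^ (2 * j) * Real.exp (-t ^ 2) = Real.Gamma (j + 1 / 2) := by
  have h := integral_comp_abs (f := fun t => t ^ (2 * j) * Real.exp (-t ^ 2))
  have e : ∀ t : ℝ, |t| ^ (2 * j) = t ^ (2 * j) := fun t => by rw [pow_mul, sq_abs, ← pow_mul]
  simp only [e, sq_abs] at h
  rw [h]
  have h2 := integral_rpow_mul_exp_neg_rpow (p := 2) (q := ((2 * j : ℕ) : ℝ)) (by norm_num)
    (by have : (0 : ℝ) ≤ ((2 * j : ℕ) : ℝ) := Nat.cast_nonneg _; linarith)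
  simp only [Real.rpow_natCast, Real.rpow_two] at h2
  rw [h2]
  push_cast
  have : (2 * (j : ℝ) + 1) / 2 = j + 1 / 2 := by ring
  rw [this]
  ring

theorem integral_Ioi_pow_mul_exp_neg_sq (m : ℕ) :
    ∫ r in Ioi (0 : ℝ), r ^ m * Real.exp (-r ^ 2) = Real.Gamma ((m + 1) / 2) / 2 := by
  have h2 := integral_rpow_mul_exp_neg_rpow (p := 2) (q := (m : ℝ)) (by norm_num)
    (by have : (0 : ℝ) ≤ (m : ℝ) := Nat.cast_nonneg _; linarith)
  simp only [Real.rpow_natCast, Real.rpow_two] at h2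
  rw [h2]
  ring

theorem integral_coord_pow_mul_gaussian (i : Fin n) (j : ℕ) :
    ∫ ξ : E n, ξ i ^ (2 * j) * Real.exp (-‖ξ‖ ^ 2) =
      Real.Gamma (j + 1 / 2) * √π ^ (n - 1) := by
  have h1 := (PiLp.volume_preserving_ofLp (Fin n)).integral_comp
    (MeasurableEquiv.toLp 2 (Fin n → ℝ)).symm.measurableEmbedding
    (fun x : Fin n → ℝ => ∏ l, ((if l = i then x l ^ (2 * j) else 1) * Real.exp (-x l ^ 2)))
  rw [integral_fintype_prod_volume_eq_prod
    (fun l (t : ℝ) => (if l = i then t ^ (2 * j) else 1) * Real.exp (-t ^ 2))] at h1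
  have h2 : ∀ ξ : E n, ∏ l, ((if l = i then ξ l ^ (2 * j) else 1) * Real.exp (-ξ l ^ 2)) =
      ξ i ^ (2 * j) * Real.exp (-‖ξ‖ ^ 2) := by
    intro ξ
    rw [Finset.prod_mul_distrib, Finset.prod_ite_eq' Finset.univ i, ← Real.exp_sum,
      EuclideanSpace.real_norm_sq_eq, Finset.sum_neg_distrib]
    simp
  have h3 : ∀ l : Fin n, ∫ t : ℝ, (if l = i then t ^ (2 * j) else 1) * Real.exp (-t ^ 2) =
      if l = i then Real.Gamma (j + 1 / 2) else √π := by
    intro l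
    split_ifs
    · exact integral_pow_mul_exp_neg_sq j
    · have := integral_pow_mul_exp_neg_sq 0
      simp only [mul_zero, pow_zero, Nat.cast_zero, zero_add, Real.Gamma_one_half_eq] at this
      exact this
  simp only [h3] at h1
  rw [← Finset.mul_prod_erase Finset.univ _ (Finset.mem_univ i), if_pos rfl,
    Finset.prod_congr rfl (g := fun _ => √π) (fun l hl => if_neg (Finset.ne_of_mem_erase hl)),
    Finset.prod_const, Finset.card_erase_of_mem (Finset.mem_univ i), Finset.card_fin] at h1
  rw [← h1]
  congr 1 with ξ
  exact (h2 ξ).symm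

/-- The Gaussian is rotation invariant: a reflection carries `‖x‖` times a coordinate vector to `x`,
and the coordinate moment factors into one-dimensional integrals. -/
theorem integral_inner_pow_mul_gaussian (hn : 1 ≤ n) (x : E n) (j : ℕ) :
    ∫ ξ : E n, inner ℝ x ξ ^ (2 * j) * Real.exp (-‖ξ‖ ^ 2) =
      ‖x‖ ^ (2 * j) * (Real.Gamma (j + 1 / 2) * √π ^ (n - 1)) := by
  let i : Fin n := ⟨0, hn⟩
  let e : E n := ‖x‖ • EuclideanSpace.single i (1 : ℝ)
  have he : ‖e‖ = ‖x‖ := by simp [e, norm_smul]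
  let A := (ℝ ∙ (e - x))ᗮ.reflection
  have hA : A e = x := Submodule.reflection_sub he
  have h1 := (A.measurePreserving).integral_comp A.toHomeomorph.measurableEmbedding
    (fun ξ => inner ℝ x ξ ^ (2 * j) * Real.exp (-‖ξ‖ ^ 2))
  rw [← h1, ← integral_coord_pow_mul_gaussian i, ← integral_const_mul]
  congr 1 with ξ
  have h2 : inner ℝ x (A ξ) = ‖x‖ * ξ i := by
    rw [← hA, A.inner_map_map, real_inner_smul_left, EuclideanSpace.inner_single_left]
    simp [hA]
  rw [h2, A.norm_map, mul_pow]
  ring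

theorem integrable_inner_pow_mul_gaussian (hn : 1 ≤ n) (x : E n) (j : ℕ) :
    Integrable fun ξ : E n => inner ℝ x ξ ^ (2 * j) * Real.exp (-‖ξ‖ ^ 2) := by
  have h1 : Integrable fun ξ : E n => ‖ξ‖ ^ (2 * j) * Real.exp (-‖ξ‖ ^ 2) := by
    have : Nonempty (Fin n) := ⟨⟨0, hn⟩⟩
    rw [integrable_fun_norm_addHaar (volume : Measure (E n))
      (f := fun r => r ^ (2 * j) * Real.exp (-r ^ 2))]
    have h := integrableOn_rpow_mul_exp_neg_rpow (p := 2)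
      (s := ((Module.finrank ℝ (E n) - 1 + 2 * j : ℕ) : ℝ))
      (lt_of_lt_of_le (by norm_num) (Nat.cast_nonneg _)) (by norm_num)
    refine h.congr_fun (fun r _ => ?_) measurableSet_Ioi
    simp only [Real.rpow_natCast, Real.rpow_two, smul_eq_mul, pow_add, mul_assoc]
  refine (h1.const_mul (‖x‖ ^ (2 * j))).mono' (by fun_prop) (ae_of_all _ fun ξ => ?_)
  rw [norm_mul, norm_pow, Real.norm_of_nonneg (Real.exp_pos _).le, ← mul_assoc, ← mul_pow]
  gcongr
  exact norm_inner_le_norm x ξ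

/-- In polar coordinates the Gaussian moment splits into a radial Gamma integral times the spherical
moment, so the latter is a quotient of known quantities. The half-integer values of Gamma produce
the factor `(2j)! / j!`. -/
theorem integral_sphere_inner_pow (hn : 1 ≤ n) (x : E n) (j : ℕ) :
    ∫ w : Metric.sphere (0 : E n) 1, inner ℝ x (w : E n) ^ (2 * j) ∂(sphereMeasure n) =
      2 * π ^ ((n : ℝ) / 2) * (2 * j).factorial /
        (j.factorial * Real.Gamma (j + ((n : ℝ) / 2 - 1) + 1)) * (‖x‖ ^ 2 / 4) ^ j := by
  have h := integral_polar hn (integrable_inner_pow_mul_gaussian hn x j)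
  rw [integral_inner_pow_mul_gaussian hn] at h
  have h2 : ∀ (r : ℝ) (w : Metric.sphere (0 : E n) 1),
      inner ℝ x (r • (w : E n)) ^ (2 * j) * Real.exp (-‖r • (w : E n)‖ ^ 2) =
      (r ^ (2 * j) * Real.exp (-r ^ 2)) * inner ℝ x (w : E n) ^ (2 * j) := by
    intro r w
    have hw : ‖(w : E n)‖ = 1 := mem_sphere_zero_iff_norm.1 w.2
    rw [real_inner_smul_right, norm_smul, hw, mul_one, Real.norm_eq_abs, sq_abs, mul_pow]
    ring
  simp only [h2, integral_const_mul, ← mul_assoc, ← pow_add] at h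
  rw [integral_mul_const, integral_Ioi_pow_mul_exp_neg_sq] at h
  have e1 : (((n - 1 + 2 * j : ℕ) : ℝ) + 1) / 2 = j + ((n : ℝ) / 2 - 1) + 1 := by
    push_cast [Nat.cast_sub hn]
    ring
  rw [e1, Real.Gamma_nat_add_half] at h
  have hG : 0 < Real.Gamma (j + ((n : ℝ) / 2 - 1) + 1) := by
    apply Real.Gamma_pos_of_pos
    have : (1 : ℝ) ≤ n := by exact_mod_cast hn
    have : (0 : ℝ) ≤ j := j.cast_nonneg
    linarith
  have hfac : ((2 * j).factorial : ℝ) = 2 ^ j * j.factorial * (2 * j - 1 : ℕ).doubleFactorial := by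
    rcases j with _ | j
    · simp
    · have e : 2 * (j + 1) - 1 + 1 = 2 * (j + 1) := by omega
      have := Nat.factorial_eq_mul_doubleFactorial (2 * (j + 1) - 1)
      rw [e, Nat.doubleFactorial_two_mul] at this
      exact_mod_cast this
  have hpi : π ^ ((n : ℝ) / 2) = √π * √π ^ (n - 1) := by
    rw [← pow_succ', Nat.sub_add_cancel hn, Real.sqrt_eq_rpow, ← Real.rpow_natCast,
      ← Real.rpow_mul Real.pi_pos.le]
    congr 1
    ring
  set I := ∫ w : Metric.sphere (0 : E n) 1, inner ℝ x (w : E n) ^ (2 * j) ∂(sphereMeasure n)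
  rw [hfac, hpi, div_pow, ← pow_mul]
  have hj : (0 : ℝ) < j.factorial := by exact_mod_cast j.factorial_pos
  have h4 : (4 : ℝ) ^ j = 2 ^ j * 2 ^ j := by rw [← mul_pow]; norm_num
  rw [h4]
  generalize Real.Gamma (j + ((n : ℝ) / 2 - 1) + 1) = Γ at hG h ⊢
  field_simp
  field_simp at h
  linarith

/-- The average of a plane wave over the unit sphere is a Bessel function. -/
theorem integral_sphere_cos (hn : 1 ≤ n) (x : E n) :
    ∫ w : Metric.sphere (0 : E n) 1, Real.cos (inner ℝ x (w : E n)) ∂(sphereMeasure n) =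
      2 * π ^ ((n : ℝ) / 2) * besselSeries ((n : ℝ) / 2 - 1) (‖x‖ ^ 2 / 4) := by
  let F : ℕ → Metric.sphere (0 : E n) 1 → ℝ := fun j w =>
    (-1) ^ j * inner ℝ x (w : E n) ^ (2 * j) / (2 * j).factorial
  have hFc : ∀ j, Continuous (F j) := fun j => by
    simp only [F]
    fun_prop
  have hFb : ∀ j w, ‖F j w‖ ≤ ‖x‖ ^ (2 * j) / (2 * j).factorial := by
    intro j w
    have hw : ‖(w : E n)‖ = 1 := mem_sphere_zero_iff_norm.1 w.2
    have hi : ‖inner ℝ x (w : E n)‖ ≤ ‖x‖ := by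
      have := norm_inner_le_norm (𝕜 := ℝ) x (w : E n)
      rwa [hw, mul_one] at this
    simp only [F]
    rw [norm_div, norm_mul, norm_pow, norm_pow, norm_neg, norm_one, one_pow, one_mul,
      Real.norm_natCast]
    gcongr
  have hFi : ∀ j, Integrable (F j) (sphereMeasure n) := fun j =>
    Integrable.of_bound (hFc j).aestronglyMeasurable _ (ae_of_all _ (hFb j))
  -- The cosine series may be integrated term by term: it is dominated by the even terms of the
  -- exponential series of `‖x‖`.
  have hsum : Summable fun j => ∫ w, ‖F j w‖ ∂(sphereMeasure n) := by
    have hs := (Real.summable_pow_div_factorial ‖x‖).comp_injective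
      (i := fun j : ℕ => 2 * j) (fun a b h => by simpa using h)
    refine Summable.of_nonneg_of_le (fun j => integral_nonneg fun w => norm_nonneg _)
      (fun j => ?_) (hs.mul_left ((sphereMeasure n).real univ))
    calc ∫ w, ‖F j w‖ ∂(sphereMeasure n)
        ≤ ∫ w, ‖x‖ ^ (2 * j) / (2 * j).factorial ∂(sphereMeasure n) :=
          integral_mono (hFi j).norm (integrable_const _) (hFb j)
      _ = _ := by rw [integral_const, smul_eq_mul]; rfl
  have h := hasSum_integral_of_summable_integral_norm hFi hsum
  have e1 : ∀ w : Metric.sphere (0 : E n) 1, ∑' j, F j w = Real.cos (inner ℝ x (w : E n)) :=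
    fun w => (Real.hasSum_cos _).tsum_eq
  simp only [e1] at h
  rw [← h.tsum_eq, besselSeries, ← tsum_mul_left]
  congr 1 with j
  simp only [F]
  rw [integral_div, integral_const_mul, integral_sphere_inner_pow hn]
  have : (0 : ℝ) < (2 * j).factorial := by exact_mod_cast (2 * j).factorial_pos
  field_simp

/-! ### The truncated Hankel integrals -/

/-- The truncated Hankel integral, continued to the origin. -/
def hankelSmooth (n : ℕ) (s R : ℝ) (x : E n) : ℝ :=
  2 ^ (1 - (n : ℝ) / 2) * ∫ r in (0 : ℝ)..R, r ^ (n - 1) *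
    (besselSeries ((n : ℝ) / 2 - 1) (r ^ 2 * ‖x‖ ^ 2 / 4) * resolventProfile (2 * s) r)

/-- The powers of `‖x‖` outside and inside the Bessel function cancel, leaving a power series in
`‖x‖ ^ 2`, which also makes sense at the origin. -/
theorem hankelTrunc_eq (hn : 1 ≤ n) (s : ℝ) {R : ℝ} (hR : 0 ≤ R) {x : E n} (hx : x ≠ 0) :
    hankelTrunc n s R x = hankelSmooth n s R x := by
  have hρ : 0 < ‖x‖ := norm_pos_iff.2 hx
  unfold hankelTrunc hankelSmooth
  rw [intervalIntegral.integral_of_le hR, intervalIntegral.integral_of_le hR,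
    ← integral_const_mul, ← integral_const_mul]
  refine setIntegral_congr_fun measurableSet_Ioc fun r hr => ?_
  have hr0 : 0 < r := hr.1
  rw [besselJ_eq (mul_pos hr0 hρ), mul_pow, Real.div_rpow (by positivity) (by norm_num),
    Real.mul_rpow hr0.le hρ.le]
  have e1 : ‖x‖ ^ (1 - (n : ℝ) / 2) * ‖x‖ ^ ((n : ℝ) / 2 - 1) = 1 := by
    rw [← Real.rpow_add hρ]; simp
  have e2 : r ^ ((n : ℝ) / 2 - 1) * r ^ ((n : ℝ) / 2) = r ^ (n - 1) := by
    rw [← Real.rpow_add hr0, ← Real.rpow_natCast, Nat.cast_sub hn]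
    congr 1
    push_cast
    ring
  have e3 : (2 : ℝ) ^ (1 - (n : ℝ) / 2) = (2 ^ ((n : ℝ) / 2 - 1))⁻¹ := by
    rw [← Real.rpow_neg (by norm_num)]
    congr 1
    ring
  rw [e3, ← e2]
  unfold resolventProfile
  generalize besselSeries ((n : ℝ) / 2 - 1) (r ^ 2 * ‖x‖ ^ 2 / 4) = B
  calc _ = (‖x‖ ^ (1 - (n : ℝ) / 2) * ‖x‖ ^ ((n : ℝ) / 2 - 1)) *
        ((2 ^ ((n : ℝ) / 2 - 1))⁻¹ * (r ^ ((n : ℝ) / 2 - 1) * r ^ ((n : ℝ) / 2) *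
        (B * (1 + r ^ (2 * s))⁻¹))) := by
        rw [div_eq_mul_inv, div_eq_mul_inv]
        ring
    _ = _ := by rw [e1, one_mul]

theorem continuous_resolventProfile_norm {s : ℝ} (hs : 0 < s) :
    Continuous fun ξ : E n => resolventProfile (2 * s) ‖ξ‖ :=
  (continuousOn_resolventProfile (by positivity)).comp_continuous continuous_norm
    fun ξ => norm_nonneg ξ

theorem norm_resolventProfile_norm_le (s : ℝ) (ξ : E n) : ‖resolventProfile (2 * s) ‖ξ‖‖ ≤ 1 := by
  obtain ⟨h1, h2⟩ := resolventProfile_mem (s := 2 * s) (norm_nonneg ξ)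
  rwa [Real.norm_of_nonneg h1]

/-- The truncated Hankel integral as an integral over a ball in frequency space. -/
theorem hankelSmooth_eq_integral (hn : 1 ≤ n) {s : ℝ} (hs : 0 < s) {R : ℝ} (hR : 0 ≤ R) (x : E n) :
    hankelSmooth n s R x = (2 * π) ^ (-(n : ℝ) / 2) *
      ∫ ξ in Metric.closedBall (0 : E n) R,
        Real.cos (inner ℝ x ξ) * resolventProfile (2 * s) ‖ξ‖ := by
  have hc : Continuous fun ξ : E n => Real.cos (inner ℝ x ξ) * resolventProfile (2 * s) ‖ξ‖ :=
    (by fun_prop : Continuous fun ξ : E n => Real.cos (inner ℝ x ξ)).mul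
      (continuous_resolventProfile_norm hs)
  have hi : IntegrableOn _ (Metric.closedBall (0 : E n) R) volume :=
    hc.continuousOn.integrableOn_compact (isCompact_closedBall (0 : E n) R)
  have hi2 := (integrable_indicator_iff Metric.isClosed_closedBall.measurableSet).2 hi
  rw [← integral_indicator Metric.isClosed_closedBall.measurableSet, integral_polar hn hi2]
  have h1 : ∀ r ∈ Ioi (0 : ℝ), r ^ (n - 1) * ∫ w : Metric.sphere (0 : E n) 1,
      (Metric.closedBall (0 : E n) R).indicator
        (fun ξ => Real.cos (inner ℝ x ξ) * resolventProfile (2 * s) ‖ξ‖) (r • (w : E n))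
        ∂(sphereMeasure n) = (Iic R).indicator (fun r => 2 * π ^ ((n : ℝ) / 2) * (r ^ (n - 1) *
          (besselSeries ((n : ℝ) / 2 - 1) (r ^ 2 * ‖x‖ ^ 2 / 4) *
            resolventProfile (2 * s) r))) r := by
    intro r hr
    have hr0 : 0 < r := hr
    have h2 : ∀ w : Metric.sphere (0 : E n) 1, (Metric.closedBall (0 : E n) R).indicator
        (fun ξ => Real.cos (inner ℝ x ξ) * resolventProfile (2 * s) ‖ξ‖) (r • (w : E n)) =
        (Iic R).indicator (fun r => resolventProfile (2 * s) r) r *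
          Real.cos (inner ℝ (r • x) (w : E n)) := by
      intro w
      have hw : ‖(w : E n)‖ = 1 := mem_sphere_zero_iff_norm.1 w.2
      have hrw : ‖r • (w : E n)‖ = r := by
        rw [norm_smul, hw, mul_one, Real.norm_of_nonneg hr0.le]
      by_cases hrR : r ≤ R
      · rw [indicator_of_mem (by rw [mem_closedBall_zero_iff, hrw]; exact hrR),
          indicator_of_mem (mem_Iic.2 hrR), hrw, real_inner_smul_left, real_inner_smul_right,
          mul_comm]
      · rw [indicator_of_notMem (by rw [mem_closedBall_zero_iff, hrw]; exact hrR),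
          indicator_of_notMem (by rwa [mem_Iic]), zero_mul]
    simp only [h2]
    rw [integral_const_mul, integral_sphere_cos hn, norm_smul, Real.norm_of_nonneg hr0.le, mul_pow]
    simp only [indicator_apply]
    split_ifs <;> ring
  rw [setIntegral_congr_fun measurableSet_Ioi h1, setIntegral_indicator measurableSet_Iic,
    Ioi_inter_Iic, integral_const_mul, ← intervalIntegral.integral_of_le hR, hankelSmooth,
    ← mul_assoc, ← mul_assoc]
  congr 1
  have e1 : (2 * π) ^ (-(n : ℝ) / 2) * (2 * π ^ ((n : ℝ) / 2)) = 2 * 2 ^ (-(n : ℝ) / 2) := by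
    rw [Real.mul_rpow (by norm_num) Real.pi_pos.le, neg_div, Real.rpow_neg Real.pi_pos.le]
    have : 0 < π ^ ((n : ℝ) / 2) := by positivity
    field_simp
  rw [← mul_assoc] at e1
  rw [e1, sub_eq_add_neg, Real.rpow_add (by norm_num), Real.rpow_one, neg_div]

theorem continuous_hankelSmooth (hn : 1 ≤ n) {s : ℝ} (hs : 0 < s) {R : ℝ} (hR : 0 ≤ R) :
    Continuous (hankelSmooth n s R) := by
  have : hankelSmooth n s R = fun x => (2 * π) ^ (-(n : ℝ) / 2) *
      ∫ ξ in Metric.closedBall (0 : E n) R,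
        Real.cos (inner ℝ x ξ) * resolventProfile (2 * s) ‖ξ‖ :=
    funext fun x => hankelSmooth_eq_integral hn hs hR x
  rw [this]
  refine continuous_const.mul ?_
  refine continuous_of_dominated (bound := fun _ => 1) (fun x => ?_) (fun x => ?_) ?_ ?_
  · exact ((by fun_prop : Continuous fun ξ : E n => Real.cos (inner ℝ x ξ)).mul
      (continuous_resolventProfile_norm hs)).aestronglyMeasurable
  · refine ae_of_all _ fun ξ => ?_
    rw [norm_mul]
    exact mul_le_one₀ (Real.abs_cos_le_one _) (norm_nonneg _) (norm_resolventProfile_norm_le s ξ)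
  · exact (continuous_const (y := (1 : ℝ))).continuousOn.integrableOn_compact
      (isCompact_closedBall (0 : E n) R)
  · exact ae_of_all _ fun ξ => by fun_prop

theorem ae_ne_zero (hn : 1 ≤ n) : ∀ᵐ x : E n, x ≠ 0 := by
  have : Nonempty (Fin n) := ⟨⟨0, hn⟩⟩
  exact Measure.ae_ne volume 0

/-! ### Convergence in the sense of distributions -/

/-- A real Schwartz function as a complex one. -/
def schwartzToComplex (ψ : 𝓢(E n, ℝ)) : 𝓢(E n, ℂ) :=
  SchwartzMap.postcompCLM (𝕜 := ℝ) Complex.ofRealCLM ψ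

@[simp]
theorem schwartzToComplex_apply (ψ : 𝓢(E n, ℝ)) (x : E n) :
    schwartzToComplex ψ x = (ψ x : ℂ) := rfl

theorem re_fourier_real (ψ : 𝓢(E n, ℝ)) (ξ : E n) :
    (𝓕 (schwartzToComplex ψ : E n → ℂ) ((2 * π)⁻¹ • ξ)).re =
      ∫ x, Real.cos (inner ℝ x ξ) * ψ x := by
  have hint := (Real.fourierIntegral_convergent_iff ((2 * π)⁻¹ • ξ)).2
    ((schwartzToComplex ψ).integrable (μ := volume))
  rw [Real.fourier_eq, ← RCLike.re_eq_complex_re, ← integral_re hint]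
  congr 1 with x
  rw [RCLike.re_eq_complex_re, Circle.smul_def, smul_eq_mul, schwartzToComplex_apply,
    Complex.re_mul_ofReal, Real.fourierChar_apply, real_inner_smul_right]
  have : ((2 * π * -((2 * π)⁻¹ * inner ℝ x ξ) : ℝ) : ℂ) * Complex.I =
      ((-inner ℝ x ξ : ℝ) : ℂ) * Complex.I := by
    congr 2
    field_simp
  rw [this, Complex.exp_ofReal_mul_I_re, Real.cos_neg]

/-- Fubini moves the truncation to the frequency side, where the pairing becomes the integral over a
ball of the bounded profile times the transform of `ψ`. That product is integrable on the whole
space, so exhaustion by balls gives the limit, for every `s > 0`. -/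
theorem tendsto_integral_hankelTrunc (hn : 1 ≤ n) {s : ℝ} (hs : 0 < s) {k : E n → ℝ}
    (hk : Integrable k) (hF : ∀ η ≠ 0, 𝓕 (fun x => (k x : ℂ)) η = ((abarSymbol s η)⁻¹ : ℝ))
    (ψ : 𝓢(E n, ℝ)) :
    Tendsto (fun R => ∫ x, hankelTrunc n s R x * ψ x) atTop
      (𝓝 (∫ x, ((2 * π) ^ ((n : ℝ) / 2) * k x) * ψ x)) := by
  set Ψ : 𝓢(E n, ℂ) := 𝓕 (schwartzToComplex ψ) with hΨ
  have hΨc : (Ψ : E n → ℂ) = 𝓕 (schwartzToComplex ψ : E n → ℂ) := by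
    rw [hΨ, SchwartzMap.fourier_coe]
  have hΨi : Integrable fun ξ : E n => (Ψ ((2 * π)⁻¹ • ξ)).re :=
    (Ψ.integrable.comp_smul (by positivity)).re
  have hmi : Integrable fun ξ : E n => resolventProfile (2 * s) ‖ξ‖ * (Ψ ((2 * π)⁻¹ • ξ)).re :=
    hΨi.bdd_mul (continuous_resolventProfile_norm hs).aestronglyMeasurable
      (ae_of_all _ (norm_resolventProfile_norm_le s))
  have htrunc : ∀ R, 0 ≤ R → ∫ x, hankelTrunc n s R x * ψ x = (2 * π) ^ (-(n : ℝ) / 2) *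
      ∫ ξ in Metric.closedBall (0 : E n) R,
        resolventProfile (2 * s) ‖ξ‖ * (Ψ ((2 * π)⁻¹ • ξ)).re := by
    intro R hR
    have hsw : Integrable (Function.uncurry fun (x ξ : E n) =>
        Real.cos (inner ℝ x ξ) * resolventProfile (2 * s) ‖ξ‖ * ψ x)
        (volume.prod (volume.restrict (Metric.closedBall (0 : E n) R))) := by
      have h1 : Integrable (fun z : E n × E n => ψ z.1 * (1 : ℝ))
          (volume.prod (volume.restrict (Metric.closedBall (0 : E n) R))) :=
        ψ.integrable.mul_prod ((continuous_const (y := (1 : ℝ))).continuousOn.integrableOn_compact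
          (isCompact_closedBall (0 : E n) R))
      refine h1.mono ?_ (ae_of_all _ fun z => ?_)
      · have h2 : Continuous fun z : E n × E n => resolventProfile (2 * s) ‖z.2‖ :=
          (continuous_resolventProfile_norm hs).comp continuous_snd
        have h3 : Continuous fun z : E n × E n => Real.cos (inner ℝ z.1 z.2) := by fun_prop
        exact ((h3.mul h2).mul (ψ.continuous.comp continuous_fst)).aestronglyMeasurable
      · simp only [Function.uncurry, norm_mul, mul_one]
        have := mul_le_one₀ (Real.abs_cos_le_one (inner ℝ z.1 z.2)) (norm_nonneg _)
          (norm_resolventProfile_norm_le s z.2)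
        exact (mul_le_of_le_one_left (norm_nonneg _) this).trans (by simp)
    calc ∫ x, hankelTrunc n s R x * ψ x = ∫ x, hankelSmooth n s R x * ψ x := by
          apply integral_congr_ae
          filter_upwards [ae_ne_zero hn] with x hx
          rw [hankelTrunc_eq hn s hR hx]
      _ = (2 * π) ^ (-(n : ℝ) / 2) * ∫ x, ∫ ξ in Metric.closedBall (0 : E n) R,
            Real.cos (inner ℝ x ξ) * resolventProfile (2 * s) ‖ξ‖ * ψ x := by
          rw [← integral_const_mul]
          congr 1 with x
          rw [hankelSmooth_eq_integral hn hs hR, integral_mul_const, mul_assoc]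
      _ = _ := by
          rw [integral_integral_swap hsw]
          congr 2 with ξ
          rw [hΨc, re_fourier_real, ← integral_const_mul]
          congr 1 with x
          ring
  have hlimit : Tendsto (fun R => (2 * π) ^ (-(n : ℝ) / 2) *
      ∫ ξ in Metric.closedBall (0 : E n) R,
        resolventProfile (2 * s) ‖ξ‖ * (Ψ ((2 * π)⁻¹ • ξ)).re) atTop
      (𝓝 ((2 * π) ^ (-(n : ℝ) / 2) *
        ∫ ξ, resolventProfile (2 * s) ‖ξ‖ * (Ψ ((2 * π)⁻¹ • ξ)).re)) :=
    ((aecover_closedBall tendsto_id).integral_tendsto_of_countably_generated hmi).const_mul _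
  have hscale : ∫ ξ, resolventProfile (2 * s) ‖ξ‖ * (Ψ ((2 * π)⁻¹ • ξ)).re =
      (2 * π) ^ n * ∫ η, (abarSymbol s η)⁻¹ * (Ψ η).re := by
    have h := Measure.integral_comp_inv_smul_of_nonneg (volume : Measure (E n))
      (fun η => (abarSymbol s η)⁻¹ * (Ψ η).re) (R := 2 * π) (by positivity)
    rw [finrank_euclideanSpace_fin, smul_eq_mul] at h
    rw [← h]
    congr 1 with ξ
    congr 1
    unfold abarSymbol resolventProfile
    rw [norm_smul, norm_inv, Real.norm_of_nonneg (by positivity),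
      mul_inv_cancel_left₀ (by positivity)]
  -- Duality: `ψ` is the inverse transform of `Ψ`, and moving this inverse transform to `k` produces
  -- the reciprocal of the symbol.
  have hpair : ∫ x, k x * ψ x = ∫ η, (abarSymbol s η)⁻¹ * (Ψ η).re := by
    have hinv : 𝓕⁻ (Ψ : E n → ℂ) = fun x => (ψ x : ℂ) := by
      rw [← SchwartzMap.fourierInv_coe, hΨ, FourierTransform.fourierInv_fourier_eq]
      rfl
    have h := integral_fourierInv_mul_eq_flip (f := fun x => (k x : ℂ)) hk.ofReal
      (Ψ.integrable (μ := volume))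
    rw [hinv] at h
    have h2 : ∫ η, 𝓕⁻ (fun x => (k x : ℂ)) η * Ψ η =
        ∫ η, (((abarSymbol s η)⁻¹ : ℝ) : ℂ) * Ψ η := by
      apply integral_congr_ae
      filter_upwards [ae_ne_zero hn] with η hη
      rw [Real.fourierInv_eq_fourier_neg, hF _ (neg_ne_zero.2 hη), abarSymbol_neg]
    have hi : Integrable fun η => (((abarSymbol s η)⁻¹ : ℝ) : ℂ) * Ψ η := by
      refine Ψ.integrable.bdd_mul (c := 1) (Complex.continuous_ofReal.comp
        ((continuous_abarSymbol hs).inv₀ fun η => (abarSymbol_pos s η).ne')).aestronglyMeasurable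
        (ae_of_all _ fun η => ?_)
      rw [Complex.norm_real, norm_inv, Real.norm_of_nonneg (abarSymbol_pos s η).le]
      exact inv_le_one_of_one_le₀ (one_le_abarSymbol s η)
    rw [h2] at h
    have h3 := congrArg Complex.re h
    rw [← RCLike.re_eq_complex_re, ← integral_re hi] at h3
    simp only [RCLike.re_eq_complex_re, Complex.re_ofReal_mul] at h3
    rw [h3]
    have h4 : ∫ x, (k x : ℂ) * (ψ x : ℂ) = ((∫ x, k x * ψ x : ℝ) : ℂ) := by
      rw [← integral_complex_ofReal]
      push_cast
      rfl
    rw [h4, Complex.ofReal_re]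
  -- The factor `(2π)^n` from the substitution `ξ = 2πη` meets `(2π)^(-n/2)`; this is the origin of
  -- the constant `(2π)^(n/2)` in front of `k`.
  have hval : (2 * π) ^ (-(n : ℝ) / 2) *
        ∫ ξ, resolventProfile (2 * s) ‖ξ‖ * (Ψ ((2 * π)⁻¹ • ξ)).re =
      ∫ x, ((2 * π) ^ ((n : ℝ) / 2) * k x) * ψ x := by
    simp only [mul_assoc ((2 * π) ^ ((n : ℝ) / 2))]
    rw [hscale, integral_const_mul, hpair, ← mul_assoc]
    congr 1
    rw [← Real.rpow_natCast, ← Real.rpow_add (by positivity)]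
    congr 1
    ring
  rw [← hval]
  refine hlimit.congr' ?_
  filter_upwards [eventually_ge_atTop 0] with R hR
  exact (htrunc R hR).symm

/-! ### Pointwise convergence of the Hankel integral -/

/-- The factor `r^n f_{n/2}(r²ρ²/4)`, the primitive of `2 r^(n-1) f_{n/2-1}(r²ρ²/4)`. -/
def hankelPrimitive (n : ℕ) (ρ r : ℝ) : ℝ := r ^ n * besselSeries ((n : ℝ) / 2) (r ^ 2 * ρ ^ 2 / 4)

theorem neg_half_le (hn : 1 ≤ n) : -1 / 2 ≤ (n : ℝ) / 2 - 1 := by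
  have : (1 : ℝ) ≤ n := by exact_mod_cast hn
  linarith

/-- With `y = r²ρ²/4` the product rule gives `2 r^(n-1) ((n/2) f_{n/2}(y) - y f_{n/2+1}(y))`, and
the recursion identifies the bracket. -/
theorem hasDerivAt_hankelPrimitive (hn : 1 ≤ n) (ρ r : ℝ) :
    HasDerivAt (hankelPrimitive n ρ)
      (2 * (r ^ (n - 1) * besselSeries ((n : ℝ) / 2 - 1) (r ^ 2 * ρ ^ 2 / 4))) r := by
  have hν := neg_half_le hn
  have h1 : HasDerivAt (fun r : ℝ => r ^ 2 * ρ ^ 2 / 4) (r * ρ ^ 2 / 2) r := by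
    have h := ((hasDerivAt_pow 2 r).mul_const (ρ ^ 2)).div_const 4
    convert! h using 1
    simp
    ring
  have h2 := (hasDerivAt_pow n r).mul
    ((hasDerivAt_besselSeries (ν := (n : ℝ) / 2) (by linarith) (r ^ 2 * ρ ^ 2 / 4)).comp r h1)
  have h3 := besselSeries_recursion hν (r ^ 2 * ρ ^ 2 / 4)
  rw [sub_add_cancel] at h3
  rw [← h3]
  convert! h2 using 1
  simp only [Function.comp]
  obtain ⟨m, rfl⟩ : ∃ m, n = m + 1 := ⟨n - 1, by omega⟩
  rw [Nat.add_sub_cancel, pow_succ]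
  ring

theorem continuous_hankelPrimitive (hn : 1 ≤ n) (ρ : ℝ) : Continuous (hankelPrimitive n ρ) :=
  continuous_iff_continuousAt.2 fun r => (hasDerivAt_hankelPrimitive hn ρ r).continuousAt

/-- Scaling to `z = r * ρ` and `1 + r * ρ ≤ (1 + ρ) * (1 + r)` separate the variables. The bound is
thus locally uniform in `x ≠ 0` while its growth in `r` stays `(n-1)/2`. -/
theorem exists_hankelPrimitive_le (hn : 1 ≤ n) : ∃ C, 0 ≤ C ∧ ∀ ρ r : ℝ, 0 < ρ → 0 ≤ r →
    |hankelPrimitive n ρ r| ≤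
      C * ((ρ ^ n)⁻¹ * (1 + ρ) ^ (((n : ℝ) - 1) / 2)) * (1 + r) ^ (((n : ℝ) - 1) / 2) := by
  obtain ⟨C, hC, h⟩ := exists_pow_mul_besselSeries_le hn
  have he : 0 ≤ ((n : ℝ) - 1) / 2 := by
    have : (1 : ℝ) ≤ n := by exact_mod_cast hn
    linarith
  refine ⟨C, hC, fun ρ r hρ hr => ?_⟩
  have h1 := h (r * ρ) (by positivity)
  have h2 : hankelPrimitive n ρ r =
      (ρ ^ n)⁻¹ * ((r * ρ) ^ n * besselSeries ((n : ℝ) / 2) ((r * ρ) ^ 2 / 4)) := by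
    unfold hankelPrimitive
    rw [mul_pow, mul_pow]
    field_simp
  rw [h2, abs_mul, abs_of_pos (by positivity)]
  have h3 : (1 + r * ρ) ^ (((n : ℝ) - 1) / 2) ≤
      (1 + ρ) ^ (((n : ℝ) - 1) / 2) * (1 + r) ^ (((n : ℝ) - 1) / 2) := by
    rw [← Real.mul_rpow (by positivity) (by positivity)]
    exact Real.rpow_le_rpow (by positivity) (by nlinarith) he
  calc _ ≤ (ρ ^ n)⁻¹ * (C * ((1 + ρ) ^ (((n : ℝ) - 1) / 2) * (1 + r) ^ (((n : ℝ) - 1) / 2))) := by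
        gcongr
        exact h1.trans (by gcongr)
    _ = _ := by ring

theorem resolventProfile_le_rpow {s r : ℝ} (hr : 0 < r) : resolventProfile s r ≤ r ^ (-s) := by
  unfold resolventProfile
  rw [Real.rpow_neg hr.le]
  have : 0 < r ^ s := by positivity
  gcongr
  linarith

theorem one_add_rpow_le {e r : ℝ} (he : 0 ≤ e) (hr : 1 ≤ r) : (1 + r) ^ e ≤ 2 ^ e * r ^ e := by
  rw [← Real.mul_rpow (by norm_num) (by linarith)]
  exact Real.rpow_le_rpow (by linarith) (by linarith) he

theorem rpow_mul_resolventProfile_le {e s r : ℝ} (he : 0 ≤ e) (hr : 1 ≤ r) :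
    (1 + r) ^ e * resolventProfile s r ≤ 2 ^ e * r ^ (-(s - e)) := by
  have hr0 : 0 < r := by linarith
  calc (1 + r) ^ e * resolventProfile s r ≤ (2 ^ e * r ^ e) * r ^ (-s) :=
        mul_le_mul (one_add_rpow_le he hr) (resolventProfile_le_rpow hr0)
          (resolventProfile_mem hr0.le).1 (by positivity)
    _ = _ := by
      rw [mul_assoc, ← Real.rpow_add hr0]
      congr 2
      ring

theorem tendsto_rpow_mul_resolventProfile {e s : ℝ} (he : 0 ≤ e) (hes : e < s) :
    Tendsto (fun r => (1 + r) ^ e * resolventProfile s r) atTop (𝓝 0) := by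
  have h1 : Tendsto (fun r : ℝ => 2 ^ e * r ^ (-(s - e))) atTop (𝓝 (2 ^ e * 0)) :=
    (tendsto_rpow_neg_atTop (by linarith)).const_mul _
  rw [mul_zero] at h1
  refine squeeze_zero' ?_ ?_ h1
  · filter_upwards [eventually_ge_atTop 0] with r hr
    exact mul_nonneg (by positivity) (resolventProfile_mem hr).1
  · filter_upwards [eventually_ge_atTop 1] with r hr
    exact rpow_mul_resolventProfile_le he hr

theorem continuousOn_resolventDensity {s : ℝ} (hs : 0 < s) :
    ContinuousOn (resolventDensity s) (Ioi 0) := by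
  have h := (continuousOn_resolventProfile hs).mono Ioi_subset_Ici_self
  exact (h.mul (continuousOn_const.sub h)).div continuousOn_id fun x hx => (mem_Ioi.1 hx).ne'

/-- Near `0` the density is already integrable, and at infinity it is `O(r^(-s-1))`. Used with `2 *
s` in place of `s` and `e = (n-1)/2`, the condition `e < 2 * s` is the threshold of the pointwise
statement. -/
theorem integrableOn_rpow_mul_resolventDensity {e s : ℝ} (hs : 0 < s) (he : 0 ≤ e) (hes : e < s) :
    IntegrableOn (fun r => (1 + r) ^ e * resolventDensity s r) (Ioi 0) := by
  have hm : ContinuousOn (fun r : ℝ => (1 + r) ^ e * resolventDensity s r) (Ioi 0) :=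
    (ContinuousOn.rpow_const (by fun_prop) fun x hx => Or.inl (by
      have := mem_Ioi.1 hx
      positivity)).mul (continuousOn_resolventDensity hs)
  rw [← Ioc_union_Ioi_eq_Ioi (zero_le_one : (0 : ℝ) ≤ 1)]
  refine IntegrableOn.union ?_ ?_
  · refine Integrable.mono' (((integrableOn_resolventDensity hs).mono_set
      Ioc_subset_Ioi_self).const_mul (2 ^ e))
      ((hm.mono Ioc_subset_Ioi_self).aestronglyMeasurable measurableSet_Ioc) ?_
    filter_upwards [ae_restrict_mem measurableSet_Ioc] with r hr
    have hd := resolventDensity_nonneg s hr.1.le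
    have hr0 := hr.1
    rw [Real.norm_of_nonneg (by positivity)]
    refine mul_le_mul_of_nonneg_right ?_ hd
    exact Real.rpow_le_rpow (by positivity) (by linarith [hr.2]) he
  · refine Integrable.mono' ((integrableOn_Ioi_rpow_of_lt (a := -(s - e) - 1) (by linarith)
      zero_lt_one).const_mul (2 ^ e))
      ((hm.mono (Ioi_subset_Ioi zero_le_one)).aestronglyMeasurable measurableSet_Ioi) ?_
    filter_upwards [ae_restrict_mem measurableSet_Ioi] with r hr
    have hr1 : 1 < r := hr
    have hr0 : 0 < r := by linarith
    have hd := resolventDensity_nonneg s hr0.le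
    rw [Real.norm_of_nonneg (by positivity)]
    have h1 := rpow_mul_resolventProfile_le (s := s) he hr1.le
    obtain ⟨q0, q1⟩ := resolventProfile_mem (s := s) hr0.le
    have h2 : resolventDensity s r ≤ resolventProfile s r / r := by
      unfold resolventDensity
      gcongr
      nlinarith
    calc (1 + r) ^ e * resolventDensity s r ≤ (1 + r) ^ e * (resolventProfile s r / r) := by gcongr
      _ = ((1 + r) ^ e * resolventProfile s r) / r := by ring
      _ ≤ (2 ^ e * r ^ (-(s - e))) / r := by gcongr
      _ = _ := by rw [Real.rpow_sub_one hr0.ne']; ring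

theorem integrableOn_hankelPrimitive_mul (hn : 1 ≤ n) {s : ℝ} (hs : 0 < s) (ρ R : ℝ) :
    IntervalIntegrable (fun r => hankelPrimitive n ρ r * resolventDensity (2 * s) r) volume 0 R ∨
      R < 0 := by
  rcases lt_or_ge R 0 with h | h
  · exact Or.inr h
  left
  rw [intervalIntegrable_iff_integrableOn_Ioc_of_le h]
  obtain ⟨C, hC⟩ := isCompact_Icc.exists_bound_of_continuousOn (s := Icc 0 R)
    (continuous_hankelPrimitive hn ρ).continuousOn
  refine Integrable.bdd_mul (c := C) ((integrableOn_resolventDensity (s := 2 * s)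
    (by positivity)).mono_set Ioc_subset_Ioi_self)
    (continuous_hankelPrimitive hn ρ).aestronglyMeasurable ?_
  filter_upwards [ae_restrict_mem measurableSet_Ioc] with r hr
  exact hC r ⟨hr.1.le, hr.2⟩

/-- Integration by parts in the truncated Hankel integral. -/
theorem hankelSmooth_eq_by_parts (hn : 1 ≤ n) {s : ℝ} (hs : 0 < s) {R : ℝ} (hR : 0 ≤ R) (x : E n) :
    hankelSmooth n s R x = 2 ^ (-(n : ℝ) / 2) *
      (hankelPrimitive n ‖x‖ R * resolventProfile (2 * s) R +
        2 * s * ∫ r in (0 : ℝ)..R, hankelPrimitive n ‖x‖ r * resolventDensity (2 * s) r) := by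
  set ρ := ‖x‖
  have hs2 : 0 < 2 * s := by positivity
  have hI2 := (integrableOn_hankelPrimitive_mul hn hs ρ R).resolve_right (not_lt.2 hR)
  have hq : ContinuousOn (resolventProfile (2 * s)) (Icc 0 R) :=
    (continuousOn_resolventProfile hs2).mono Icc_subset_Ici_self
  have hI1 : IntervalIntegrable (fun r => r ^ (n - 1) *
      (besselSeries ((n : ℝ) / 2 - 1) (r ^ 2 * ρ ^ 2 / 4) * resolventProfile (2 * s) r))
      volume 0 R := by
    apply ContinuousOn.intervalIntegrable
    rw [uIcc_of_le hR]
    have h1 : Continuous fun r : ℝ => besselSeries ((n : ℝ) / 2 - 1) (r ^ 2 * ρ ^ 2 / 4) :=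
      (continuous_besselSeries (neg_half_le hn)).comp (by fun_prop)
    exact (by fun_prop : Continuous fun r : ℝ => r ^ (n - 1)).continuousOn.mul
      (h1.continuousOn.mul hq)
  have hcont : ContinuousOn (fun r => hankelPrimitive n ρ r * resolventProfile (2 * s) r)
      (Icc 0 R) := (continuous_hankelPrimitive hn ρ).continuousOn.mul hq
  have hder : ∀ r ∈ Ioo 0 R, HasDerivAt
      (fun r => hankelPrimitive n ρ r * resolventProfile (2 * s) r)
      (2 * (r ^ (n - 1) * (besselSeries ((n : ℝ) / 2 - 1) (r ^ 2 * ρ ^ 2 / 4) *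
        resolventProfile (2 * s) r)) +
        (-(2 * s)) * (hankelPrimitive n ρ r * resolventDensity (2 * s) r)) r := by
    intro r hr
    have h := (hasDerivAt_hankelPrimitive hn ρ r).mul (hasDerivAt_resolventProfile (2 * s) hr.1)
    convert! h using 1
    unfold resolventDensity
    ring
  have h := intervalIntegral.integral_eq_sub_of_hasDerivAt_of_le hR hcont hder
    ((hI1.const_mul 2).add (hI2.const_mul (-(2 * s))))
  rw [intervalIntegral.integral_add (hI1.const_mul 2) (hI2.const_mul (-(2 * s))),
    intervalIntegral.integral_const_mul, intervalIntegral.integral_const_mul] at h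
  have h0 : hankelPrimitive n ρ 0 = 0 := by
    unfold hankelPrimitive
    rw [zero_pow (by omega), zero_mul]
  rw [h0, zero_mul, sub_zero] at h
  have e : (2 : ℝ) ^ (1 - (n : ℝ) / 2) = 2 ^ (-(n : ℝ) / 2) * 2 := by
    rw [sub_eq_add_neg, Real.rpow_add (by norm_num), Real.rpow_one, neg_div, mul_comm]
  unfold hankelSmooth
  rw [e, mul_assoc]
  congr 1
  linarith

/-- The pointwise limit of the truncated Hankel integrals. -/
def hankelLimit (n : ℕ) (s : ℝ) (x : E n) : ℝ :=
  2 ^ (-(n : ℝ) / 2) * (0 + 2 * s *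
    ∫ r in Ioi (0 : ℝ), hankelPrimitive n ‖x‖ r * resolventDensity (2 * s) r)

/-- After the integration by parts the boundary term tends to zero and the remaining integral
converges absolutely: growth of order `(n-1)/2` is beaten by the decay `r^(-2s)` of the profile. -/
theorem tendsto_hankelSmooth (hn : 1 ≤ n) {s : ℝ} (hs : 0 < s) (hns : ((n : ℝ) - 1) / 4 < s)
    {x : E n} (hx : x ≠ 0) :
    Tendsto (fun R => hankelSmooth n s R x) atTop (𝓝 (hankelLimit n s x)) := by
  have hρ : 0 < ‖x‖ := norm_pos_iff.2 hx
  obtain ⟨C, hC0, hC⟩ := exists_hankelPrimitive_le hn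
  set e := ((n : ℝ) - 1) / 2 with he
  have he0 : 0 ≤ e := by
    have : (1 : ℝ) ≤ n := by exact_mod_cast hn
    linarith
  have hes : e < 2 * s := by linarith
  set B := C * ((‖x‖ ^ n)⁻¹ * (1 + ‖x‖) ^ e) with hB
  have hB0 : 0 ≤ B := by positivity
  have t1 : Tendsto (fun R => hankelPrimitive n ‖x‖ R * resolventProfile (2 * s) R) atTop
      (𝓝 0) := by
    have h := (tendsto_rpow_mul_resolventProfile he0 hes).const_mul B
    rw [mul_zero] at h
    refine squeeze_zero_norm' ?_ h
    filter_upwards [eventually_ge_atTop 0] with r hr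
    have q0 := (resolventProfile_mem (s := 2 * s) hr).1
    rw [norm_mul, Real.norm_eq_abs, Real.norm_of_nonneg q0, ← mul_assoc]
    exact mul_le_mul_of_nonneg_right (hC _ r hρ hr) q0
  have hint : IntegrableOn (fun r => hankelPrimitive n ‖x‖ r * resolventDensity (2 * s) r)
      (Ioi 0) := by
    refine Integrable.mono' ((integrableOn_rpow_mul_resolventDensity (by positivity) he0
      hes).const_mul B) (((continuous_hankelPrimitive hn _).continuousOn.mul
      (continuousOn_resolventDensity (by positivity))).aestronglyMeasurable measurableSet_Ioi) ?_
    filter_upwards [ae_restrict_mem measurableSet_Ioi] with r hr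
    have q0 := resolventDensity_nonneg (2 * s) (mem_Ioi.1 hr).le
    rw [norm_mul, Real.norm_eq_abs, Real.norm_of_nonneg q0, ← mul_assoc]
    exact mul_le_mul_of_nonneg_right (hC _ r hρ (mem_Ioi.1 hr).le) q0
  have t2 := intervalIntegral_tendsto_integral_Ioi 0 hint tendsto_id
  have t3 := (t1.add (t2.const_mul (2 * s))).const_mul ((2 : ℝ) ^ (-(n : ℝ) / 2))
  refine t3.congr' ?_
  filter_upwards [eventually_ge_atTop 0] with R hR
  exact (hankelSmooth_eq_by_parts hn hs hR x).symm

/-- A majorant independent of `R` and continuous off the origin, which permits dominated convergence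
against test functions supported there. -/
theorem exists_hankelSmooth_le (hn : 1 ≤ n) {s : ℝ} (hs : 0 < s) (hns : ((n : ℝ) - 1) / 4 < s) :
    ∃ B, ∀ R, 0 ≤ R → ∀ x : E n, x ≠ 0 →
      |hankelSmooth n s R x| ≤ B * ((‖x‖ ^ n)⁻¹ * (1 + ‖x‖) ^ (((n : ℝ) - 1) / 2)) := by
  obtain ⟨C, hC0, hC⟩ := exists_hankelPrimitive_le hn
  set e := ((n : ℝ) - 1) / 2 with he
  have he0 : 0 ≤ e := by
    have : (1 : ℝ) ≤ n := by exact_mod_cast hn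
    linarith
  have hes : e < 2 * s := by linarith
  have hs2 : 0 < 2 * s := by positivity
  set I := ∫ r in Ioi (0 : ℝ), (1 + r) ^ e * resolventDensity (2 * s) r with hI
  have hint := integrableOn_rpow_mul_resolventDensity hs2 he0 hes
  have hq : ∀ R, 0 ≤ R → (1 + R) ^ e * resolventProfile (2 * s) R ≤ 2 ^ e := by
    intro R hR
    obtain ⟨q0, q1⟩ := resolventProfile_mem (s := 2 * s) hR
    rcases le_total R 1 with h | h
    · calc (1 + R) ^ e * resolventProfile (2 * s) R ≤ (1 + R) ^ e * 1 := by gcongr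
        _ ≤ 2 ^ e := by
          rw [mul_one]
          exact Real.rpow_le_rpow (by positivity) (by linarith) he0
    · refine (rpow_mul_resolventProfile_le he0 h).trans ?_
      have : R ^ (-(2 * s - e)) ≤ 1 := Real.rpow_le_one_of_one_le_of_nonpos h (by linarith)
      have h2 : (0 : ℝ) < 2 ^ e := by positivity
      nlinarith
  refine ⟨2 ^ (-(n : ℝ) / 2) * (C * 2 ^ e + 2 * s * (C * I)), fun R hR x hx => ?_⟩
  have hρ : 0 < ‖x‖ := norm_pos_iff.2 hx
  set ρ := ‖x‖
  set P := (ρ ^ n)⁻¹ * (1 + ρ) ^ e with hP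
  have hP0 : 0 ≤ P := by positivity
  have b1 : |hankelPrimitive n ρ R * resolventProfile (2 * s) R| ≤ C * P * 2 ^ e := by
    have q0 := (resolventProfile_mem (s := 2 * s) hR).1
    rw [abs_mul, abs_of_nonneg q0]
    calc _ ≤ (C * P * (1 + R) ^ e) * resolventProfile (2 * s) R := by
          gcongr
          exact hC ρ R hρ hR
      _ = C * P * ((1 + R) ^ e * resolventProfile (2 * s) R) := by ring
      _ ≤ _ := by gcongr; exact hq R hR
  have b2 : |∫ r in (0 : ℝ)..R, hankelPrimitive n ρ r * resolventDensity (2 * s) r| ≤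
      C * P * I := by
    rw [intervalIntegral.integral_of_le hR, ← Real.norm_eq_abs]
    calc _ ≤ ∫ r in Ioc 0 R, C * P * ((1 + r) ^ e * resolventDensity (2 * s) r) := by
          refine norm_integral_le_of_norm_le ((hint.mono_set Ioc_subset_Ioi_self).const_mul _) ?_
          filter_upwards [ae_restrict_mem measurableSet_Ioc] with r hr
          have q0 := resolventDensity_nonneg (2 * s) hr.1.le
          rw [norm_mul, Real.norm_eq_abs, Real.norm_of_nonneg q0, ← mul_assoc]
          exact mul_le_mul_of_nonneg_right (hC ρ r hρ hr.1.le) q0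
      _ = C * P * ∫ r in Ioc 0 R, ((1 + r) ^ e * resolventDensity (2 * s) r) :=
          integral_const_mul _ _
      _ ≤ C * P * I := by
          refine mul_le_mul_of_nonneg_left ?_ (by positivity)
          refine setIntegral_mono_set hint ?_
            (LE.le.eventuallyLE Ioc_subset_Ioi_self)
          filter_upwards [ae_restrict_mem measurableSet_Ioi] with r hr
          have hr0 : 0 < r := hr
          have q0 := resolventDensity_nonneg (2 * s) hr0.le
          simp only [Pi.zero_apply]
          positivity
  rw [hankelSmooth_eq_by_parts hn hs hR, abs_mul,
    abs_of_nonneg (a := (2 : ℝ) ^ (-(n : ℝ) / 2)) (by positivity),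
    mul_assoc (2 ^ (-(n : ℝ) / 2))]
  refine mul_le_mul_of_nonneg_left ?_ (by positivity : (0 : ℝ) ≤ 2 ^ (-(n : ℝ) / 2))
  calc _ ≤ |hankelPrimitive n ρ R * resolventProfile (2 * s) R| +
        |2 * s * ∫ r in (0 : ℝ)..R, hankelPrimitive n ρ r * resolventDensity (2 * s) r| :=
        abs_add_le _ _
    _ ≤ C * P * 2 ^ e + 2 * s * (C * P * I) := by
        rw [abs_mul (2 * s), abs_of_pos hs2]
        gcongr
    _ = _ := by ring

/-- Against a test function supported off the origin the truncations converge to the pointwise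
limit, by domination, and to `K`, by hypothesis. The majorant behaves like `‖x‖^(-n)` at the origin
and is not integrable there, so the origin is removed; it is a null set. -/
theorem hankelLimit_ae_eq (hn : 1 ≤ n) {s : ℝ} (hs : 0 < s) (hns : ((n : ℝ) - 1) / 4 < s)
    {K : E n → ℝ} (hK : Integrable K)
    (hlim : ∀ ψ : 𝓢(E n, ℝ),
      Tendsto (fun R => ∫ x, hankelTrunc n s R x * ψ x) atTop (𝓝 (∫ x, K x * ψ x))) :
    hankelLimit n s =ᵐ[volume] K := by
  obtain ⟨B, hB⟩ := exists_hankelSmooth_le hn hs hns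
  let h : E n → ℝ := fun x => B * ((‖x‖ ^ n)⁻¹ * (1 + ‖x‖) ^ (((n : ℝ) - 1) / 2))
  have hne := ae_ne_zero hn
  have hU : IsOpen ({0}ᶜ : Set (E n)) := isOpen_compl_singleton
  have hh : ContinuousOn h {0}ᶜ := by
    refine continuousOn_const.mul (ContinuousOn.mul (ContinuousOn.inv₀ (by fun_prop) ?_)
      (ContinuousOn.rpow_const (by fun_prop) fun x _ => Or.inl (by positivity)))
    intro x hx
    have : ‖x‖ ≠ 0 := norm_ne_zero_iff.2 hx
    positivity
  have hbd : ∀ x : E n, x ≠ 0 → |hankelLimit n s x| ≤ h x := fun x hx =>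
    le_of_tendsto (tendsto_hankelSmooth hn hs hns hx).abs
      ((eventually_ge_atTop 0).mono fun R hR => hB R hR x hx)
  have hm : AEStronglyMeasurable (hankelLimit n s) (volume : Measure (E n)) := by
    refine aestronglyMeasurable_of_tendsto_ae (u := atTop) (f := fun (N : ℕ) x =>
      hankelSmooth n s N x) (fun N => (continuous_hankelSmooth hn hs
        (Nat.cast_nonneg N)).aestronglyMeasurable) ?_
    filter_upwards [hne] with x hx
    exact (tendsto_hankelSmooth hn hs hns hx).comp tendsto_natCast_atTop_atTop
  have hloc : LocallyIntegrableOn (hankelLimit n s) ({0}ᶜ : Set (E n)) volume := by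
    refine (hh.locallyIntegrableOn hU.measurableSet).mono hm ?_
    filter_upwards [hne] with x hx
    exact (hbd x hx).trans (le_abs_self _)
  have key := hU.ae_eq_zero_of_integral_contDiff_smul_eq_zero (μ := (volume : Measure (E n)))
    (f := fun x => hankelLimit n s x - K x) (hloc.sub (hK.locallyIntegrable.locallyIntegrableOn _)) ?_
  · filter_upwards [key, hne] with x h1 h2
    exact sub_eq_zero.1 (h1 h2)
  intro g hg hgc hgs
  obtain ⟨D, hD⟩ := IsCompact.exists_bound_of_continuousOn (s := tsupport g) hgc.isCompact
    (hh.mono hgs)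
  have hgb : ∀ x, x ≠ 0 → ∀ y : ℝ, |y| ≤ h x → ‖y * g x‖ ≤ D * |g x| := by
    intro x hx y hy
    by_cases hxs : x ∈ tsupport g
    · rw [norm_mul, Real.norm_eq_abs, Real.norm_eq_abs]
      exact mul_le_mul_of_nonneg_right (hy.trans ((le_abs_self _).trans (hD x hxs))) (abs_nonneg _)
    · simp [image_eq_zero_of_notMem_tsupport hxs]
  have hgi : Integrable g := hg.continuous.integrable_of_hasCompactSupport hgc
  have hDi : Integrable fun x => D * |g x| := hgi.abs.const_mul D
  have hLi : Integrable fun x => hankelLimit n s x * g x := by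
    refine hDi.mono' (hm.mul hg.continuous.aestronglyMeasurable) ?_
    filter_upwards [hne] with x hx
    exact hgb x hx _ (hbd x hx)
  obtain ⟨C, hC⟩ := hg.continuous.bounded_above_of_compact_support hgc
  have hKi : Integrable fun x => K x * g x :=
    hK.mul_bdd hg.continuous.aestronglyMeasurable (ae_of_all _ hC)
  have t1 : Tendsto (fun R => ∫ x, hankelTrunc n s R x * g x) atTop
      (𝓝 (∫ x, hankelLimit n s x * g x)) := by
    refine tendsto_integral_filter_of_dominated_convergence (fun x => D * |g x|) ?_ ?_ hDi ?_
    · filter_upwards [eventually_ge_atTop 0] with R hR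
      refine AEStronglyMeasurable.congr (((continuous_hankelSmooth (n := n) hn hs hR).mul
        hg.continuous).aestronglyMeasurable) ?_
      filter_upwards [hne] with x hx
      rw [hankelTrunc_eq hn s hR hx, Pi.mul_apply]
    · filter_upwards [eventually_ge_atTop 0] with R hR
      filter_upwards [hne] with x hx
      rw [hankelTrunc_eq hn s hR hx]
      exact hgb x hx _ (hB R hR x hx)
    · filter_upwards [hne] with x hx
      refine ((tendsto_hankelSmooth hn hs hns hx).mul_const (g x)).congr' ?_
      filter_upwards [eventually_ge_atTop 0] with R hR
      rw [hankelTrunc_eq hn s hR hx]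
  have t2 := hlim (hgc.toSchwartzMap hg)
  have t3 := tendsto_nhds_unique t1 t2
  have t4 : ∫ x, hankelLimit n s x * g x = ∫ x, K x * g x := t3
  calc ∫ x, g x • (hankelLimit n s x - K x) = ∫ x, (hankelLimit n s x * g x - K x * g x) := by
        congr 1 with x
        rw [smul_eq_mul]
        ring
    _ = 0 := by rw [integral_sub hLi hKi, t4, sub_self]

/-- The Hankel kernel exists, and is almost everywhere a multiple of the function with Fourier
transform `1 / (1 + |ξ|^(2s))`. -/
theorem exists_hankelKernel (hn : 1 ≤ n) {s : ℝ} (hs : 0 < s) {k : E n → ℝ}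
    (hk : Integrable k) (hF : ∀ η ≠ 0, 𝓕 (fun x => (k x : ℂ)) η = ((abarSymbol s η)⁻¹ : ℝ)) :
    ∃ K : E n → ℝ, IsHankelKernel n s K ∧
      K =ᵐ[volume] fun x => (2 * π) ^ ((n : ℝ) / 2) * k x := by
  have hK1 : Integrable fun x => (2 * π) ^ ((n : ℝ) / 2) * k x := hk.const_mul _
  have hlim := tendsto_integral_hankelTrunc hn hs hk hF
  by_cases hns : ((n : ℝ) - 1) / 4 < s
  · have hae := hankelLimit_ae_eq hn hs hns hK1 hlim
    -- As an integrable function the kernel is determined only almost everywhere. Above the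
    -- threshold the pointwise limit serves as its representative; below it nothing is claimed
    -- pointwise and any representative will do.
    refine ⟨hankelLimit n s, ⟨hK1.congr hae.symm, fun ψ => ?_, fun _ x hx => ?_⟩, hae⟩
    · have e : ∫ x, hankelLimit n s x * ψ x = ∫ x, ((2 * π) ^ ((n : ℝ) / 2) * k x) * ψ x := by
        apply integral_congr_ae
        filter_upwards [hae] with x hx
        rw [hx]
      rw [e]
      exact hlim ψ
    · refine (tendsto_hankelSmooth hn hs hns hx).congr' ?_
      filter_upwards [eventually_ge_atTop 0] with R hR
      exact (hankelTrunc_eq hn s hR hx).symm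
  · exact ⟨_, ⟨hK1, hlim, fun h => absurd h hns⟩, ae_eq_refl _⟩

/-! ### Convolution with the kernel -/

/-- The constants `(2π)^(±n/2)` cancel, and an almost everywhere equality suffices at every `x`
because `y ↦ x - y` preserves null sets. -/
theorem isKernelConv_iff {k K : E n → ℝ}
    (hK : K =ᵐ[volume] fun x => (2 * π) ^ ((n : ℝ) / 2) * k x) (g v : E n → ℝ) :
    IsKernelConv K g v ↔
      ∀ x, Integrable (fun y => k (x - y) * g y) ∧ v x = ∫ y, k (x - y) * g y := by
  refine forall_congr' fun x => ?_
  have hc : (0 : ℝ) < (2 * π) ^ ((n : ℝ) / 2) := by positivity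
  have h : (fun y => K (x - y) * g y) =ᵐ[volume]
      fun y => (2 * π) ^ ((n : ℝ) / 2) * (k (x - y) * g y) := by
    filter_upwards [(quasiMeasurePreserving_sub_left volume x).ae hK] with y hy
    rw [hy, mul_assoc]
  rw [integrable_congr h, integral_congr_ae h, integral_const_mul, ← mul_assoc,
    ← Real.rpow_add (by positivity), neg_div, neg_add_cancel, Real.rpow_zero, one_mul,
    integrable_const_mul_iff hc.ne'.isUnit]

theorem fourierInv_comp_sub_left (k : E n → ℂ) (x η : E n) :
    𝓕⁻ (fun y => k (x - y)) η = Complex.exp ((2 * π * inner ℝ x η : ℝ) * Complex.I) * 𝓕 k η := by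
  rw [Real.fourierInv_eq', Real.fourier_eq', ← integral_const_mul,
    ← integral_sub_left_eq_self _ volume x]
  congr 1 with y
  rw [sub_sub_cancel, smul_eq_mul, smul_eq_mul, ← mul_assoc, ← Complex.exp_add, inner_sub_left]
  congr 2
  push_cast
  ring

theorem integrable_kernel_mul_Abar {s : ℝ} (hs : 0 < s) {k : E n → ℝ} (hk : Integrable k)
    {v : E n → ℝ} (hv : ContDiff ℝ ∞ v) (hc : HasCompactSupport v) (x : E n) :
    Integrable fun y => k (x - y) * Abar s v y := by
  obtain ⟨C, hC⟩ := exists_abs_Abar_le s v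
  exact (hk.comp_sub_left x).mul_bdd (c := C) (continuous_Abar hs hv hc).aestronglyMeasurable
    (Eventually.of_forall hC)

/-- The inverse transform of `y ↦ k (x - y)` is a character times the reciprocal of the symbol. The
symbol in `Abar` cancels it, and what remains is Fourier inversion for `v`. -/
theorem integral_kernel_mul_Abar (hn : 1 ≤ n) {s : ℝ} (hs : 0 < s) {k : E n → ℝ}
    (hk : Integrable k)
    (hF : ∀ η : E n, η ≠ 0 → 𝓕 (fun x => (k x : ℂ)) η = ((abarSymbol s η)⁻¹ : ℝ))
    {v : E n → ℝ} (hv : ContDiff ℝ ∞ v) (hc : HasCompactSupport v) (x : E n) :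
    ∫ y, k (x - y) * Abar s v y = v x := by
  apply Complex.ofReal_injective
  have e : ∫ y, (Abar s v y : ℂ) * (k (x - y) : ℂ) =
      ∫ η, (abarSymbol s η : ℂ) * 𝓕 (fun y : E n => (v y : ℂ)) η *
        𝓕⁻ (fun y => (k (x - y) : ℂ)) η := by
    simp_rw [Abar_eq_fourierInv]
    exact integral_fourierInv_mul_eq_flip (integrable_symbol_fourier hs hv hc)
      (hk.comp_sub_left x).ofReal
  rw [← integral_complex_ofReal]
  push_cast
  simp_rw [mul_comm (k _ : ℂ)]
  rw [e, ← congrFun (fourierInv_fourier_test hv hc) x, Real.fourierInv_eq']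
  apply integral_congr_ae
  filter_upwards [ae_ne_zero hn] with η hη
  rw [fourierInv_comp_sub_left (fun y => (k y : ℂ)), hF η hη, real_inner_comm x η, smul_eq_mul]
  have hp : (abarSymbol s η : ℂ) ≠ 0 := Complex.ofReal_ne_zero.2 (abarSymbol_pos s η).ne'
  push_cast
  field_simp

/-- The bound `|g w| ≤ g² + w²` reduces the claim to convolution integrands of two integrable
functions; the evenness of `k` lets the two variables be exchanged. -/
theorem integrable_prod_kernel_mul {k g w : E n → ℝ} (hk : Integrable k)
    (hke : ∀ x, k (-x) = k x) (hg : MemLp g 2 volume) (hw : MemLp w 2 volume) :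
    Integrable (fun p : E n × E n => k (p.1 - p.2) * g p.2 * w p.1) (volume.prod volume) := by
  have h (f : E n → ℝ) (hf : MemLp f 2 volume) : Integrable
      (fun p : E n × E n => f p.2 ^ 2 * |k (p.1 - p.2)|) (volume.prod volume) :=
    hf.integrable_sq.convolution_integrand (ContinuousLinearMap.mul ℝ ℝ) hk.abs
  have h1 := h g hg
  have h2 : Integrable (fun p : E n × E n => w p.1 ^ 2 * |k (p.1 - p.2)|)
      (volume.prod volume) := by
    refine (h w hw).swap.congr (Eventually.of_forall fun p => ?_)
    simp only [Function.comp_apply, Prod.fst_swap, Prod.snd_swap]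
    rw [← neg_sub, hke]
  refine (h1.add h2).mono ?_ (Eventually.of_forall fun p => ?_)
  · have hk' := hk.aestronglyMeasurable.comp_quasiMeasurePreserving
      (quasiMeasurePreserving_sub volume volume)
    exact (hk'.mul hg.1.comp_snd).mul hw.1.comp_fst
  · simp only [Pi.add_apply, Real.norm_eq_abs, abs_mul]
    rw [← add_mul, abs_mul, abs_abs, abs_of_nonneg (add_nonneg (sq_nonneg (g p.2))
      (sq_nonneg (w p.1))), mul_assoc, mul_comm]
    gcongr
    nlinarith [sq_nonneg (|g p.2| - |w p.1|), sq_abs (g p.2), sq_abs (w p.1),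
      sq_nonneg (g p.2), sq_nonneg (w p.1)]

/-- Pair `v = k ⋆ g` with `Abar s ψ`. Moving the even kernel across gives `∫ g ψ`, since `k` inverts
`Abar` on `ψ`; self-adjointness gives `∫ (Abar s v) ψ`. Thus no transform of `g` is needed, and its
square integrability serves Fubini. -/
theorem eq_Abar_of_kernelConv (hn : 1 ≤ n) {s : ℝ} (hs : 0 < s) {k : E n → ℝ}
    (hk : Integrable k) (hke : ∀ x, k (-x) = k x)
    (hF : ∀ η : E n, η ≠ 0 → 𝓕 (fun x => (k x : ℂ)) η = ((abarSymbol s η)⁻¹ : ℝ))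
    {v g : E n → ℝ} (hv : ContDiff ℝ ∞ v) (hc : HasCompactSupport v) (hg : Continuous g)
    (hg2 : MemLp g 2 volume) (h : ∀ x, v x = ∫ y, k (x - y) * g y) : g = Abar s v := by
  have hA := continuous_Abar hs hv hc
  refine Continuous.ae_eq_iff_eq volume hg hA |>.1 ?_
  refine ae_eq_of_integral_contDiff_smul_eq hg.locallyIntegrable hA.locallyIntegrable
    fun ψ hψ hψc => ?_
  simp only [smul_eq_mul]
  have e1 : ∫ x, v x * Abar s ψ x = ∫ y, g y * ψ y := by
    calc ∫ x, v x * Abar s ψ x = ∫ x, ∫ y, k (x - y) * g y * Abar s ψ x := by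
          congr 1 with x
          rw [integral_mul_const, ← h]
      _ = ∫ y, ∫ x, k (x - y) * g y * Abar s ψ x :=
          integral_integral_swap (integrable_prod_kernel_mul hk hke hg2 (memLp_Abar hs hψ hψc))
      _ = ∫ y, g y * ψ y := by
          congr 1 with y
          rw [← integral_kernel_mul_Abar hn hs hk hF hψ hψc y, ← integral_const_mul]
          congr 1 with x
          rw [← neg_sub y x, hke]
          ring
  calc ∫ x, ψ x * g x = ∫ x, v x * Abar s ψ x := by rw [e1]; simp only [mul_comm]
    _ = ∫ x, ψ x * Abar s v x := by
        rw [← integral_Abar_mul_comm hs hv hc hψ hψc]; simp only [mul_comm]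

theorem isKernelConv_iff_eq_Abar (hn : 1 ≤ n) {s : ℝ} (hs : 0 < s) {k K : E n → ℝ}
    (hk : Integrable k) (hke : ∀ x, k (-x) = k x)
    (hF : ∀ η : E n, η ≠ 0 → 𝓕 (fun x => (k x : ℂ)) η = ((abarSymbol s η)⁻¹ : ℝ))
    (hK : K =ᵐ[volume] fun x => (2 * π) ^ ((n : ℝ) / 2) * k x)
    {v g : E n → ℝ} (hv : ContDiff ℝ ∞ v) (hc : HasCompactSupport v) (hg : Continuous g)
    (hg2 : MemLp g 2 volume) : IsKernelConv K g v ↔ g = Abar s v := by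
  rw [isKernelConv_iff hK]
  refine ⟨fun h => eq_Abar_of_kernelConv hn hs hk hke hF hv hc hg hg2 fun x => (h x).2, ?_⟩
  rintro rfl x
  exact ⟨integrable_kernel_mul_Abar hs hk hv hc x,
    (integral_kernel_mul_Abar hn hs hk hF hv hc x).symm⟩

/-! ### Smooth families of test functions -/

variable {P F G : Type*} [NormedAddCommGroup P] [NormedSpace ℝ P]
  [NormedAddCommGroup F] [NormedSpace ℝ F] [NormedAddCommGroup G] [NormedSpace ℝ G]

/-- A family of smooth compactly supported functions on `ℝⁿ`, jointly smooth in parameter and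
point, with locally uniformly bounded supports. -/
structure TestFamilyOn (U : Set P) (u : P → E n → F) : Prop where
  smooth : ContDiffOn ℝ ∞ (fun q : P × E n => u q.1 q.2) (U ×ˢ univ)
  supp : ∀ K ⊆ U, IsCompact K → ∃ C : Set (E n), IsCompact C ∧ ∀ p ∈ K, ∀ x ∉ C, u p x = 0

namespace TestFamilyOn

variable {U : Set P} {u v : P → E n → F}

theorem congr (hu : TestFamilyOn U u) (h : ∀ p ∈ U, ∀ x, v p x = u p x) : TestFamilyOn U v where
  smooth := hu.smooth.congr fun q hq => h q.1 hq.1 q.2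
  supp K hKU hK := by
    obtain ⟨C, hC, h0⟩ := hu.supp K hKU hK
    exact ⟨C, hC, fun p hp x hx => (h p (hKU hp) x).trans (h0 p hp x hx)⟩

theorem contDiff (hu : TestFamilyOn U u) {p : P} (hp : p ∈ U) : ContDiff ℝ ∞ (u p) := by
  rw [← contDiffOn_univ]
  exact hu.smooth.comp (f := fun x => (p, x)) (contDiff_prodMk_right p).contDiffOn
    fun x _ => ⟨hp, mem_univ _⟩

theorem hasCompactSupport (hu : TestFamilyOn U u) {p : P} (hp : p ∈ U) :
    HasCompactSupport (u p) := by
  obtain ⟨C, hC, h0⟩ := hu.supp {p} (singleton_subset_iff.2 hp) isCompact_singleton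
  exact HasCompactSupport.intro hC fun x hx => h0 p rfl x hx

theorem comp_clm (hu : TestFamilyOn U u) (L : F →L[ℝ] G) : TestFamilyOn U fun p x => L (u p x) where
  smooth := L.contDiff.comp_contDiffOn hu.smooth
  supp K hKU hK := by
    obtain ⟨C, hC, h0⟩ := hu.supp K hKU hK
    exact ⟨C, hC, fun p hp x hx => by rw [h0 p hp x hx, map_zero]⟩

theorem coord {w : P → E n → E n} (hw : TestFamilyOn U w) (k : Fin n) :
    TestFamilyOn U fun p x => w p x k :=
  hw.comp_clm (EuclideanSpace.proj k)

theorem add (hu : TestFamilyOn U u) (hv : TestFamilyOn U v) :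
    TestFamilyOn U fun p x => u p x + v p x where
  smooth := hu.smooth.add hv.smooth
  supp K hKU hK := by
    obtain ⟨C, hC, h0⟩ := hu.supp K hKU hK
    obtain ⟨D, hD, h1⟩ := hv.supp K hKU hK
    refine ⟨C ∪ D, hC.union hD, fun p hp x hx => ?_⟩
    rw [mem_union, not_or] at hx
    rw [h0 p hp x hx.1, h1 p hp x hx.2, add_zero]

theorem smul (hu : TestFamilyOn U u) {a : P → E n → ℝ}
    (ha : ContDiffOn ℝ ∞ (fun q : P × E n => a q.1 q.2) (U ×ˢ univ)) :
    TestFamilyOn U fun p x => a p x • u p x where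
  smooth := ha.smul hu.smooth
  supp K hKU hK := by
    obtain ⟨C, hC, h0⟩ := hu.supp K hKU hK
    exact ⟨C, hC, fun p hp x hx => by rw [h0 p hp x hx, smul_zero]⟩

theorem neg (hu : TestFamilyOn U u) : TestFamilyOn U fun p x => -u p x where
  smooth := hu.smooth.neg
  supp K hKU hK := by
    obtain ⟨C, hC, h0⟩ := hu.supp K hKU hK
    exact ⟨C, hC, fun p hp x hx => by rw [h0 p hp x hx, neg_zero]⟩

theorem sub (hu : TestFamilyOn U u) (hv : TestFamilyOn U v) :
    TestFamilyOn U fun p x => u p x - v p x :=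
  (hu.add hv.neg).congr fun _ _ _ => sub_eq_add_neg _ _

theorem zero : TestFamilyOn U fun _ (_ : E n) => (0 : F) where
  smooth := contDiffOn_const
  supp _ _ _ := ⟨∅, isCompact_empty, fun _ _ _ _ => rfl⟩

theorem sum {ι : Type*} (t : Finset ι) {w : ι → P → E n → F} (h : ∀ i, TestFamilyOn U (w i)) :
    TestFamilyOn U fun p x => ∑ i ∈ t, w i p x := by
  classical
  induction t using Finset.induction_on with
  | empty => simpa using zero
  | insert a t ha ih =>
    exact ((h a).add ih).congr fun p _ x => by rw [Finset.sum_insert ha]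

theorem comp_param {Q : Type*} [NormedAddCommGroup Q] [NormedSpace ℝ Q] {W : Set Q} {f : Q → P}
    (hu : TestFamilyOn U u) (hf : ContDiffOn ℝ ∞ f W) (hW : MapsTo f W U) :
    TestFamilyOn W fun q => u (f q) where
  smooth := by
    refine hu.smooth.comp (f := fun q : Q × E n => (f q.1, q.2)) ?_ fun q hq => ⟨hW hq.1, hq.2⟩
    exact (hf.comp contDiffOn_fst fun q hq => hq.1).prodMk contDiffOn_snd
  supp K hKW hK := by
    obtain ⟨C, hC, h0⟩ := hu.supp (f '' K) ((image_mono hKW).trans hW.image_subset)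
      (hK.image_of_continuousOn (hf.continuousOn.mono hKW))
    exact ⟨C, hC, fun q hq x hx => h0 _ (mem_image_of_mem f hq) x hx⟩

/-- For the derivatives to vanish, the family must vanish near `(p, x)` in both variables; a compact
set of parameters with `K` in its interior provides this. -/
theorem eventuallyEq_zero (hU : IsOpen U) [LocallyCompactSpace P] (hu : TestFamilyOn U u)
    {K : Set P} (hKU : K ⊆ U) (hK : IsCompact K) :
    ∃ C : Set (E n), IsCompact C ∧ ∀ p ∈ K, ∀ x ∉ C,
      (fun q : P × E n => u q.1 q.2) =ᶠ[𝓝 (p, x)] 0 := by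
  obtain ⟨L, hL, hKL, hLU⟩ := exists_compact_between hK hU hKU
  obtain ⟨C, hC, h0⟩ := hu.supp L hLU hL
  refine ⟨C, hC, fun p hp x hx => ?_⟩
  filter_upwards [prod_mem_nhds (mem_interior_iff_mem_nhds.1 (hKL hp))
    (hC.isClosed.isOpen_compl.mem_nhds hx)] with q hq
  exact h0 q.1 hq.1 q.2 hq.2

theorem dirDeriv (hU : IsOpen U) [LocallyCompactSpace P] (hu : TestFamilyOn U u) (d : P × E n) :
    TestFamilyOn U fun p x => fderiv ℝ (fun q : P × E n => u q.1 q.2) (p, x) d where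
  smooth := (hu.smooth.fderiv_of_isOpen (hU.prod isOpen_univ) (m := ∞) le_rfl).clm_apply
    contDiffOn_const
  supp K hKU hK := by
    obtain ⟨C, hC, h0⟩ := hu.eventuallyEq_zero hU hKU hK
    refine ⟨C, hC, fun p hp x hx => ?_⟩
    rw [(h0 p hp x hx).fderiv_eq]
    simp

theorem hasFDerivAt (hU : IsOpen U) (hu : TestFamilyOn U u) {p : P} (hp : p ∈ U) (x : E n) :
    HasFDerivAt (fun q : P × E n => u q.1 q.2) (fderiv ℝ (fun q : P × E n => u q.1 q.2) (p, x))
      (p, x) :=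
  ((hu.smooth.contDiffAt ((hU.prod isOpen_univ).mem_nhds ⟨hp, mem_univ x⟩)).differentiableAt
    (by simp)).hasFDerivAt

theorem fderiv_apply (hU : IsOpen U) (hu : TestFamilyOn U u) {p : P} (hp : p ∈ U) (x e : E n) :
    fderiv ℝ (u p) x e = fderiv ℝ (fun q : P × E n => u q.1 q.2) (p, x) (0, e) := by
  have h := (hu.hasFDerivAt hU hp x).comp x (hasFDerivAt_prodMk_right p x)
  have h2 : fderiv ℝ (u p) x = _ := h.fderiv
  rw [h2]
  simp

theorem pderiv {u : P → E n → ℝ} (hU : IsOpen U) [LocallyCompactSpace P] (hu : TestFamilyOn U u)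
    (i : Fin n) : TestFamilyOn U fun p x => pderiv i (u p) x :=
  (hu.dirDeriv hU (0, EuclideanSpace.single i 1)).congr fun _ hp x => hu.fderiv_apply hU hp x _

end TestFamilyOn

/-! ### The operator `1 - Δ` -/

/-- The operator `1 - Δ`. -/
def oneSubLaplacian (v : E n → ℝ) (x : E n) : ℝ := v x - ∑ i, pderiv i (pderiv i v) x

theorem TestFamilyOn.oneSubLaplacian {U : Set P} (hU : IsOpen U) [LocallyCompactSpace P]
    {u : P → E n → ℝ} (hu : TestFamilyOn U u) (N : ℕ) :
    TestFamilyOn U fun p => oneSubLaplacian^[N] (u p) := by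
  induction N with
  | zero => exact hu
  | succ N ih =>
    simp only [Function.iterate_succ_apply']
    exact ih.sub (TestFamilyOn.sum _ fun i => (ih.pderiv hU i).pderiv hU i)

theorem contDiff_pderiv {v : E n → ℝ} (hv : ContDiff ℝ ∞ v) (i : Fin n) :
    ContDiff ℝ ∞ (pderiv i v) :=
  (hv.fderiv_right (m := ∞) le_rfl).clm_apply contDiff_const

theorem hasCompactSupport_pderiv {v : E n → ℝ} (hc : HasCompactSupport v) (i : Fin n) :
    HasCompactSupport (pderiv i v) :=
  hc.fderiv_apply ℝ _

theorem fourier_pderiv {v : E n → ℝ} (hv : ContDiff ℝ ∞ v) (hc : HasCompactSupport v) (i : Fin n)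
    (η : E n) : 𝓕 (fun y : E n => (pderiv i v y : ℂ)) η =
      (2 * π * Complex.I) * η i * 𝓕 (fun y : E n => (v y : ℂ)) η := by
  have hd := hv.differentiable (by simp)
  have h := congrArg (fun f : 𝓢(E n, ℂ) => f η)
    (SchwartzMap.fourier_lineDerivOp_eq (testSchwartz hv hc) (EuclideanSpace.single i (1 : ℝ)))
  have e : (fun y : E n => (pderiv i v y : ℂ)) =
      ⇑(LineDeriv.lineDerivOp (EuclideanSpace.single i (1 : ℝ)) (testSchwartz hv hc)) := by
    funext y
    rw [SchwartzMap.lineDerivOp_apply_eq_fderiv, testSchwartz_coe]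
    have h1 := (Complex.ofRealCLM.hasFDerivAt.comp y (hd y).hasFDerivAt).fderiv
    exact (DFunLike.congr_fun h1 (EuclideanSpace.single i (1 : ℝ))).symm
  have ht : (fun x : E n => inner ℝ x (EuclideanSpace.single i (1 : ℝ))).HasTemperateGrowth := by
    fun_prop
  simp only [smul_apply, SchwartzMap.smulLeftCLM_apply_apply ht] at h
  rw [SchwartzMap.fourier_coe, ← e, fourier_testSchwartz] at h
  have e2 : inner ℝ η (EuclideanSpace.single i (1 : ℝ)) = η i := by
    rw [EuclideanSpace.inner_single_right]
    simp
  rw [h, e2, smul_eq_mul, Complex.real_smul]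
  ring

theorem contDiff_oneSubLaplacian {v : E n → ℝ} (hv : ContDiff ℝ ∞ v) :
    ContDiff ℝ ∞ (oneSubLaplacian v) :=
  hv.sub (ContDiff.sum fun i _ => contDiff_pderiv (contDiff_pderiv hv i) i)

theorem hasCompactSupport_oneSubLaplacian {v : E n → ℝ} (hc : HasCompactSupport v) :
    HasCompactSupport (oneSubLaplacian v) := by
  refine HasCompactSupport.intro hc fun x hx => ?_
  have h : v =ᶠ[𝓝 x] 0 := notMem_tsupport_iff_eventuallyEq.1 hx
  have h1 (i : Fin n) : pderiv i v =ᶠ[𝓝 x] 0 := by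
    filter_upwards [h.fderiv (𝕜 := ℝ)] with y hy
    simp [pderiv, hy]
  have h2 (i : Fin n) : pderiv i (pderiv i v) x = 0 := by
    simp [pderiv, (h1 i).fderiv_eq]
  simp [oneSubLaplacian, h.eq_of_nhds, h2]

theorem fourier_oneSubLaplacian {v : E n → ℝ} (hv : ContDiff ℝ ∞ v) (hc : HasCompactSupport v)
    (η : E n) : 𝓕 (fun y : E n => (oneSubLaplacian v y : ℂ)) η =
      ((1 + (2 * π * ‖η‖) ^ 2 : ℝ) : ℂ) * 𝓕 (fun y : E n => (v y : ℂ)) η := by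
  have h1 (i : Fin n) := contDiff_pderiv hv i
  have c1 (i : Fin n) := hasCompactSupport_pderiv hc i
  have i2 (i : Fin n) := integrable_test (contDiff_pderiv (h1 i) i) (hasCompactSupport_pderiv (c1 i) i)
  have i0 := integrable_test hv hc
  have e : 𝓕 (fun y : E n => (oneSubLaplacian v y : ℂ)) η = 𝓕 (fun y : E n => (v y : ℂ)) η -
      ∑ i, 𝓕 (fun y : E n => (pderiv i (pderiv i v) y : ℂ)) η := by
    have J {f : E n → ℂ} (hf : Integrable f) : Integrable fun y : E n =>
        𝐞 (-inner ℝ y η) • f y := (Real.fourierIntegral_convergent_iff η).2 hf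
    simp_rw [Real.fourier_eq]
    rw [← integral_finsetSum _ fun i _ => J (i2 i), ← integral_sub (J i0)
      (integrable_finsetSum _ fun i _ => J (i2 i))]
    congr 1 with y
    simp only [oneSubLaplacian]
    push_cast
    rw [smul_sub, Finset.smul_sum]
  rw [e]
  simp_rw [fourier_pderiv (h1 _) (c1 _), fourier_pderiv hv hc]
  have e2 : ((‖η‖ ^ 2 : ℝ) : ℂ) = ∑ i, (η i : ℂ) ^ 2 := by
    rw [EuclideanSpace.real_norm_sq_eq]
    push_cast
    rfl
  have e3 : ((1 + (2 * π * ‖η‖) ^ 2 : ℝ) : ℂ) = 1 + (2 * π) ^ 2 * ∑ i, (η i : ℂ) ^ 2 := by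
    rw [← e2]
    push_cast
    ring
  rw [e3, add_mul, one_mul, sub_eq_add_neg, Finset.mul_sum, Finset.sum_mul, ← Finset.sum_neg_distrib]
  congr 1
  refine Finset.sum_congr rfl fun i _ => ?_
  linear_combination (-(2 * π * η i : ℂ) ^ 2 * 𝓕 (fun y : E n => (v y : ℂ)) η) * Complex.I_sq

theorem iterate_oneSubLaplacian {v : E n → ℝ} (hv : ContDiff ℝ ∞ v) (hc : HasCompactSupport v)
    (N : ℕ) : ContDiff ℝ ∞ (oneSubLaplacian^[N] v) ∧ HasCompactSupport (oneSubLaplacian^[N] v) ∧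
      ∀ η, 𝓕 (fun y : E n => (oneSubLaplacian^[N] v y : ℂ)) η =
        ((1 + (2 * π * ‖η‖) ^ 2 : ℝ) : ℂ) ^ N * 𝓕 (fun y : E n => (v y : ℂ)) η := by
  induction N with
  | zero => exact ⟨hv, hc, fun η => by simp⟩
  | succ N ih =>
    obtain ⟨a, b, c⟩ := ih
    simp only [Function.iterate_succ_apply']
    refine ⟨contDiff_oneSubLaplacian a, hasCompactSupport_oneSubLaplacian b, fun η => ?_⟩
    rw [fourier_oneSubLaplacian a b, c]
    ring

/-! ### Joint smoothness of `Abar` of a family -/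

theorem exists_integrable_abarSymbol_div {s : ℝ} (hs : 0 < s) :
    ∃ N : ℕ, Integrable fun η : E n => ((abarSymbol s η / (1 + (2 * π * ‖η‖) ^ 2) ^ N : ℝ) : ℂ) := by
  obtain ⟨C, M, hC, h⟩ := exists_abarSymbol_le_pow (n := n) hs
  -- Of the powers of `1 + ‖η‖`, `M` absorb the growth of the symbol and `n + 1` make the quotient
  -- integrable.
  refine ⟨M + n + 1, ?_⟩
  have hI : Integrable fun η : E n => (1 + ‖η‖) ^ (-((n : ℝ) + 1)) :=
    integrable_one_add_norm (by simp)
  refine Integrable.ofReal ((hI.const_mul (C * 2 ^ (M + n + 1))).mono' ?_ (.of_forall fun η => ?_))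
  · exact ((continuous_abarSymbol hs).div₀ (by fun_prop) fun η => by positivity).aestronglyMeasurable
  have hp := abarSymbol_pos s η
  have hq : 0 ≤ abarSymbol s η / (1 + (2 * π * ‖η‖) ^ 2) ^ (M + n + 1) :=
    div_nonneg hp.le (by positivity)
  refine (Real.norm_of_nonneg hq).le.trans ?_
  have h1 : (1 : ℝ) + ‖η‖ ≥ 1 := by linarith [norm_nonneg η]
  have h2 : (1 + ‖η‖) ^ 2 ≤ 2 * (1 + (2 * π * ‖η‖) ^ 2) := by
    have : (1 : ℝ) ≤ (2 * π) ^ 2 := by nlinarith [Real.pi_gt_three]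
    nlinarith [sq_nonneg (1 - ‖η‖), sq_nonneg ‖η‖]
  have h3 : (1 + ‖η‖) ^ (M + n + 1) ≤ 2 ^ (M + n + 1) * (1 + (2 * π * ‖η‖) ^ 2) ^ (M + n + 1) := by
    rw [← mul_pow]
    refine (pow_le_pow_left₀ (by positivity) ?_ _)
    nlinarith
  have h4 : (1 + ‖η‖) ^ (-((n : ℝ) + 1)) = ((1 + ‖η‖) ^ (n + 1))⁻¹ := by
    rw [Real.rpow_neg (by positivity)]
    norm_cast
  rw [h4, div_le_iff₀ (by positivity), mul_assoc, mul_assoc]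
  calc abarSymbol s η ≤ C * (1 + ‖η‖) ^ M := h η
    _ = C * (((1 + ‖η‖) ^ (n + 1))⁻¹ * (1 + ‖η‖) ^ (M + n + 1)) := by
        rw [add_assoc, pow_add (1 + ‖η‖) M, mul_comm ((1 + ‖η‖) ^ M),
          inv_mul_cancel_left₀ (by positivity)]
    _ ≤ C * (((1 + ‖η‖) ^ (n + 1))⁻¹ *
        (2 ^ (M + n + 1) * (1 + (2 * π * ‖η‖) ^ 2) ^ (M + n + 1))) := by gcongr
    _ = _ := by ring

/-- `Abar` is nonlocal and its symbol may be singular at the origin. In this factorization all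
derivatives fall on the compactly supported function `(1 - Δ)ᴺ v`, and the nonlocal factor `L`, the
inverse transform of an integrable function, only has to be continuous. -/
theorem exists_Abar_eq_convolution {s : ℝ} (hs : 0 < s) :
    ∃ (N : ℕ) (L : E n → ℝ), Continuous L ∧ ∀ v : E n → ℝ, ContDiff ℝ ∞ v → HasCompactSupport v →
      ∀ x, Abar s v x =
        convolution L (oneSubLaplacian^[N] v) (ContinuousLinearMap.mul ℝ ℝ) volume x := by
  obtain ⟨N, hN⟩ := exists_integrable_abarSymbol_div (n := n) hs
  set h : E n → ℂ := fun η => ((abarSymbol s η / (1 + (2 * π * ‖η‖) ^ 2) ^ N : ℝ) : ℂ) with hh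
  refine ⟨N, fun x => (𝓕⁻ h x).re, Complex.continuous_re.comp (continuous_fourierInv hN),
    fun v hv hc x => ?_⟩
  obtain ⟨hw, hwc, hF⟩ := iterate_oneSubLaplacian hv hc N
  set w := oneSubLaplacian^[N] v
  apply Complex.ofReal_injective
  have hL (y : E n) : ((𝓕⁻ h y).re : ℂ) = 𝓕⁻ h y := by
    refine fourierInv_eq_ofReal_re (fun η => ?_) y
    simp only [hh, Complex.conj_ofReal, abarSymbol_neg, norm_neg]
  have e1 : 𝓕⁻ (fun η : E n => (abarSymbol s η : ℂ) * 𝓕 (fun y : E n => (v y : ℂ)) η) x =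
      ∫ η, 𝓕 (fun y : E n => (w y : ℂ)) η *
        (Complex.exp ((2 * π * inner ℝ η x : ℝ) * Complex.I) * h η) := by
    rw [Real.fourierInv_eq']
    congr 1 with η
    rw [hF, hh, smul_eq_mul]
    have hp : ((1 + (2 * π * ‖η‖) ^ 2 : ℝ) : ℂ) ≠ 0 :=
      Complex.ofReal_ne_zero.2 (by positivity)
    simp only [Complex.ofReal_div, Complex.ofReal_pow]
    generalize ((1 + (2 * π * ‖η‖) ^ 2 : ℝ) : ℂ) = c at hp ⊢
    field_simp
  have i1 : Integrable fun η : E n => Complex.exp ((2 * π * inner ℝ η x : ℝ) * Complex.I) * h η := by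
    refine hN.bdd_mul (c := 1) ?_ (.of_forall fun η => ?_)
    · exact Continuous.aestronglyMeasurable (by fun_prop)
    · rw [Complex.norm_exp_ofReal_mul_I]
  rw [Abar_eq_fourierInv, e1, integral_fourier_mul_eq_flip (integrable_test hw hwc) i1, convolution,
    ← integral_complex_ofReal, ← integral_sub_left_eq_self _ volume x]
  congr 1 with y
  simp only [ContinuousLinearMap.mul_apply']
  push_cast
  rw [hL, mul_comm]
  congr 1
  rw [Real.fourier_eq', Real.fourierInv_eq']
  congr 1 with η
  rw [smul_eq_mul, smul_eq_mul, ← mul_assoc, ← Complex.exp_add, inner_sub_right]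
  congr 2
  push_cast
  ring

/-- Smoothness is local in the parameter. Near a given one the functions `(1 - Δ)ᴺ (u p)` have
supports in one compact set, so convolution with the locally integrable `L` is jointly smooth. -/
theorem TestFamilyOn.contDiffOn_Abar {s : ℝ} (hs : 0 < s) {U : Set P} (hU : IsOpen U)
    [LocallyCompactSpace P] {u : P → E n → ℝ} (hu : TestFamilyOn U u) :
    ContDiffOn ℝ ∞ (fun q : P × E n => Abar s (u q.1) q.2) (U ×ˢ univ) := by
  obtain ⟨N, L, hL, hA⟩ := exists_Abar_eq_convolution (n := n) hs
  have hw := hu.oneSubLaplacian hU N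
  rintro ⟨p, x⟩ ⟨hp, -⟩
  obtain ⟨K, hK, hpK, hKU⟩ := exists_compact_between (isCompact_singleton (x := p)) hU
    (singleton_subset_iff.2 hp)
  obtain ⟨C, hC, h0⟩ := hw.supp K hKU hK
  have h := contDiffOn_convolution_right_with_param (n := ⊤) (μ := volume)
    (ContinuousLinearMap.mul ℝ ℝ) isOpen_interior hC
    (fun q y hq hy => h0 q (interior_subset hq) y hy) hL.locallyIntegrable
    (hw.smooth.mono (prod_mono (interior_subset.trans hKU) Subset.rfl))
  have h1 := h.contDiffAt (x := (p, x))
    ((isOpen_interior.prod isOpen_univ).mem_nhds ⟨singleton_subset_iff.1 hpK, mem_univ _⟩)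
  refine (h1.congr_of_eventuallyEq ?_).contDiffWithinAt
  filter_upwards [(hU.prod isOpen_univ).mem_nhds ⟨hp, mem_univ x⟩] with q hq
  exact hA _ (hu.contDiff hq.1) (hu.hasCompactSupport hq.1) q.2

end SobolevDiff

namespace SobolevDiff

variable {n : ℕ}

/-! ### Smooth families of diffeomorphisms -/

variable {P : Type*} [NormedAddCommGroup P] [NormedSpace ℝ P]
  {F : Type*} [NormedAddCommGroup F] [NormedSpace ℝ F]

namespace SmoothFamilyOn

variable {U : Set P} {φ : P → DiffC n}

theorem testFamilyOn_sub (hφ : SmoothFamilyOn U φ) :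
    TestFamilyOn U fun p x => (φ p).1 x - x where
  smooth := hφ.1.sub contDiffOn_snd
  supp K hKU hK := by
    obtain ⟨C, hC, h⟩ := hφ.2 K hKU hK
    exact ⟨C, hC, fun p hp x hx => sub_eq_zero.2 (h p hp x hx)⟩

theorem hasFDerivAt (hU : IsOpen U) (hφ : SmoothFamilyOn U φ) {p : P} (hp : p ∈ U) (x : E n) :
    HasFDerivAt (fun q : P × E n => (φ q.1).1 q.2)
      (fderiv ℝ (fun q : P × E n => (φ q.1).1 q.2) (p, x)) (p, x) :=
  ((hφ.1.contDiffAt ((hU.prod isOpen_univ).mem_nhds ⟨hp, mem_univ x⟩)).differentiableAt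
    (by simp)).hasFDerivAt

/-- Inverse function theorem for `(p, x) ↦ (p, φ_p x)`. Its derivative is block triangular with
invertible diagonal blocks, and since each `φ_p` is globally injective the local inverse must be
`(p, y) ↦ (p, φ_p⁻¹ y)`. -/
theorem contDiffOn_symm [CompleteSpace P] (hU : IsOpen U) (hφ : SmoothFamilyOn U φ) :
    ContDiffOn ℝ ∞ (fun q : P × E n => (φ q.1).1.symm q.2) (U ×ˢ univ) := by
  rintro ⟨p, y⟩ ⟨hp, -⟩
  set x := (φ p).1.symm y with hx
  have hxy : (φ p).1 x = y := (φ p).1.apply_symm_apply y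
  set T := fderiv ℝ (fun q : P × E n => (φ q.1).1 q.2) (p, x) with hT
  have hF := hφ.hasFDerivAt hU hp x
  have hd1 : HasFDerivAt (φ p).1 (T.comp (ContinuousLinearMap.inr ℝ P (E n))) x :=
    hF.comp x (hasFDerivAt_prodMk_right p x)
  set D' := fderiv ℝ (φ p).1.symm y
  have hd2 : HasFDerivAt (φ p).1.symm D' y :=
    ((φ p).1.symm.contDiff.differentiable (by simp) y).hasFDerivAt
  have e1 (ξ : E n) : D' (T (0, ξ)) = ξ := by
    have h := HasFDerivAt.comp x (g := (φ p).1.symm) (by rw [hxy]; exact hd2) hd1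
    have h2 : (φ p).1.symm ∘ (φ p).1 = id := funext (φ p).1.symm_apply_apply
    rw [h2] at h
    exact DFunLike.congr_fun (h.unique (hasFDerivAt_id x)) ξ
  have e2 (ξ : E n) : T (0, D' ξ) = ξ := by
    have h := HasFDerivAt.comp y (g := (φ p).1) (f := (φ p).1.symm) hd1 hd2
    have h2 : (φ p).1 ∘ (φ p).1.symm = id := funext (φ p).1.apply_symm_apply
    rw [h2] at h
    exact DFunLike.congr_fun (h.unique (hasFDerivAt_id y)) ξ
  have eT (c : P) (ξ : E n) : T (c, ξ) = T (c, 0) + T (0, ξ) := by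
    rw [← map_add, Prod.mk_add_mk, add_zero, zero_add]
  let A : P × E n →L[ℝ] P × E n := (ContinuousLinearMap.fst ℝ P (E n)).prod T
  -- The inverse of the triangular map `(c, ξ) ↦ (c, T (c, 0) + T (0, ξ))` is `(c, ξ) ↦ (c, D' (ξ -
  -- T (c, 0)))`.
  let B : P × E n →L[ℝ] P × E n := (ContinuousLinearMap.fst ℝ P (E n)).prod
    (D'.comp (ContinuousLinearMap.snd ℝ P (E n) -
      T.comp ((ContinuousLinearMap.inl ℝ P (E n)).comp (ContinuousLinearMap.fst ℝ P (E n)))))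
  let L : (P × E n) ≃L[ℝ] (P × E n) := ContinuousLinearEquiv.equivOfInverse A B
    (fun ⟨c, ξ⟩ => by simp [A, B, eT c ξ, e1]) (fun ⟨c, ξ⟩ => by
      simp only [A, B, ContinuousLinearMap.prod_apply, ContinuousLinearMap.coe_fst',
        ContinuousLinearMap.comp_apply, sub_apply,
        ContinuousLinearMap.coe_snd', ContinuousLinearMap.inl_apply, Prod.mk.injEq, true_and]
      rw [eT, e2, add_sub_cancel])
  have hc : ContDiffAt ℝ ∞ (fun q : P × E n => (q.1, (φ q.1).1 q.2)) (p, x) :=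
    contDiffAt_fst.prodMk
      (hφ.1.contDiffAt ((hU.prod isOpen_univ).mem_nhds ⟨hp, mem_univ x⟩))
  have hL : HasFDerivAt (fun q : P × E n => (q.1, (φ q.1).1 q.2)) (L : P × E n →L[ℝ] P × E n)
      (p, x) := hasFDerivAt_fst.prodMk hF
  have hne : (∞ : WithTop ℕ∞) ≠ 0 := by simp
  have hinv : ContDiffAt ℝ ∞ (hc.localInverse hL hne) (p, y) := by
    simpa only [hxy] using hc.to_localInverse hL hne
  have hr : ∀ᶠ q in 𝓝 (p, y), (fun q : P × E n => (q.1, (φ q.1).1 q.2))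
      (hc.localInverse hL hne q) = q := by
    have h := (hc.hasStrictFDerivAt' hL hne).eventually_right_inverse
    simp only [hxy] at h
    exact h
  refine (hinv.snd.congr_of_eventuallyEq ?_).contDiffWithinAt
  filter_upwards [hr] with q hq
  have q1 := congrArg Prod.fst hq
  have q2 := congrArg Prod.snd hq
  dsimp only at q1 q2
  rw [q1] at q2
  rw [← q2]
  exact (φ q.1).1.symm_apply_apply _

theorem testFamilyOn_comp_symm [CompleteSpace P] (hU : IsOpen U) (hφ : SmoothFamilyOn U φ)
    {u : P → E n → F} (hu : TestFamilyOn U u) :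
    TestFamilyOn U fun p y => u p ((φ p).1.symm y) where
  smooth := hu.smooth.comp (f := fun q : P × E n => (q.1, (φ q.1).1.symm q.2))
    (contDiffOn_fst.prodMk (hφ.contDiffOn_symm hU)) fun q hq => ⟨hq.1, mem_univ _⟩
  supp K hKU hK := by
    obtain ⟨C, hC, h0⟩ := hu.supp K hKU hK
    obtain ⟨D, hD, h1⟩ := hφ.2 K hKU hK
    refine ⟨C ∪ D, hC.union hD, fun p hp y hy => ?_⟩
    rw [mem_union, not_or] at hy
    have h2 : (φ p).1.symm y = y := by
      conv_lhs => rw [← h1 p hp y hy.2]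
      exact (φ p).1.symm_apply_apply y
    rw [h2, h0 p hp y hy.1]

end SmoothFamilyOn

/-- The right trivialized derivative of a family of diffeomorphisms, in the direction `c` of the
parameter space. -/
def paramField (φ : P → DiffC n) (c p : P) (y : E n) : E n :=
  fderiv ℝ (fun q : P × E n => (φ q.1).1 q.2) (p, (φ p).1.symm y) (c, 0)

namespace SmoothFamilyOn

variable {U : Set P} {φ : P → DiffC n}

theorem testFamilyOn_paramField [CompleteSpace P] [LocallyCompactSpace P] (hU : IsOpen U)
    (hφ : SmoothFamilyOn U φ) (c : P) : TestFamilyOn U (paramField φ c) := by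
  refine hφ.testFamilyOn_comp_symm hU (u := fun p x =>
    fderiv ℝ (fun q : P × E n => (φ q.1).1 q.2) (p, x) (c, 0)) ?_
  refine (hφ.testFamilyOn_sub.dirDeriv hU (c, 0)).congr fun p hp x => ?_
  have h := ((hφ.hasFDerivAt hU hp x).sub (hasFDerivAt_snd (𝕜 := ℝ))).fderiv
  have h2 := DFunLike.congr_fun h (c, (0 : E n))
  simp only [sub_apply, ContinuousLinearMap.coe_snd', sub_zero] at h2
  exact h2.symm

/-- Equality of mixed second derivatives, for the right trivialized derivatives. -/
theorem fderiv_paramField_comm [CompleteSpace P] [LocallyCompactSpace P] (hU : IsOpen U)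
    (hφ : SmoothFamilyOn U φ) (c d : P) {p : P} (hp : p ∈ U) (y : E n) :
    fderiv ℝ (fun q : P × E n => paramField φ c q.1 q.2) (p, y) (d, paramField φ d p y) =
      fderiv ℝ (fun q : P × E n => paramField φ d q.1 q.2) (p, y) (c, paramField φ c p y) := by
  set f : P × E n → E n := fun q => (φ q.1).1 q.2 with hf
  set x := (φ p).1.symm y with hx
  have hxy : f (p, x) = y := (φ p).1.apply_symm_apply y
  have hmem : U ×ˢ univ ∈ 𝓝 (p, x) := (hU.prod isOpen_univ).mem_nhds ⟨hp, mem_univ x⟩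
  have hfc : ContDiffAt ℝ ∞ f (p, x) := hφ.1.contDiffAt hmem
  have hf2 : DifferentiableAt ℝ (fderiv ℝ f) (p, x) :=
    (hfc.fderiv_right (m := ∞) le_rfl).differentiableAt (by simp)
  -- Undoing the right translation, `paramField φ c` along `(q.1, f q)` is the plain derivative of
  -- `f` in the direction `c`. Differentiating this once more in the direction `(d, 0)` moves the
  -- base point with velocity `paramField φ d`, which explains the direction on the left; symmetry
  -- of the second derivative does the rest.
  have key (c d : P) : fderiv ℝ (fun q : P × E n => paramField φ c q.1 q.2) (p, y)
      (d, paramField φ d p y) = fderiv ℝ (fderiv ℝ f) (p, x) (d, 0) (c, 0) := by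
    have hA : HasFDerivAt (fun q : P × E n => (q.1, f q))
        ((ContinuousLinearMap.fst ℝ P (E n)).prod (fderiv ℝ f (p, x))) (p, x) :=
      hasFDerivAt_fst.prodMk (hφ.hasFDerivAt hU hp x)
    have hV := (hφ.testFamilyOn_paramField hU c).hasFDerivAt hU hp y
    have h1 := HasFDerivAt.comp (p, x) (f := fun q : P × E n => (q.1, f q))
      (g := fun q : P × E n => paramField φ c q.1 q.2) (by rw [hxy]; exact hV) hA
    have h2 : (fun q : P × E n => paramField φ c q.1 q.2) ∘ (fun q : P × E n => (q.1, f q)) =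
        fun q => fderiv ℝ f q (c, 0) := by
      funext q
      simp only [Function.comp_apply, paramField, hf]
      rw [(φ q.1).1.symm_apply_apply]
    rw [h2] at h1
    have h3 := DFunLike.congr_fun
      (h1.unique (hf2.hasFDerivAt.clm_apply (hasFDerivAt_const (c, (0 : E n)) (p, x)))) (d, 0)
    simpa [paramField] using h3
  rw [key c d, key d c]
  exact (hfc.isSymmSndFDerivAt (by simpa using WithTop.coe_le_coe.2 (le_top (a := (2 : ℕ∞))))).eq _ _

end SmoothFamilyOn

theorem eulerVelocity_eq_paramField {U : Set P} (hU : IsOpen U) {φ : P → DiffC n}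
    (hφ : SmoothFamilyOn U φ) {γ : ℝ → P} {c : P} {t : ℝ} (hγ : HasDerivAt γ c t) (ht : γ t ∈ U)
    (y : E n) : eulerVelocity (fun τ => φ (γ τ)) t y = paramField φ c (γ t) y := by
  set x := (φ (γ t)).1.symm y
  have h := (hφ.hasFDerivAt hU ht x).comp_hasDerivAt t (hγ.prodMk (hasDerivAt_const t x))
  exact h.deriv

end SobolevDiff

namespace SobolevDiff

variable {n : ℕ}

/-! ### Integrals of families of test functions -/

variable {P F : Type*} [NormedAddCommGroup P] [NormedSpace ℝ P]
  [NormedAddCommGroup F] [NormedSpace ℝ F]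

section SmoothFamilies

variable {U : Set P} {f : P → E n → F}

theorem hasFDerivAt_family (hU : IsOpen U)
    (hf : ContDiffOn ℝ ∞ (fun q : P × E n => f q.1 q.2) (U ×ˢ univ)) {p : P} (hp : p ∈ U)
    (x : E n) : HasFDerivAt (fun q : P × E n => f q.1 q.2)
      (fderiv ℝ (fun q : P × E n => f q.1 q.2) (p, x)) (p, x) :=
  ((hf.contDiffAt ((hU.prod isOpen_univ).mem_nhds ⟨hp, mem_univ x⟩)).differentiableAt
    (by simp)).hasFDerivAt

theorem hasFDerivAt_slice (hU : IsOpen U)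
    (hf : ContDiffOn ℝ ∞ (fun q : P × E n => f q.1 q.2) (U ×ˢ univ)) {p : P} (hp : p ∈ U)
    (x : E n) : HasFDerivAt (f p) ((fderiv ℝ (fun q : P × E n => f q.1 q.2) (p, x)).comp
      (ContinuousLinearMap.inr ℝ P (E n))) x :=
  (hasFDerivAt_family hU hf hp x).comp x (hasFDerivAt_prodMk_right p x)

theorem hasDerivAt_family_comp (hU : IsOpen U)
    (hf : ContDiffOn ℝ ∞ (fun q : P × E n => f q.1 q.2) (U ×ˢ univ)) {γ : ℝ → P} {c : P} {t : ℝ}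
    (hγ : HasDerivAt γ c t) (ht : γ t ∈ U) (x : E n) : HasDerivAt (fun τ => f (γ τ) x)
      (fderiv ℝ (fun q : P × E n => f q.1 q.2) (γ t, x) (c, 0)) t :=
  HasFDerivAt.comp_hasDerivAt (f := fun τ => (γ τ, x)) t (hasFDerivAt_family hU hf ht x)
    (hγ.prodMk (hasDerivAt_const t x))

theorem contDiffOn_fderiv_family (hU : IsOpen U)
    (hf : ContDiffOn ℝ ∞ (fun q : P × E n => f q.1 q.2) (U ×ˢ univ)) (d : P × E n) :
    ContDiffOn ℝ ∞ (fun q : P × E n => fderiv ℝ (fun q : P × E n => f q.1 q.2) (q.1, q.2) d)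
      (U ×ˢ univ) :=
  (hf.fderiv_of_isOpen (hU.prod isOpen_univ) (m := ∞) le_rfl).clm_apply contDiffOn_const

theorem contDiffOn_pderiv_family {f : P → E n → ℝ} (hU : IsOpen U)
    (hf : ContDiffOn ℝ ∞ (fun q : P × E n => f q.1 q.2) (U ×ˢ univ)) (i : Fin n) :
    ContDiffOn ℝ ∞ (fun q : P × E n => pderiv i (f q.1) q.2) (U ×ˢ univ) := by
  refine (contDiffOn_fderiv_family hU hf (0, EuclideanSpace.single i 1)).congr fun q hq => ?_
  rw [pderiv, (hasFDerivAt_slice hU hf hq.1 q.2).fderiv]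
  simp

theorem contDiffOn_deriv_family {J : Set ℝ} {f : ℝ → E n → F} (hJ : IsOpen J)
    (hf : ContDiffOn ℝ ∞ (fun q : ℝ × E n => f q.1 q.2) (J ×ˢ univ)) :
    ContDiffOn ℝ ∞ (fun q : ℝ × E n => deriv (fun τ => f τ q.2) q.1) (J ×ˢ univ) :=
  (contDiffOn_fderiv_family hJ hf (1, 0)).congr fun q hq =>
    (hasDerivAt_family_comp hJ hf (hasDerivAt_id q.1) hq.1 q.2).deriv

theorem hasDerivAt_family {J : Set ℝ} {f : ℝ → E n → F} (hJ : IsOpen J)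
    (hf : ContDiffOn ℝ ∞ (fun q : ℝ × E n => f q.1 q.2) (J ×ˢ univ)) {t : ℝ} (ht : t ∈ J)
    (x : E n) : HasDerivAt (fun τ => f τ x) (deriv (fun τ => f τ x) t) t :=
  (hasDerivAt_family_comp hJ hf (hasDerivAt_id t) ht x).differentiableAt.hasDerivAt

end SmoothFamilies

namespace TestFamilyOn

theorem mul_left {U : Set P} {a u : P → E n → ℝ} (hu : TestFamilyOn U u)
    (ha : ContDiffOn ℝ ∞ (fun q : P × E n => a q.1 q.2) (U ×ˢ univ)) :
    TestFamilyOn U fun p x => a p x * u p x :=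
  hu.smul ha

theorem mul_right {U : Set P} {a u : P → E n → ℝ} (hu : TestFamilyOn U u)
    (ha : ContDiffOn ℝ ∞ (fun q : P × E n => a q.1 q.2) (U ×ˢ univ)) :
    TestFamilyOn U fun p x => u p x * a p x :=
  (hu.smul ha).congr fun _ _ _ => mul_comm _ _

theorem deriv {J : Set ℝ} {u : ℝ → E n → F} (hJ : IsOpen J) (hu : TestFamilyOn J u) :
    TestFamilyOn J fun t x => deriv (fun τ => u τ x) t :=
  (hu.dirDeriv hJ (1, 0)).congr fun _ ht x =>
    (hasDerivAt_family_comp hJ hu.smooth (hasDerivAt_id _) ht x).deriv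

theorem integrable {U : Set P} {u : P → E n → ℝ} (hu : TestFamilyOn U u) {p : P} (hp : p ∈ U) :
    Integrable (u p) :=
  (hu.contDiff hp).continuous.integrable_of_hasCompactSupport (hu.hasCompactSupport hp)

theorem continuousOn_integral [LocallyCompactSpace P] {U : Set P} (hU : IsOpen U)
    {u : P → E n → ℝ} (hu : TestFamilyOn U u) : ContinuousOn (fun p => ∫ x, u p x) U := by
  intro p hp
  obtain ⟨K, hK, hpK, hKU⟩ := exists_compact_between (isCompact_singleton (x := p)) hU
    (singleton_subset_iff.2 hp)
  obtain ⟨C, hC, h0⟩ := hu.supp K hKU hK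
  have h := continuousOn_integral_of_compact_support (μ := (volume : Measure (E n))) hC
    (hu.smooth.continuousOn.mono (prod_mono hKU Subset.rfl))
    fun p x hp hx => h0 p hp x hx
  exact (h.continuousAt (mem_interior_iff_mem_nhds.1 (singleton_subset_iff.1 hpK))).continuousWithinAt

theorem intervalIntegrable_integral {J : Set ℝ} (hJ : IsOpen J) {u : ℝ → E n → ℝ}
    (hu : TestFamilyOn J u) {a b : ℝ} (hab : a ≤ b) (h : Icc a b ⊆ J) :
    IntervalIntegrable (fun t => ∫ x, u t x) volume a b :=
  ((hu.continuousOn_integral hJ).mono (by rwa [uIcc_of_le hab])).intervalIntegrable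

theorem hasDerivAt_integral {J : Set ℝ} (hJ : IsOpen J) {u : ℝ → E n → ℝ} (hu : TestFamilyOn J u)
    {t : ℝ} (ht : t ∈ J) :
    HasDerivAt (fun τ => ∫ x, u τ x) (∫ x, _root_.deriv (fun τ => u τ x) t) t := by
  obtain ⟨K, hK, hpK, hKU⟩ := exists_compact_between (isCompact_singleton (x := t)) hJ
    (singleton_subset_iff.2 ht)
  have hKt : K ∈ 𝓝 t := mem_interior_iff_mem_nhds.1 (singleton_subset_iff.1 hpK)
  have hd := hu.deriv hJ
  obtain ⟨C, hC, h0⟩ := hd.supp K hKU hK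
  obtain ⟨B, hB⟩ := (hK.prod hC).exists_bound_of_continuousOn
    (hd.smooth.continuousOn.mono (prod_mono hKU (subset_univ C)))
  refine (hasDerivAt_integral_of_dominated_loc_of_deriv_le hKt
    (F' := fun t x => _root_.deriv (fun τ => u τ x) t) (bound := C.indicator fun _ => B)
    ?_ (hu.integrable ht) (hd.integrable ht).aestronglyMeasurable ?_ ?_ ?_).2
  · filter_upwards [hJ.mem_nhds ht] with τ hτ using (hu.integrable hτ).aestronglyMeasurable
  · refine Eventually.of_forall fun x τ hτ => ?_
    by_cases hx : x ∈ C
    · rw [indicator_of_mem hx]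
      exact hB (τ, x) ⟨hτ, hx⟩
    · rw [indicator_of_notMem hx, h0 τ hτ x hx, norm_zero]
  · exact (integrable_indicator_iff hC.measurableSet).2
      (integrableOn_const hC.measure_lt_top.ne)
  · exact Eventually.of_forall fun x τ hτ => hasDerivAt_family hJ hu.smooth (hKU hτ) x

theorem integral_deriv_eq_sub {J : Set ℝ} (hJ : IsOpen J) {u : ℝ → E n → ℝ}
    (hu : TestFamilyOn J u) {a b : ℝ} (hab : a ≤ b) (h : Icc a b ⊆ J) :
    ∫ t in a..b, ∫ x, _root_.deriv (fun τ => u τ x) t = (∫ x, u b x) - ∫ x, u a x := by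
  refine intervalIntegral.integral_eq_sub_of_hasDerivAt (f := fun t => ∫ x, u t x)
    (fun t ht => hu.hasDerivAt_integral hJ (h ?_))
    ((hu.deriv hJ).intervalIntegrable_integral hJ hab h)
  rwa [uIcc_of_le hab] at ht

theorem integral_pderiv_eq_zero {v : E n → ℝ} (hv : ContDiff ℝ ∞ v) (hc : HasCompactSupport v)
    (i : Fin n) : ∫ x, SobolevDiff.pderiv i v x = 0 := by
  have i1 : Integrable (SobolevDiff.pderiv i v) :=
    (contDiff_pderiv hv i).continuous.integrable_of_hasCompactSupport
    (hasCompactSupport_pderiv hc i)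
  have i2 : Integrable v := hv.continuous.integrable_of_hasCompactSupport hc
  have h := integral_mul_fderiv_eq_neg_fderiv_mul_of_integrable (μ := (volume : Measure (E n)))
    (f := fun _ => (1 : ℝ)) (g := v) (v := EuclideanSpace.single i (1 : ℝ)) (by simp)
    (by simp only [one_mul]; exact i1)
    (by simpa using i2) (fun _ _ => differentiableAt_const _)
    (fun x _ => hv.differentiable (by simp) x)
  simpa [SobolevDiff.pderiv] using h

/-- Differentiation under both integrals. The inner one uses the common compact support, the outer
one a bound of the differentiated inner integral on the compact set of `ε` near `ε₀` and `t ∈ [a,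
b]`. -/
theorem hasDerivAt_integral_integral {J : Set ℝ} (hJ : IsOpen J) {H : ℝ × ℝ → E n → ℝ}
    (hH : TestFamilyOn (univ ×ˢ J) H) {a b : ℝ} (hab : a ≤ b) (h : Icc a b ⊆ J) (ε₀ : ℝ) :
    HasDerivAt (fun ε => ∫ t in a..b, ∫ x, H (ε, t) x)
      (∫ t in a..b, ∫ x, _root_.deriv (fun ε => H (ε, t) x) ε₀) ε₀ := by
  have hU : IsOpen ((univ : Set ℝ) ×ˢ J) := isOpen_univ.prod hJ
  have hd : TestFamilyOn (univ ×ˢ J) fun p x => _root_.deriv (fun ε => H (ε, p.2) x) p.1 := by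
    refine (hH.dirDeriv hU ((1, 0), 0)).congr fun p hp x => ?_
    exact (hasDerivAt_family_comp hU hH.smooth (γ := fun ε => (ε, p.2)) (t := p.1)
      ((hasDerivAt_id _).prodMk (hasDerivAt_const _ _)) hp x).deriv
  have hslice (t : ℝ) (ht : t ∈ J) : TestFamilyOn univ fun ε => H (ε, t) :=
    hH.comp_param (f := fun ε => (ε, t)) (by fun_prop) fun ε _ => ⟨mem_univ _, ht⟩
  have hslice2 (ε : ℝ) : TestFamilyOn J fun t => H (ε, t) :=
    hH.comp_param (f := fun t => (ε, t)) (by fun_prop) fun t ht => ⟨mem_univ _, ht⟩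
  have hdslice2 (ε : ℝ) : TestFamilyOn J fun t x => _root_.deriv (fun ε => H (ε, t) x) ε :=
    hd.comp_param (f := fun t => (ε, t)) (by fun_prop) fun t ht => ⟨mem_univ _, ht⟩
  have hK : IsCompact (Metric.closedBall ε₀ 1 ×ˢ Icc a b) :=
    (isCompact_closedBall ε₀ 1).prod isCompact_Icc
  obtain ⟨B, hB⟩ := hK.exists_bound_of_continuousOn
    ((hd.continuousOn_integral hU).mono (prod_mono (subset_univ _) h))
  have hsub : uIoc a b ⊆ Icc a b := by rw [uIoc_of_le hab]; exact Ioc_subset_Icc_self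
  refine (intervalIntegral.hasDerivAt_integral_of_dominated_loc_of_deriv_le
    (F' := fun ε t => ∫ x, _root_.deriv (fun ε => H (ε, t) x) ε) (bound := fun _ => B)
    (Metric.closedBall_mem_nhds ε₀ one_pos) ?_
    ((hslice2 ε₀).intervalIntegrable_integral hJ hab h) ?_ ?_ (by simp) ?_).2
  · exact Eventually.of_forall fun ε =>
      (intervalIntegrable_iff.1
        ((hslice2 ε).intervalIntegrable_integral hJ hab h)).aestronglyMeasurable
  · exact (intervalIntegrable_iff.1
      ((hdslice2 ε₀).intervalIntegrable_integral hJ hab h)).aestronglyMeasurable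
  · exact Eventually.of_forall fun t ht ε hε => hB (ε, t) ⟨hε, hsub ht⟩
  · exact Eventually.of_forall fun t ht ε _ =>
      (hslice t (h (hsub ht))).hasDerivAt_integral isOpen_univ (mem_univ ε)

end TestFamilyOn

end SobolevDiff

namespace SobolevDiff

variable {n : ℕ}

/-! ### The first variation of the energy -/

/-- The defect in the momentum equation `mᵏₜ + ∑ᵢ (mⁱ ∂ₖuⁱ + ∂ᵢmᵏ uⁱ + mᵏ ∂ᵢuⁱ) = 0`. -/
def momentumDefect (u m : ℝ → E n → E n) (k : Fin n) (t : ℝ) (x : E n) : ℝ :=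
  deriv (fun τ => m τ x k) t + ∑ i, (m t x i * pderiv k (fun y => u t y i) x
    + (pderiv i (fun y => m t y k) x * u t x i + m t x k * pderiv i (fun y => u t y i) x))

section ByParts

variable {J : Set ℝ} {u w m : ℝ → E n → E n}

theorem contDiffOn_apply (hm : ContDiffOn ℝ ∞ (fun q : ℝ × E n => m q.1 q.2) (J ×ˢ univ))
    (k : Fin n) : ContDiffOn ℝ ∞ (fun q : ℝ × E n => m q.1 q.2 k) (J ×ˢ univ) :=
  contDiffOn_euclidean.1 hm k

theorem contDiffOn_momentumDefect (hJ : IsOpen J) (hu : TestFamilyOn J u)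
    (hm : ContDiffOn ℝ ∞ (fun q : ℝ × E n => m q.1 q.2) (J ×ˢ univ)) (k : Fin n) :
    ContDiffOn ℝ ∞ (fun q : ℝ × E n => momentumDefect u m k q.1 q.2) (J ×ˢ univ) := by
  have hm' := contDiffOn_apply hm
  refine (contDiffOn_deriv_family (f := fun t x => m t x k) hJ (hm' k)).add
    (ContDiffOn.sum fun i _ => ?_)
  refine ((hm' i).mul ((hu.coord i).pderiv hJ k).smooth).add (ContDiffOn.add ?_ ?_)
  · exact (contDiffOn_pderiv_family (f := fun t x => m t x k) hJ (hm' k) i).mul (hu.coord i).smooth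
  · exact (hm' k).mul ((hu.coord i).pderiv hJ i).smooth

theorem pderiv_mul {f g : E n → ℝ} {x : E n} (hf : DifferentiableAt ℝ f x)
    (hg : DifferentiableAt ℝ g x) (i : Fin n) :
    pderiv i (fun y => f y * g y) x = pderiv i f x * g x + f x * pderiv i g x := by
  have h := (hf.hasFDerivAt.mul hg.hasFDerivAt).fderiv
  rw [pderiv, show (fun y => f y * g y) = f * g from rfl, h]
  simp [pderiv]
  ring

theorem pderiv_sum {ι : Type*} (s : Finset ι) {f : ι → E n → ℝ} {x : E n}
    (hf : ∀ j ∈ s, DifferentiableAt ℝ (f j) x) (i : Fin n) :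
    pderiv i (fun y => ∑ j ∈ s, f j y) x = ∑ j ∈ s, pderiv i (f j) x := by
  rw [pderiv, fderiv_fun_sum hf]
  simp [pderiv]

/-- The pointwise algebra behind the integration by parts. The two terms with `m`, `w` and a mixed
derivative of `u` cancel after renaming indices, and everything else assembles into derivatives of
products. -/
theorem sum_variation_add_sum_defect {ι : Type*} [Fintype ι] (m w u mt wt : ι → ℝ)
    (dm dw du : ι → ι → ℝ) :
    (∑ k, m k * (wt k + ∑ i, (dw i k * u i - du i k * w i))) +
      ∑ k, w k * (mt k + ∑ i, (m i * du k i + (dm i k * u i + m k * du i i))) =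
    (∑ k, (mt k * w k + m k * wt k)) +
      ∑ i, ∑ k, ((dm i k * w k + m k * dw i k) * u i + m k * w k * du i i) := by
  have e : ∑ k, ∑ i, m k * (du i k * w i) = ∑ k, ∑ i, w k * (m i * du k i) := by
    rw [Finset.sum_comm]
    exact Finset.sum_congr rfl fun i _ => Finset.sum_congr rfl fun k _ => by ring
  have e2 : ∑ k, ∑ i, (m k * (dw i k * u i - du i k * w i) +
      w k * (m i * du k i + (dm i k * u i + m k * du i i))) =
      (∑ k, ∑ i, ((dm i k * w k + m k * dw i k) * u i + m k * w k * du i i)) +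
        ((∑ k, ∑ i, w k * (m i * du k i)) - ∑ k, ∑ i, m k * (du i k * w i)) := by
    simp only [← Finset.sum_add_distrib, ← Finset.sum_sub_distrib]
    exact Finset.sum_congr rfl fun k _ => Finset.sum_congr rfl fun i _ => by ring
  rw [e, sub_self, add_zero] at e2
  rw [Finset.sum_comm (f := fun i k => (dm i k * w k + m k * dw i k) * u i + m k * w k * du i i),
    ← e2]
  simp only [mul_add, Finset.mul_sum, Finset.sum_add_distrib, mul_comm (w _) (mt _)]
  ring

theorem variation_integrand_add_defect (hJ : IsOpen J) (hu : TestFamilyOn J u)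
    (hw : TestFamilyOn J w) (hm : ContDiffOn ℝ ∞ (fun q : ℝ × E n => m q.1 q.2) (J ×ˢ univ))
    {t : ℝ} (ht : t ∈ J) (x : E n) :
    (∑ k, m t x k * (deriv (fun τ => w τ x k) t +
      ∑ i, (pderiv i (fun y => w t y k) x * u t x i - pderiv i (fun y => u t y k) x * w t x i))) +
      ∑ k, w t x k * momentumDefect u m k t x =
    deriv (fun τ => ∑ k, m τ x k * w τ x k) t +
      ∑ i, pderiv i (fun y => (∑ k, m t y k * w t y k) * u t y i) x := by
  have hm' := contDiffOn_apply hm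
  have dw (k : Fin n) : DifferentiableAt ℝ (fun y => w t y k) x :=
    ((hw.coord k).contDiff ht).differentiable (by simp) x
  have du (k : Fin n) : DifferentiableAt ℝ (fun y => u t y k) x :=
    ((hu.coord k).contDiff ht).differentiable (by simp) x
  have dm (k : Fin n) : DifferentiableAt ℝ (fun y => m t y k) x :=
    (hasFDerivAt_slice (f := fun t x => m t x k) hJ (hm' k) ht x).differentiableAt
  have e1 : deriv (fun τ => ∑ k, m τ x k * w τ x k) t =
      ∑ k, (deriv (fun τ => m τ x k) t * w t x k + m t x k * deriv (fun τ => w τ x k) t) := by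
    refine (HasDerivAt.fun_sum fun k _ => ?_).deriv
    exact (hasDerivAt_family (f := fun t x => m t x k) hJ (hm' k) ht x).mul
      (hasDerivAt_family (f := fun t x => w t x k) hJ (hw.coord k).smooth ht x)
  have e2 (i : Fin n) : pderiv i (fun y => (∑ k, m t y k * w t y k) * u t y i) x =
      ∑ k, ((pderiv i (fun y => m t y k) x * w t x k + m t x k * pderiv i (fun y => w t y k) x) *
        u t x i + m t x k * w t x k * pderiv i (fun y => u t y i) x) := by
    have dmw (k : Fin n) : DifferentiableAt ℝ (fun y => m t y k * w t y k) x := (dm k).mul (dw k)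
    rw [pderiv_mul (DifferentiableAt.fun_sum fun k _ => dmw k) (du i),
      pderiv_sum _ (fun k _ => dmw k), Finset.sum_mul, Finset.sum_mul,
      ← Finset.sum_add_distrib]
    exact Finset.sum_congr rfl fun k _ => by rw [pderiv_mul (dm k) (dw k)]
  rw [e1]
  simp_rw [e2]
  exact sum_variation_add_sum_defect (fun k => m t x k) (fun k => w t x k) (fun k => u t x k) _ _
    (fun i k => pderiv i (fun y => m t y k) x) (fun i k => pderiv i (fun y => w t y k) x)
    (fun i k => pderiv i (fun y => u t y k) x)

/-- The two integrands add up to `∂_t (m·w)` plus the divergence of `(m·w) u`. The divergence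
integrates to zero because `w` has compact support, although `m` need not; the time derivative does
so because `w` vanishes at the end points. -/
theorem integral_variation_eq_neg_integral_defect (hJ : IsOpen J) (hu : TestFamilyOn J u)
    (hw : TestFamilyOn J w) (hm : ContDiffOn ℝ ∞ (fun q : ℝ × E n => m q.1 q.2) (J ×ˢ univ))
    {a b : ℝ} (hab : a ≤ b) (h : Icc a b ⊆ J) (ha : ∀ x, w a x = 0) (hb : ∀ x, w b x = 0) :
    ∫ t in a..b, ∫ x, ∑ k, m t x k * (deriv (fun τ => w τ x k) t +
      ∑ i, (pderiv i (fun y => w t y k) x * u t x i - pderiv i (fun y => u t y k) x * w t x i)) =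
    -∫ t in a..b, ∫ x, ∑ k, w t x k * momentumDefect u m k t x := by
  have hm' := contDiffOn_apply hm
  have hq : TestFamilyOn J fun t x => ∑ k, m t x k * w t x k :=
    TestFamilyOn.sum _ fun k => (hw.coord k).mul_left (hm' k)
  have h2 : TestFamilyOn J fun t x => ∑ k, w t x k * momentumDefect u m k t x :=
    TestFamilyOn.sum _ fun k => (hw.coord k).mul_right (contDiffOn_momentumDefect hJ hu hm k)
  have h1 : TestFamilyOn J fun t x => ∑ k, m t x k * (deriv (fun τ => w τ x k) t +
      ∑ i, (pderiv i (fun y => w t y k) x * u t x i -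
        pderiv i (fun y => u t y k) x * w t x i)) := by
    refine TestFamilyOn.sum _ fun k => TestFamilyOn.mul_left ?_ (hm' k)
    refine ((hw.coord k).deriv hJ).add (TestFamilyOn.sum _ fun i => ?_)
    exact (((hw.coord k).pderiv hJ i).mul_right (hu.coord i).smooth).sub
      (((hu.coord k).pderiv hJ i).mul_right (hw.coord i).smooth)
  rw [← sub_eq_zero, sub_neg_eq_add, ← intervalIntegral.integral_add
    (h1.intervalIntegrable_integral hJ hab h) (h2.intervalIntegrable_integral hJ hab h)]
  have e : ∀ t ∈ J, (∫ x, ∑ k, m t x k * (deriv (fun τ => w τ x k) t +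
      ∑ i, (pderiv i (fun y => w t y k) x * u t x i - pderiv i (fun y => u t y k) x * w t x i))) +
      (∫ x, ∑ k, w t x k * momentumDefect u m k t x) =
      ∫ x, deriv (fun τ => ∑ k, m τ x k * w τ x k) t := by
    intro t ht
    have hqi (i : Fin n) := hq.mul_right (a := fun t x => u t x i) (hu.coord i).smooth
    rw [← integral_add (h1.integrable ht) (h2.integrable ht)]
    simp_rw [variation_integrand_add_defect hJ hu hw hm ht]
    rw [integral_add ((hq.deriv hJ).integrable ht)
      (integrable_finsetSum _ fun i _ => ((hqi i).pderiv hJ i).integrable ht),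
      integral_finsetSum _ fun i _ => ((hqi i).pderiv hJ i).integrable ht]
    rw [Finset.sum_eq_zero fun i _ => TestFamilyOn.integral_pderiv_eq_zero ((hqi i).contDiff ht)
      ((hqi i).hasCompactSupport ht) i, add_zero]
  rw [intervalIntegral.integral_congr (g := fun t => ∫ x, deriv (fun τ => ∑ k, m τ x k * w τ x k) t)
    fun t ht => e t (h (by rwa [uIcc_of_le hab] at ht)), hq.integral_deriv_eq_sub hJ hab h]
  simp [ha, hb]

end ByParts

end SobolevDiff

namespace SobolevDiff

variable {n : ℕ} {P : Type*} [NormedAddCommGroup P] [NormedSpace ℝ P]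

/-! ### Mixed derivatives of a variation and the derivative of the energy. -/

theorem hasDerivAt_family_comp_apply {U : Set P} {f : P → E n → E n} (hU : IsOpen U)
    (hf : ContDiffOn ℝ ∞ (fun q : P × E n => f q.1 q.2) (U ×ˢ univ)) {γ : ℝ → P} {c : P} {t : ℝ}
    (hγ : HasDerivAt γ c t) (ht : γ t ∈ U) (x : E n) (k : Fin n) :
    HasDerivAt (fun τ => f (γ τ) x k)
      (fderiv ℝ (fun q : P × E n => f q.1 q.2) (γ t, x) (c, 0) k) t :=
  (EuclideanSpace.proj (𝕜 := ℝ) k).hasFDerivAt.comp_hasDerivAt t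
    (hasDerivAt_family_comp hU hf hγ ht x)

theorem fderiv_family_apply {U : Set P} {f : P → E n → E n} (hU : IsOpen U)
    (hf : ContDiffOn ℝ ∞ (fun q : P × E n => f q.1 q.2) (U ×ˢ univ)) {p : P} (hp : p ∈ U)
    (x ξ : E n) (k : Fin n) : fderiv ℝ (fun q : P × E n => f q.1 q.2) (p, x) (0, ξ) k =
      ∑ i, pderiv i (fun y => f p y k) x * ξ i := by
  set T := fderiv ℝ (fun q : P × E n => f q.1 q.2) (p, x)
  have h : HasFDerivAt (fun y => f p y k) ((EuclideanSpace.proj (𝕜 := ℝ) k).comp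
      (T.comp (ContinuousLinearMap.inr ℝ P (E n)))) x :=
    (EuclideanSpace.proj (𝕜 := ℝ) k).hasFDerivAt.comp x (hasFDerivAt_slice hU hf hp x)
  have e : ξ = ∑ i, ξ i • EuclideanSpace.single i (1 : ℝ) := by
    simpa using ((EuclideanSpace.basisFun (Fin n) ℝ).sum_repr ξ).symm
  have h2 : T (0, ξ) k = fderiv ℝ (fun y => f p y k) x ξ := by rw [h.fderiv]; simp
  rw [h2]
  conv_lhs => rw [e]
  simp [pderiv, mul_comm]

/-- The formula `∂_ε u = ∂_t w + Dw·u - Du·w` in coordinates: in `fderiv_paramField_comm` each total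
derivative is split into its parameter part and its transport part. -/
theorem SmoothFamilyOn.deriv_paramField_comm {Φ : ℝ × ℝ → DiffC n} {U : Set (ℝ × ℝ)}
    (hU : IsOpen U) (hΦ : SmoothFamilyOn U Φ) {ε t : ℝ} (hp : (ε, t) ∈ U) (x : E n) (k : Fin n) :
    deriv (fun ε => paramField Φ (0, 1) (ε, t) x k) ε =
      deriv (fun τ => paramField Φ (1, 0) (ε, τ) x k) t +
        ∑ i, (pderiv i (fun y => paramField Φ (1, 0) (ε, t) y k) x *
            paramField Φ (0, 1) (ε, t) x i -
          pderiv i (fun y => paramField Φ (0, 1) (ε, t) y k) x *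
            paramField Φ (1, 0) (ε, t) x i) := by
  have h := congrArg (fun v : E n => v k) (hΦ.fderiv_paramField_comm hU (0, 1) (1, 0) hp x)
  have hf (c : ℝ × ℝ) := (hΦ.testFamilyOn_paramField hU c).smooth
  have split (c d : ℝ × ℝ) (ξ : E n) :
      fderiv ℝ (fun q : (ℝ × ℝ) × E n => paramField Φ c q.1 q.2) ((ε, t), x) (d, ξ) k =
      fderiv ℝ (fun q : (ℝ × ℝ) × E n => paramField Φ c q.1 q.2) ((ε, t), x) (d, 0) k +
        ∑ i, pderiv i (fun y => paramField Φ c (ε, t) y k) x * ξ i := by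
    rw [← fderiv_family_apply hU (hf c) hp x ξ k, ← PiLp.add_apply, ← map_add, Prod.mk_add_mk,
      add_zero, zero_add]
  beta_reduce at h
  rw [split (0, 1) (1, 0), split (1, 0) (0, 1)] at h
  rw [← (hasDerivAt_family_comp_apply hU (hf (0, 1)) (γ := fun ε => (ε, t)) (t := ε)
      ((hasDerivAt_id ε).prodMk (hasDerivAt_const ε t)) hp x k).deriv,
    ← (hasDerivAt_family_comp_apply hU (hf (1, 0)) (γ := fun τ => (ε, τ)) (t := t)
      ((hasDerivAt_const t ε).prodMk (hasDerivAt_id t)) hp x k).deriv] at h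
  rw [Finset.sum_sub_distrib, ← add_sub_assoc, ← h, add_sub_cancel_right]

theorem testFamilyOn_eulerVelocity {J : Set ℝ} (hJ : IsOpen J) {φ : ℝ → DiffC n}
    (hφ : SmoothFamilyOn J φ) : TestFamilyOn J (eulerVelocity φ) :=
  (hφ.testFamilyOn_paramField hJ 1).congr fun t ht y =>
    eulerVelocity_eq_paramField hJ hφ (hasDerivAt_id t) ht y

theorem TestFamilyOn.isTestField {U : Set P} {u : P → E n → E n} (hu : TestFamilyOn U u) {p : P}
    (hp : p ∈ U) : IsTestField (u p) :=
  ⟨hu.contDiff hp, hu.hasCompactSupport hp⟩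

/-- A difference of squares for a symmetric form. In this shape the difference `v - w` is a factor,
so the derivative of `Abar s v` drops out when the energy is differentiated at `v = w`. -/
theorem integral_Abar_mul_self_sub {s : ℝ} (hs : 0 < s) {v w : E n → ℝ} (hv : ContDiff ℝ ∞ v)
    (hc : HasCompactSupport v) (hw : ContDiff ℝ ∞ w) (hwc : HasCompactSupport w) :
    ∫ x, (Abar s v x + Abar s w x) * (v x - w x) =
      (∫ x, Abar s v x * v x) - ∫ x, Abar s w x * w x := by
  have i1 := integrable_Abar_mul hs hv hc hv.continuous hc
  have i2 := integrable_Abar_mul hs hv hc hw.continuous hwc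
  have i3 := integrable_Abar_mul hs hw hwc hv.continuous hc
  have i4 := integrable_Abar_mul hs hw hwc hw.continuous hwc
  have e : ∫ x, Abar s w x * v x = ∫ x, Abar s v x * w x := by
    rw [integral_Abar_mul_comm hs hw hwc hv hc]
    simp only [mul_comm]
  have j1 : Integrable fun x => Abar s v x * v x - Abar s w x * w x := i1.sub i4
  have j2 : Integrable fun x => Abar s w x * v x - Abar s v x * w x := i3.sub i2
  calc ∫ x, (Abar s v x + Abar s w x) * (v x - w x) = ∫ x, ((Abar s v x * v x - Abar s w x * w x) +
        (Abar s w x * v x - Abar s v x * w x)) := by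
        congr 1 with x
        ring
    _ = _ := by
        rw [integral_add j1 j2, integral_sub i1 i4, integral_sub i3 i2, e,
          sub_self, add_zero]

theorem energy_eq {s : ℝ} (hs : 0 < s) {J : Set ℝ} (hJ : IsOpen J) {φ : ℝ → DiffC n}
    (hφ : SmoothFamilyOn J φ) {a b : ℝ} (hab : a ≤ b) (h : Icc a b ⊆ J) :
    energy s a b φ = (1 / 2) * ∫ t in a..b, ∫ x, ∑ k,
      Abar s (fun y => eulerVelocity φ t y k) x * eulerVelocity φ t x k := by
  unfold energy
  congr 1
  refine intervalIntegral.integral_congr fun t ht => ?_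
  have hX := (testFamilyOn_eulerVelocity hJ hφ).isTestField (h (by rwa [uIcc_of_le hab] at ht))
  exact hbarInner_eq_integral hs hX hX

/-- The first variation of the energy. -/
theorem hasDerivAt_energy {s : ℝ} (hs : 0 < s) {J : Set ℝ} (hJ : IsOpen J) {φ : ℝ → DiffC n}
    {a b : ℝ} (hab : a ≤ b) (h : Icc a b ⊆ J) {Φ : ℝ × ℝ → DiffC n}
    (hΦ : IsProperVariation J a b φ Φ) {m : ℝ → E n → E n}
    (hm : ContDiffOn ℝ ∞ (fun q : ℝ × E n => m q.1 q.2) (J ×ˢ univ))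
    (hmA : ∀ t ∈ J, ∀ x k, m t x k = Abar s (fun y => eulerVelocity φ t y k) x) :
    HasDerivAt (fun ε => energy s a b fun t => Φ (ε, t))
      (-∫ t in a..b, ∫ x, ∑ k, paramField Φ (1, 0) (0, t) x k *
        momentumDefect (eulerVelocity φ) m k t x) 0 := by
  obtain ⟨hS, hΦ0, hends⟩ := hΦ
  have hU : IsOpen ((univ : Set ℝ) ×ˢ J) := isOpen_univ.prod hJ
  set U := paramField Φ (0, 1) with hUdef
  set W := paramField Φ (1, 0) with hWdef
  have hUt : TestFamilyOn (univ ×ˢ J) U := hS.testFamilyOn_paramField hU _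
  have hWt : TestFamilyOn (univ ×ˢ J) W := hS.testFamilyOn_paramField hU _
  have smooth_zero : ContDiffOn ℝ ∞ (fun p : ℝ × ℝ => ((0 : ℝ), p.2)) (univ ×ˢ J) := by fun_prop
  have maps_zero : MapsTo (fun p : ℝ × ℝ => ((0 : ℝ), p.2)) (univ ×ˢ J) (univ ×ˢ J) :=
    fun p hp => ⟨mem_univ _, hp.2⟩
  have hU0 := hUt.comp_param smooth_zero maps_zero
  have hE (ε t : ℝ) (ht : t ∈ J) : eulerVelocity (fun τ => Φ (ε, τ)) t = U (ε, t) :=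
    funext fun y => eulerVelocity_eq_paramField hU hS (γ := fun τ => (ε, τ))
      ((hasDerivAt_const t ε).prodMk (hasDerivAt_id t)) ⟨mem_univ _, ht⟩ y
  have hφ0 (t : ℝ) (ht : t ∈ J) : eulerVelocity φ t = U (0, t) := by
    rw [← hE 0 t ht]
    have hv : velocity φ t = velocity (fun τ => Φ (0, τ)) t := by
      funext x
      refine Filter.EventuallyEq.deriv_eq ?_
      filter_upwards [hJ.mem_nhds ht] with τ hτ
      rw [hΦ0 τ hτ]
    simp only [eulerVelocity, hv, hΦ0 t ht]
  have hslice (ε : ℝ) : SmoothFamilyOn J fun t => Φ (ε, t) := by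
    refine ⟨hS.1.comp (f := fun q : ℝ × E n => ((ε, q.1), q.2)) (by fun_prop)
      fun q hq => ⟨⟨mem_univ _, hq.1⟩, mem_univ _⟩, fun K hKJ hK => ?_⟩
    obtain ⟨C, hC, hC0⟩ := hS.2 ({ε} ×ˢ K) (prod_mono (subset_univ _) hKJ)
      (isCompact_singleton.prod hK)
    exact ⟨C, hC, fun t ht x hx => hC0 (ε, t) ⟨rfl, ht⟩ x hx⟩
  have hM (k : Fin n) := (hUt.coord k).contDiffOn_Abar hs hU
  have hM0 (k : Fin n) := (hU0.coord k).contDiffOn_Abar hs hU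
  -- An integrand for the change of the energy from parameter `0` to `ε`, in the factored form of
  -- `integral_Abar_mul_self_sub`.
  set H : ℝ × ℝ → E n → ℝ := fun p x => (1 / 2) * ∑ k,
    (Abar s (fun y => U p y k) x + Abar s (fun y => U (0, p.2) y k) x) *
      (U p x k - U (0, p.2) x k) with hH
  have hHt : TestFamilyOn (univ ×ˢ J) H := by
    refine TestFamilyOn.mul_left (TestFamilyOn.sum _ fun k => ?_) contDiffOn_const
    exact ((hUt.coord k).sub (hU0.coord k)).mul_left
      (a := fun p x => Abar s (fun y => U p y k) x + Abar s (fun y => U (0, p.2) y k) x)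
      ((hM k).add (hM0 k))
  have hHJ (ε : ℝ) : TestFamilyOn J fun t => H (ε, t) :=
    hHt.comp_param (f := fun t => (ε, t)) (by fun_prop) fun t ht => ⟨mem_univ _, ht⟩
  have hUJ (ε : ℝ) : TestFamilyOn J fun t => U (ε, t) :=
    hUt.comp_param (f := fun t => (ε, t)) (by fun_prop) fun t ht => ⟨mem_univ _, ht⟩
  have hWJ : TestFamilyOn J fun t => W (0, t) :=
    hWt.comp_param (f := fun t => (0, t)) (by fun_prop) fun t ht => ⟨mem_univ _, ht⟩
  have hQ (ε : ℝ) : TestFamilyOn J fun t x => ∑ k, Abar s (fun y => U (ε, t) y k) x * U (ε, t) x k :=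
    TestFamilyOn.sum _ fun k => ((hUJ ε).coord k).mul_left
      (a := fun t x => Abar s (fun y => U (ε, t) y k) x) (((hUJ ε).coord k).contDiffOn_Abar hs hJ)
  have henergy (ε : ℝ) : energy s a b (fun t => Φ (ε, t)) = (1 / 2) * ∫ t in a..b, ∫ x, ∑ k,
      Abar s (fun y => U (ε, t) y k) x * U (ε, t) x k := by
    rw [energy_eq hs hJ (hslice ε) hab h]
    congr 1
    refine intervalIntegral.integral_congr fun t ht => ?_
    simp only [hE ε t (h (by rwa [uIcc_of_le hab] at ht))]
  have hdiff (ε : ℝ) : energy s a b (fun t => Φ (ε, t)) =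
      energy s a b (fun t => Φ (0, t)) + ∫ t in a..b, ∫ x, H (ε, t) x := by
    rw [henergy, henergy, ← intervalIntegral.integral_const_mul,
      ← intervalIntegral.integral_const_mul, ← intervalIntegral.integral_add
        (((hQ 0).intervalIntegrable_integral hJ hab h).const_mul _)
        ((hHJ ε).intervalIntegrable_integral hJ hab h)]
    refine intervalIntegral.integral_congr fun t ht => ?_
    have htJ := h (by rwa [uIcc_of_le hab] at ht)
    have hc (ε : ℝ) (k : Fin n) := ((hUJ ε).isTestField htJ).apply k
    have hi (ε : ℝ) (k : Fin n) := integrable_Abar_mul hs (hc ε k).1 (hc ε k).2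
      (hc ε k).1.continuous (hc ε k).2
    have hk (k : Fin n) := integral_Abar_mul_self_sub hs (hc ε k).1 (hc ε k).2 (hc 0 k).1 (hc 0 k).2
    have hik (k : Fin n) : Integrable fun x =>
        (Abar s (fun y => U (ε, t) y k) x + Abar s (fun y => U (0, t) y k) x) *
          (U (ε, t) x k - U (0, t) x k) := by
      refine ((integrable_Abar_mul hs (hc ε k).1 (hc ε k).2 ((hc ε k).1.sub (hc 0 k).1).continuous
        ((hc ε k).2.sub (hc 0 k).2)).add (integrable_Abar_mul hs (hc 0 k).1 (hc 0 k).2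
        ((hc ε k).1.sub (hc 0 k).1).continuous ((hc ε k).2.sub (hc 0 k).2))).congr
        (Eventually.of_forall fun x => ?_)
      simp only [Pi.add_apply]
      ring
    simp only [hH]
    rw [integral_const_mul, integral_finsetSum _ fun k _ => hi ε k,
      integral_finsetSum _ fun k _ => hi 0 k, integral_finsetSum _ fun k _ => hik k]
    simp_rw [hk]
    rw [Finset.sum_sub_distrib]
    ring
  have hderiv := (hHt.hasDerivAt_integral_integral hJ hab h 0).const_add
    (energy s a b (fun t => Φ (0, t)))
  simp_rw [← hdiff] at hderiv
  -- At a time when the variation does not depend on `ε`, the variation field vanishes; this removes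
  -- the boundary terms in time.
  have hW0 (t₀ : ℝ) (ht₀ : t₀ ∈ J) (hfix : ∀ ε, Φ (ε, t₀) = φ t₀) (x : E n) : W (0, t₀) x = 0 := by
    have h1 := hasDerivAt_family_comp (F := E n) hU hS.1 (f := fun p x => (Φ p).1 x)
      (γ := fun ε => (ε, t₀))
      (t := 0) ((hasDerivAt_id (0 : ℝ)).prodMk (hasDerivAt_const (0 : ℝ) t₀)) ⟨mem_univ _, ht₀⟩
      ((Φ (0, t₀)).1.symm x)
    simp only [hfix] at h1
    have h2 := h1.unique (hasDerivAt_const _ _)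
    rw [hWdef, paramField]
    simpa only [hfix] using h2
  have hparts := integral_variation_eq_neg_integral_defect hJ
    ((hUJ 0).congr fun t ht y => congrFun (hφ0 t ht) y) hWJ hm hab h
    (hW0 a (h (left_mem_Icc.2 hab)) fun ε => (hends ε).1)
    (hW0 b (h (right_mem_Icc.2 hab)) fun ε => (hends ε).2)
  rw [← hparts]
  refine hderiv.congr_deriv (Eq.symm ?_)
  refine intervalIntegral.integral_congr fun t ht => ?_
  have htJ := h (by rwa [uIcc_of_le hab] at ht)
  refine integral_congr_ae (Eventually.of_forall fun x => ?_)
  have hd (k : Fin n) : HasDerivAt (fun ε => U (ε, t) x k) (deriv (fun ε => U (ε, t) x k) 0) 0 :=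
    (hasDerivAt_family_comp_apply hU hUt.smooth (γ := fun ε => (ε, t)) (t := 0)
      ((hasDerivAt_id (0 : ℝ)).prodMk (hasDerivAt_const (0 : ℝ) t)) ⟨mem_univ _, htJ⟩
        x k).differentiableAt.hasDerivAt
  have hdM (k : Fin n) : HasDerivAt (fun ε => Abar s (fun y => U (ε, t) y k) x)
      (deriv (fun ε => Abar s (fun y => U (ε, t) y k) x) 0) 0 :=
    (hasDerivAt_family_comp hU (hM k) (f := fun p x => Abar s (fun y => U p y k) x)
      (γ := fun ε => (ε, t)) (t := 0)
      ((hasDerivAt_id (0 : ℝ)).prodMk (hasDerivAt_const (0 : ℝ) t)) ⟨mem_univ _, htJ⟩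
        x).differentiableAt.hasDerivAt
  -- At `ε = 0` the derivative of the first factor is multiplied by `u - u = 0`, and the first
  -- factor itself equals `2 m`, which cancels the `1 / 2`.
  have hdH := (HasDerivAt.fun_sum (u := Finset.univ) fun k _ =>
    ((hdM k).add_const (Abar s (fun y => U (0, t) y k) x)).mul
      ((hd k).sub_const (U (0, t) x k))).const_mul (1 / 2 : ℝ)
  have e := hdH.deriv
  simp only [hH]
  refine Eq.trans ?_ e.symm
  rw [Finset.mul_sum]
  refine Finset.sum_congr rfl fun k _ => ?_
  rw [hmA t htJ, hφ0 t htJ, hUdef, hS.deriv_paramField_comm hU ⟨mem_univ _, htJ⟩]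
  ring

end SobolevDiff

namespace SobolevDiff

variable {n : ℕ}

/-! ### Perturbations of the identity -/

/-- A smooth perturbation of the identity that is small in `C¹` is a diffeomorphism. -/
theorem exists_diffC_eq_add {Y : E n → E n} (hY : IsTestField Y)
    (hL : LipschitzWith (1 / 2) Y) : ∃ S : DiffC n, ∀ x, S.1 x = x + Y x := by
  set f : E n → E n := fun x => x + Y x with hf
  have hfc : ContDiff ℝ ∞ f := contDiff_id.add hY.1
  have happ : ApproximatesLinearOn f (ContinuousLinearEquiv.refl ℝ (E n) : E n →L[ℝ] E n) univ
      (1 / 2) := by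
    intro x _ y _
    have e : f x - f y - (ContinuousLinearEquiv.refl ℝ (E n) : E n →L[ℝ] E n) (x - y) =
        Y x - Y y := by
      change x + Y x - (y + Y y) - (x - y) = Y x - Y y
      abel
    rw [e]
    exact hL.norm_sub_le x y
  have hsmall : Subsingleton (E n) ∨
      (1 / 2 : NNReal) < ‖((ContinuousLinearEquiv.refl ℝ (E n)).symm : E n →L[ℝ] E n)‖₊⁻¹ := by
    rcases subsingleton_or_nontrivial (E n) with h | h
    · exact Or.inl h
    · right
      have h1 : ‖((ContinuousLinearEquiv.refl ℝ (E n)).symm : E n →L[ℝ] E n)‖₊ = 1 :=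
        ContinuousLinearMap.nnnorm_id
      rw [h1, inv_one]
      exact NNReal.half_lt_self one_ne_zero
  let h := happ.toHomeomorph f hsmall
  have hcoe : ⇑h = f := rfl
  have hlt (x : E n) : ‖-fderiv ℝ Y x‖ < 1 := by
    rw [norm_neg]
    refine (norm_fderiv_le_of_lipschitz ℝ hL).trans_lt ?_
    rw [NNReal.coe_div, NNReal.coe_one, NNReal.coe_ofNat]
    norm_num
  -- The derivative `1 + DY` is invertible by the Neumann series, as `‖DY‖ ≤ 1/2`; hence the inverse
  -- homeomorphism is smooth.
  have hd (x : E n) : HasFDerivAt h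
      (ContinuousLinearEquiv.ofUnit (Units.oneSub (-fderiv ℝ Y x) (hlt x)) : E n →L[ℝ] E n) x := by
    have h1 := (hasFDerivAt_id (𝕜 := ℝ) x).add (hY.1.differentiable (by simp) x).hasFDerivAt
    refine h1.congr_fderiv ?_
    ext1 v
    exact congrArg (v + ·) (neg_neg (fderiv ℝ Y x v)).symm
  let D : E n ≃ₘ^∞⟮𝓘(ℝ, E n), 𝓘(ℝ, E n)⟯ E n :=
    { toEquiv := h.toEquiv
      contMDiff_toFun := hfc.contMDiff
      contMDiff_invFun := (h.contDiff_symm hd hfc).contMDiff }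
  have hD (x : E n) : D x = x + Y x := rfl
  refine ⟨⟨D, ?_⟩, hD⟩
  simp only [hD, add_sub_cancel_left]
  exact hY.2

theorem hasCompactSupport_trans_sub (S φ : DiffC n) :
    HasCompactSupport fun x => (φ.1.trans S.1) x - x := by
  have h1 : HasCompactSupport fun x => φ.1 x - x := φ.2
  have h2 : HasCompactSupport fun x => S.1 x - x := S.2
  refine HasCompactSupport.intro (IsCompact.union h1 h2) fun x hx => ?_
  rw [mem_union, not_or] at hx
  have e1 : φ.1 x = x :=
    sub_eq_zero.1 (image_eq_zero_of_notMem_tsupport (f := fun x => φ.1 x - x) hx.1)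
  have e2 : S.1 x = x :=
    sub_eq_zero.1 (image_eq_zero_of_notMem_tsupport (f := fun x => S.1 x - x) hx.2)
  rw [Diffeomorph.coe_trans, Function.comp_apply, e1, e2, sub_self]

/-- Composition in `Diff_c(ℝⁿ)`. -/
def diffComp (S φ : DiffC n) : DiffC n := ⟨φ.1.trans S.1, hasCompactSupport_trans_sub S φ⟩

theorem diffComp_apply (S φ : DiffC n) (x : E n) : (diffComp S φ).1 x = S.1 (φ.1 x) := rfl

/-- If `X` is `L`-Lipschitz, then `r • X` is `1/2`-Lipschitz for `|r| ≤ 1 / (2 * (L + 1))`; the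
summand `1` covers `L = 0`. -/
theorem exists_diffC_family {X : E n → E n} (hX : IsTestField X) :
    ∃ r₀ > 0, ∃ S : ℝ → DiffC n, ∀ r, |r| ≤ r₀ → ∀ x, (S r).1 x = x + r • X x := by
  obtain ⟨L, hL⟩ := hX.1.lipschitzWith_of_hasCompactSupport hX.2 (by simp)
  have h (r : ℝ) (hr : |r| ≤ 1 / (2 * (L + 1))) : ∃ S : DiffC n, ∀ x, S.1 x = x + r • X x := by
    have hY : IsTestField fun x => r • X x :=
      ⟨hX.1.const_smul r, hX.2.comp_left (g := fun v : E n => r • v) (smul_zero r)⟩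
    refine exists_diffC_eq_add hY ?_
    refine LipschitzWith.of_dist_le_mul fun x y => ?_
    rw [dist_eq_norm, dist_eq_norm, ← smul_sub, norm_smul, Real.norm_eq_abs]
    calc |r| * ‖X x - X y‖ ≤ 1 / (2 * (L + 1)) * (L * ‖x - y‖) := by
          gcongr
          exact hL.norm_sub_le x y
      _ = (L / (L + 1)) * (1 / 2 * ‖x - y‖) := by field_simp
      _ ≤ 1 * (1 / 2 * ‖x - y‖) := by
          gcongr
          exact div_le_one_of_le₀ (by linarith) (by positivity)
      _ = _ := by rw [one_mul]; norm_num
  -- Outside the admissible range of `r` the value does not matter; it is the identity, the member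
  -- of the family at `r = 0`.
  refine ⟨1 / (2 * (L + 1)), by positivity, fun r => if hr : |r| ≤ 1 / (2 * (L + 1)) then
    (h r hr).choose else (h 0 (by rw [abs_zero]; positivity)).choose, fun r hr x => ?_⟩
  simp only [dif_pos hr]
  exact (h r hr).choose_spec x

theorem diffC_ext {φ χ : DiffC n} (h : ∀ x, φ.1 x = χ.1 x) : φ = χ :=
  Subtype.ext (Diffeomorph.ext h)

/-- A variation in the direction of a multiple of `θ(t) X`. -/
theorem exists_properVariation {J : Set ℝ} (hJ : IsOpen J) {φ : ℝ → DiffC n}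
    (hφ : SmoothFamilyOn J φ) {a b : ℝ} {X : E n → E n} (hX : IsTestField X) {θ : ℝ → ℝ}
    (hθ : ContDiff ℝ ∞ θ) (hθc : HasCompactSupport θ) (ha : θ a = 0) (hb : θ b = 0) :
    ∃ δ > 0, ∃ Φ : ℝ × ℝ → DiffC n, IsProperVariation J a b φ Φ ∧
      ∀ t ∈ J, ∀ y, paramField Φ (1, 0) (0, t) y = (δ * θ t) • X y := by
  obtain ⟨r₀, hr₀, S, hS⟩ := exists_diffC_family hX
  obtain ⟨B, hB⟩ := hθc.exists_bound_of_continuous hθ.continuous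
  have hB0 : 0 ≤ B := (norm_nonneg _).trans (hB 0)
  -- A variation must be defined for all real `ε`. Hence `sin ε`, bounded and with derivative one at
  -- `0`, replaces `ε`, and `δ` scales the amplitude into the range where `id + r X` is a
  -- diffeomorphism.
  set δ := r₀ / (B + 1) with hδ
  have hδ0 : 0 < δ := by positivity
  have hr (ε t : ℝ) : |δ * Real.sin ε * θ t| ≤ r₀ := by
    rw [abs_mul, abs_mul, abs_of_pos hδ0]
    calc δ * |Real.sin ε| * |θ t| ≤ δ * 1 * (B + 1) := by
          gcongr
          · exact Real.abs_sin_le_one ε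
          · exact (hB t).trans (by linarith)
      _ = r₀ := by rw [hδ]; field_simp
  set Φ : ℝ × ℝ → DiffC n := fun p => diffComp (S (δ * Real.sin p.1 * θ p.2)) (φ p.2) with hΦ
  have hΦx (p : ℝ × ℝ) (x : E n) : (Φ p).1 x =
      (φ p.2).1 x + (δ * Real.sin p.1 * θ p.2) • X ((φ p.2).1 x) := by
    rw [hΦ, diffComp_apply, hS _ (hr _ _)]
  have hfam : SmoothFamilyOn (univ ×ˢ J) Φ := by
    refine ⟨?_, fun K hKU hK => ?_⟩
    · simp only [hΦx]
      have h1 : ContDiffOn ℝ ∞ (fun q : (ℝ × ℝ) × E n => (φ q.1.2).1 q.2)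
          ((univ ×ˢ J) ×ˢ univ) :=
        hφ.1.comp (f := fun q : (ℝ × ℝ) × E n => (q.1.2, q.2)) (by fun_prop)
          fun q hq => ⟨hq.1.2, mem_univ _⟩
      have h4 : ContDiffOn ℝ ∞ (fun q : (ℝ × ℝ) × E n => X ((φ q.1.2).1 q.2))
          ((univ ×ˢ J) ×ˢ univ) := hX.1.comp_contDiffOn h1
      have h2 : ContDiff ℝ ∞ fun q : (ℝ × ℝ) × E n => θ q.1.2 := hθ.comp (by fun_prop)
      have h3 : ContDiff ℝ ∞ fun q : (ℝ × ℝ) × E n => Real.sin q.1.1 :=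
        Real.contDiff_sin.comp (by fun_prop)
      exact h1.add (((contDiff_const.mul h3).mul h2).contDiffOn.smul h4)
    · obtain ⟨C, hC, h0⟩ := hφ.2 (Prod.snd '' K)
        (by rintro _ ⟨p, hp, rfl⟩; exact (hKU hp).2) (hK.image continuous_snd)
      refine ⟨C ∪ tsupport X, hC.union hX.2.isCompact, fun p hp x hx => ?_⟩
      rw [mem_union, not_or] at hx
      rw [hΦx, h0 p.2 (mem_image_of_mem _ hp) x hx.1, image_eq_zero_of_notMem_tsupport hx.2,
        smul_zero, add_zero]
  refine ⟨δ, hδ0, Φ, ⟨hfam, fun t _ => diffC_ext fun x => ?_, fun ε => ⟨diffC_ext fun x => ?_,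
    diffC_ext fun x => ?_⟩⟩, fun t ht y => ?_⟩
  · simp [hΦx]
  · simp [hΦx, ha]
  · simp [hΦx, hb]
  · set x := (Φ (0, t)).1.symm y with hx
    have hxy : (φ t).1 x = y := by
      have h1 : (Φ (0, t)).1 x = y := (Φ (0, t)).1.apply_symm_apply y
      simpa [hΦx] using h1
    have h1 := hasDerivAt_family_comp (F := E n) (isOpen_univ.prod hJ) hfam.1
      (f := fun p x => (Φ p).1 x) (γ := fun ε => (ε, t)) (t := 0)
      ((hasDerivAt_id (0 : ℝ)).prodMk (hasDerivAt_const (0 : ℝ) t)) ⟨mem_univ _, ht⟩ x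
    simp only [hΦx] at h1
    have h2 : HasDerivAt (fun ε => (φ t).1 x + (δ * Real.sin ε * θ t) • X ((φ t).1 x))
        ((δ * Real.cos 0 * θ t) • X ((φ t).1 x)) 0 :=
      ((((Real.hasDerivAt_sin 0).const_mul δ).mul_const (θ t)).smul_const _).const_add _
    have h3 := h1.unique h2
    rw [Real.cos_zero, mul_one, hxy] at h3
    rw [paramField, ← h3]
    simp only [hΦx, hx]

/-- The fundamental lemma of the calculus of variations for the energy. -/
theorem IsGeodesicOn.momentumDefect_eq_zero {s : ℝ} (hs : 0 < s) {J : Set ℝ} (hJ : IsOpen J)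
    {φ : ℝ → DiffC n} (hφ : SmoothFamilyOn J φ) (hg : IsGeodesicOn s J φ) {m : ℝ → E n → E n}
    (hm : ContDiffOn ℝ ∞ (fun q : ℝ × E n => m q.1 q.2) (J ×ˢ univ))
    (hmA : ∀ t ∈ J, ∀ x k, m t x k = Abar s (fun y => eulerVelocity φ t y k) x)
    {t : ℝ} (ht : t ∈ J) (x : E n) (k : Fin n) :
    momentumDefect (eulerVelocity φ) m k t x = 0 := by
  set R := momentumDefect (eulerVelocity φ) m with hR
  have hRs (j : Fin n) : ContDiffOn ℝ ∞ (fun q : ℝ × E n => R j q.1 q.2) (J ×ˢ univ) :=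
    contDiffOn_momentumDefect hJ (testFamilyOn_eulerVelocity hJ hφ) hm j
  obtain ⟨r, hr, hball⟩ := Metric.isOpen_iff.1 hJ t ht
  set a := t - r / 2 with ha
  set b := t + r / 2 with hb
  have hab : a < b := by rw [ha, hb]; linarith
  have hI : Icc a b ⊆ J := by
    refine Subset.trans (fun τ hτ => ?_) hball
    rw [Metric.mem_ball, Real.dist_eq, abs_lt]
    constructor <;> linarith [hτ.1, hτ.2]
  -- The fundamental lemma is applied twice: for fixed `ψ` in time, with the field `θ(t) ψ(x) e_k`,
  -- and afterwards in space.
  have key (ψ : E n → ℝ) (hψ : ContDiff ℝ ∞ ψ) (hψc : HasCompactSupport ψ) :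
      ∫ x, ψ x * R k t x = 0 := by
    have hψR : TestFamilyOn J fun t x => ψ x * R k t x := by
      refine TestFamilyOn.mul_right (u := fun _ => ψ) ⟨?_, fun K _ _ =>
        ⟨_, hψc.isCompact, fun _ _ y hy => image_eq_zero_of_notMem_tsupport hy⟩⟩ (hRs k)
      exact (hψ.comp contDiff_snd).contDiffOn
    have hcont := hψR.continuousOn_integral hJ
    have hIoo : Ioo a b ⊆ J := Ioo_subset_Icc_self.trans hI
    have hz : ∀ᵐ τ, τ ∈ Ioo a b → ∫ x, ψ x * R k τ x = 0 := by
      refine isOpen_Ioo.ae_eq_zero_of_integral_contDiff_smul_eq_zero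
        ((hcont.mono hIoo).locallyIntegrableOn measurableSet_Ioo) fun θ hθ hθc hθs => ?_
      have hθ0 (τ : ℝ) (hτ : τ ∉ Ioo a b) : θ τ = 0 :=
        image_eq_zero_of_notMem_tsupport fun h => hτ (hθs h)
      have hX : IsTestField fun y : E n => ψ y • EuclideanSpace.single k (1 : ℝ) :=
        ⟨hψ.smul contDiff_const, hψc.smul_right⟩
      obtain ⟨δ, hδ, Φ, hΦ, hW⟩ := exists_properVariation hJ hφ hX hθ hθc
        (hθ0 a fun h => lt_irrefl _ h.1) (hθ0 b fun h => lt_irrefl _ h.2)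
      -- The derivative of the energy is zero for a geodesic, and the first variation computes it as
      -- `-δ` times the pairing of `θ` with `∫ ψ R`.
      have h0 := (hg a b hab hI Φ hΦ).unique (hasDerivAt_energy hs hJ hab.le hI hΦ hm hmA)
      have h1 : ∫ τ in a..b, ∫ x, ∑ j, paramField Φ (1, 0) (0, τ) x j * R j τ x =
          ∫ τ in a..b, δ * (θ τ • ∫ x, ψ x * R k τ x) := by
        refine intervalIntegral.integral_congr fun τ hτ => ?_
        have hτJ := hI (by rwa [uIcc_of_le hab.le] at hτ)
        simp only [smul_eq_mul]
        rw [← mul_assoc, ← integral_const_mul]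
        congr 1 with y
        rw [Finset.sum_eq_single k]
        · rw [hW τ hτJ]
          simp [mul_assoc]
        · intro j _ hj
          rw [hW τ hτJ]
          simp [hj]
        · simp
      rw [h1, intervalIntegral.integral_const_mul, eq_comm, neg_eq_zero] at h0
      rw [← intervalIntegral.integral_eq_integral_of_support_subset (a := a) (b := b)]
      · exact (mul_eq_zero.1 h0).resolve_left hδ.ne'
      · intro τ hτ
        by_contra hc
        refine hτ ?_
        simp only
        rw [hθ0 τ fun h => hc (Ioo_subset_Ioc_self h), zero_smul]
    -- Continuity in time turns vanishing almost everywhere into vanishing at the midpoint `t`.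
    have hz2 : EqOn (fun τ => ∫ x, ψ x * R k τ x) (fun _ => 0) (Ioo a b) :=
      Measure.eqOn_open_of_ae_eq (μ := volume) ((ae_restrict_iff' measurableSet_Ioo).2 hz)
        isOpen_Ioo (hcont.mono hIoo) continuousOn_const
    exact hz2 ⟨by rw [ha]; linarith, by rw [hb]; linarith⟩
  have hRc : Continuous (R k t) := by
    rw [← continuousOn_univ]
    exact (hRs k).continuousOn.comp (f := fun x => (t, x)) (by fun_prop) fun x _ => ⟨ht, mem_univ _⟩
  have hae := ae_eq_zero_of_integral_contDiff_smul_eq_zero hRc.locallyIntegrable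
    fun ψ hψ hψc => by simpa only [smul_eq_mul] using key ψ hψ hψc
  exact congrFun ((Continuous.ae_eq_iff_eq volume hRc (continuous_const (y := (0 : ℝ)))).1 hae) x

end SobolevDiff

namespace SobolevDiff

variable {n : ℕ}

/-! ### The geodesic equation -/

/-- The momentum `Abar u` of a time dependent vector field. -/
def momentum (s : ℝ) (u : ℝ → E n → E n) (t : ℝ) (x : E n) : E n :=
  WithLp.toLp 2 fun k => Abar s (fun y => u t y k) x

theorem contDiffOn_momentum {s : ℝ} (hs : 0 < s) {J : Set ℝ} (hJ : IsOpen J) {u : ℝ → E n → E n}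
    (hu : TestFamilyOn J u) :
    ContDiffOn ℝ ∞ (fun q : ℝ × E n => momentum s u q.1 q.2) (J ×ˢ univ) :=
  contDiffOn_euclidean.2 fun k => (hu.coord k).contDiffOn_Abar hs hJ

/-- `K` represents the inverse of `Abar` by convolution. -/
def RepresentsInverse (s : ℝ) (K : E n → ℝ) : Prop :=
  ∀ v : E n → ℝ, ContDiff ℝ ∞ v → HasCompactSupport v → ∀ g : E n → ℝ, Continuous g →
    MemLp g 2 volume → (IsKernelConv K g v ↔ g = Abar s v)

theorem RepresentsInverse.eq_Abar {s : ℝ} {K : E n → ℝ} (hK : RepresentsInverse s K)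
    {J : Set ℝ} {u m : ℝ → E n → E n} (hu : TestFamilyOn J u)
    (h : SolvesMomentumSystem J K u m) {t : ℝ} (ht : t ∈ J) (x : E n) (k : Fin n) :
    m t x k = Abar s (fun y => u t y k) x := by
  obtain ⟨hm, hsol⟩ := h
  obtain ⟨hL2, -, hconv⟩ := hsol t ht k
  have hc : Continuous fun x => m t x k := by
    rw [← continuousOn_univ]
    exact (contDiffOn_apply hm k).continuousOn.comp (f := fun x => (t, x)) (by fun_prop)
      fun x _ => ⟨ht, mem_univ _⟩
  exact congrFun ((hK _ ((hu.coord k).contDiff ht) ((hu.coord k).hasCompactSupport ht) _ hc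
    hL2).1 hconv) x

/-- The convolution equation forces `m = Abar u`, so the first variation formula applies in both
directions: a geodesic has zero defect by the fundamental lemma, and zero defect makes the energy
critical under every proper variation. -/
theorem isGeodesicOn_iff_solvesMomentumSystem {s : ℝ} (hs : 0 < s) {K : E n → ℝ}
    (hK : RepresentsInverse s K) {J : Set ℝ} (hJ : IsOpen J) {φ : ℝ → DiffC n}
    (hφ : SmoothFamilyOn J φ) :
    IsGeodesicOn s J φ ↔ ∃ m, SolvesMomentumSystem J K (eulerVelocity φ) m := by
  have hu := testFamilyOn_eulerVelocity hJ hφ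
  constructor
  · intro hg
    have hm := contDiffOn_momentum hs hJ hu
    refine ⟨momentum s (eulerVelocity φ), hm, fun t ht k => ?_⟩
    have hc := (hu.coord k).contDiff ht
    have hcs := (hu.coord k).hasCompactSupport ht
    refine ⟨memLp_Abar hs hc hcs, fun x => ?_, (hK _ hc hcs _ (continuous_Abar hs hc hcs)
      (memLp_Abar hs hc hcs)).2 rfl⟩
    have h1 := hasDerivAt_family (f := fun t x => momentum s (eulerVelocity φ) t x k) hJ
      (contDiffOn_apply hm k) ht x
    have h2 := hg.momentumDefect_eq_zero hs hJ hφ hm (fun _ _ _ _ => rfl) ht x k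
    rwa [eq_neg_of_add_eq_zero_left h2] at h1
  · rintro ⟨m, hm⟩ a b hab hI Φ hΦ
    have hA (t : ℝ) (ht : t ∈ J) (x : E n) (k : Fin n) := hK.eq_Abar hu hm ht x k
    refine (hasDerivAt_energy hs hJ hab.le hI hΦ hm.1 hA).congr_deriv ?_
    rw [neg_eq_zero]
    refine (intervalIntegral.integral_congr (g := fun _ => (0 : ℝ)) fun t ht => ?_).trans (by simp)
    have htJ := hI (by rwa [uIcc_of_le hab.le] at ht)
    refine integral_eq_zero_of_ae (Eventually.of_forall fun x => ?_)
    refine Finset.sum_eq_zero fun k _ => ?_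
    rw [momentumDefect, ((hm.2 t htJ k).2.1 x).deriv, neg_add_cancel, mul_zero]

end SobolevDiff

end

open SobolevDiff in
theorem mainTheorem7 (n : ℕ) (hn : 1 ≤ n) (s : ℝ) (hs : 0 < s) :
    -- `Ā_s` is a bounded isomorphism from `H^(k+2s)` onto `H^k`, and preserves real functions
    (∀ k : ℝ, 0 ≤ k →
      ∃ T : SobolevSpace n (k + 2 * s) ≃ₗ[ℂ] SobolevSpace n k,
        (∀ f : SobolevSpace n (k + 2 * s), (𝓕 (T f : L2 n) : L2 n) =ᵐ[volume]
          fun η => (abarSymbol s η : ℂ) * (𝓕 (f : L2 n) : L2 n) η) ∧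
        (∃ C : ℝ, 0 < C ∧ ∀ f : SobolevSpace n (k + 2 * s),
          sobolevNorm k (T f : L2 n) ≤ C * sobolevNorm (k + 2 * s) (f : L2 n) ∧
          sobolevNorm (k + 2 * s) (f : L2 n) ≤ C * sobolevNorm k (T f : L2 n)) ∧
        (∀ f : SobolevSpace n (k + 2 * s), (∀ᵐ x, ((f : L2 n) x).im = 0) ↔
          ∀ᵐ x, ((T f : L2 n) x).im = 0) ∧
        (∀ (f : SobolevSpace n (k + 2 * s)) (v : E n → ℝ),
          ContDiff ℝ ∞ v → HasCompactSupport v →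
          ((f : L2 n) =ᵐ[volume] fun x => (v x : ℂ)) →
          ((T f : L2 n) =ᵐ[volume] fun x => (Abar s v x : ℂ)))) ∧
    -- `Ā_s` induces the metric `Ḡˢ`
    (∀ (φ : DiffC n) (X Y : E n → E n), IsTestField X → IsTestField Y →
      (∀ k, Integrable fun x => Abar s (fun y => rightTriv φ X y k) x * rightTriv φ Y x k) ∧
      Gbar s φ X Y =
        ∫ x, ∑ k, Abar s (fun y => rightTriv φ X y k) x * rightTriv φ Y x k) ∧
    ∃ K : E n → ℝ, IsHankelKernel n s K ∧
      -- convolution with the kernel inverts `Ā_s`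
      (∀ v : E n → ℝ, ContDiff ℝ ∞ v → HasCompactSupport v →
        Continuous (Abar s v) ∧ MemLp (Abar s v) 2 volume ∧
        ∀ g : E n → ℝ, Continuous g → MemLp g 2 volume →
          (IsKernelConv K g v ↔ g = Abar s v)) ∧
      -- the geodesic equation of `Ḡˢ`
      (∀ (J : Set ℝ), IsOpen J → ∀ φ : ℝ → DiffC n, SmoothFamilyOn J φ →
        (IsGeodesicOn s J φ ↔
          ∃ m : ℝ → E n → E n, SolvesMomentumSystem J K (eulerVelocity φ) m) ∧
        (∀ m : ℝ → E n → E n, SolvesMomentumSystem J K (eulerVelocity φ) m →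
          ∀ t ∈ J, ∀ x k, m t x k = Abar s (fun y => eulerVelocity φ t y k) x)) := by
  -- The function `k` carries the Fourier analysis, and `K` is the representative of `(2π)^(n/2) k`
  -- fixed by the improper integral; the geodesic equation only uses that `K` represents the inverse
  -- of `Abar`.
  obtain ⟨k, hk, hke, hF⟩ := exists_resolventKernel (n := n) hs
  obtain ⟨K, hK, hKk⟩ := exists_hankelKernel hn hs hk hF
  have hR : RepresentsInverse s K := fun v hv hc g hg hg2 =>
    isKernelConv_iff_eq_Abar hn hs hk hke hF hKk hv hc hg hg2
  refine ⟨exists_sobolev_isomorphism hs, Gbar_eq_integral hs, K, hK, fun v hv hc =>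
    ⟨continuous_Abar hs hv hc, memLp_Abar hs hv hc, hR v hv hc⟩, fun J hJ φ hφ =>
    ⟨isGeodesicOn_iff_solvesMomentumSystem hs hR hJ hφ, fun m hm t ht x j =>
      hR.eq_Abar (testFamilyOn_eulerVelocity hJ hφ) hm ht x j⟩⟩
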